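/- Consider equations $$u_t+\alpha(t)\,u\,u_x+\beta(t)\,u_{xxx}+\sigma(t)\,u_{xxxxx}=0 \qquad (1)$$ whose coefficients $\alpha,\beta,\sigma$ are smooth nonvanishing real functions on a nonempty open interval $I$; the gauged class is the subclass with $\alpha=1$. The maximal Lie invariance algebra $A^{\max}$ of an equation is the space of all smooth vector fields $Q=\tau\partial_t+\xi\partial_x+\eta\partial_u$ on $I\times\mathbb R^2$, with $\tau,\xi,\eta$ functions of $(t,x,u)$, whose fifth prolongation annihilates the left-hand side of the equation at every jet satisfying the equation. The usual equivalence group $G^\sim_{\alpha=n=1}$ of the gauged class consists of the transformations $$\tilde t=\frac{at+b}{ct+d},\quad \tilde x=\frac{e_2x+e_1t+e_0}{ct+d},\quad \tilde u=\frac{e_2(ct+d)u-e_2cx-e_0c+e_1d}{\Delta},\quad \tilde\beta(\tilde t)=\frac{e_2^3}{ct+d}\frac{\beta(t)}{\Delta},\quad \tilde\sigma(\tilde t)=\frac{e_2^5}{(ct+d)^3}\frac{\sigma(t)}{\Delta}$$ with constants such that $\Delta=ad-bc\neq0$, $e_2\ne0$. The generalized extended equivalence group $\hat G^\sim_{n=1}$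 of class (1) consists of the transformations $$\tilde t=T(t),\quad \tilde x=(x+\delta_1)X^1+\delta_0,\quad \tilde u=\frac{\delta_2}{X^1}u-\delta_2\delta_3(x+\delta_1),$$ $$\tilde\alpha(\tilde t)=\frac{(X^1)^2}{\delta_2T_t}\alpha(t),\quad \tilde\beta(\tilde t)=\frac{(X^1)^3}{T_t}\beta(t),\quad \tilde\sigma(\tilde t)=\frac{(X^1)^5}{T_t}\sigma(t),\qquad X^1=\Big(\delta_3\int\alpha\,dt+\delta_4\Big)^{-1},$$ with constants such that $\delta_2(\delta_3^2+\delta_4^2)\ne0$ and a smooth function $T$ with $T_t\ne0$. A transformation is applied to an equation only if its denominators do not vanish on $I$; it maps the equation on $I$ to the equation with the transformed coefficients on the image interval. **Theorem.** (a) For every $I$, the intersection of the maximal Lie invariance algebras of all equations of the gauged class on $I$ (the kernel algebra) is the two-dimensional algebra $\langle\partial_x,\ t\partial_x+\partial_u\rangle$. For class (1), for every fixed coefficient $\alpha$ with antiderivative $A=\int\alpha\,dt$, the intersection over all $\beta,\sigma$ is the two-dimensional algebra $\langle\partial_x,\ A\partial_x+\partial_u\rangle$. (b) In each of the following cases of equations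 with $\alpha=1$ and nonzero constants $\lambda,\delta$, the algebra $A^{\max}$ is three-dimensional, properly contains the kernel algebra, and is spanned by $\partial_x$, $t\partial_x+\partial_u$ and the third operator listed: * $1'$: $\beta=\lambda t^{\rho}$, $\sigma=\delta t^{\frac{5\rho+2}{3}}$ on $I\subseteq(0,\infty)$, $\rho\ge\frac12$: $\;3t\partial_t+(\rho+1)x\partial_x+(\rho-2)u\partial_u$; * $2'$: $\beta=\lambda e^{t}$, $\sigma=\delta e^{\frac53t}$: $\;3\partial_t+x\partial_x+u\partial_u$; * $3'$: $\beta=\lambda$, $\sigma=\delta$: $\;\partial_t$; * $4'$: $\beta=\lambda(t^2+1)^{\frac12}e^{3\nu\arctan t}$, $\sigma=\delta(t^2+1)^{\frac32}e^{5\nu\arctan t}$, $\nu\ge0$: $\;(t^2+1)\partial_t+(t+\nu)x\partial_x+((\nu-t)u+x)\partial_u$. (c) If $A^{\max}$ of an equation of the gauged class (respectively, of class (1)) is strictly larger than the kernel algebra (respectively, than the kernel algebra for its coefficient $\alpha$), then $A^{\max}$ is three-dimensional and some transformation from $G^\sim_{\alpha=n=1}$ (respectively, from $\hat G^\sim_{n=1}$)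 maps the equation to an equation from one of the cases $1'$–$4'$ with $\delta=\pm1$. (d) Equations from different cases among $1'$–$4'$, or from the same case with different values of $\rho$ or of $\nu$, are neither $G^\sim_{\alpha=n=1}$-equivalent nor $\hat G^\sim_{n=1}$-equivalent. -/

import Mathlib

open Set
open scoped ContDiff

namespace Kawahara

/-! ## Derivatives of functions of `(t, x)` -/

/-- Derivative with respect to `t`. Applied to a differential function evaluated along `u = u(t, x)`
this is the total derivative `D_t`. -/
noncomputable def Dt (F : ℝ → ℝ → ℝ) : ℝ → ℝ → ℝ := fun t x => deriv (fun s => F s x) t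

/-- Derivative with respect to `x`. Applied to a differential function evaluated along `u = u(t, x)`
this is the total derivative `D_x`. -/
noncomputable def Dx (F : ℝ → ℝ → ℝ) : ℝ → ℝ → ℝ := fun t x => deriv (F t) x

/-! ## The class of equations -/

/-- An equation `u_t + α(t) u u_x + β(t) u_xxx + σ(t) u_xxxxx = 0` whose coefficients are smooth
nonvanishing functions on a nonempty open interval `dom`. The values of the coefficients outside
`dom` play no role. -/
structure Equation where
  dom : Set ℝ
  α : ℝ → ℝ
  β : ℝ → ℝ
  σ : ℝ → ℝ
  dom_open : IsOpen dom
  dom_nonempty : dom.Nonempty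
  dom_interval : dom.OrdConnected
  α_smooth : ContDiffOn ℝ ∞ α dom
  β_smooth : ContDiffOn ℝ ∞ β dom
  σ_smooth : ContDiffOn ℝ ∞ σ dom
  α_ne : ∀ t ∈ dom, α t ≠ 0
  β_ne : ∀ t ∈ dom, β t ≠ 0
  σ_ne : ∀ t ∈ dom, σ t ≠ 0

/-- Membership in the subclass `u_t + u u_x + β(t) u_xxx + σ(t) u_xxxxx = 0`. -/
def Equation.IsGauged (E : Equation) : Prop := ∀ t ∈ E.dom, E.α t = 1

/-- The left-hand side of the equation, evaluated along `u = u(t, x)`. -/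
noncomputable def Equation.lhs (E : Equation) (u : ℝ → ℝ → ℝ) (t x : ℝ) : ℝ :=
  Dt u t x + E.α t * u t x * Dx u t x + E.β t * Dx^[3] u t x + E.σ t * Dx^[5] u t x

/-! ## Vector fields and their prolongations -/

/-- A vector field `τ ∂_t + ξ ∂_x + η ∂_u` in the space of the variables `(t, x, u)`, given by its
components `(τ, ξ, η)`. -/
abbrev Field := ℝ × ℝ × ℝ → ℝ × ℝ × ℝ

/-- `τ` along `u = u(t, x)`. -/
def tauAlong (Q : Field) (u : ℝ → ℝ → ℝ) : ℝ → ℝ → ℝ := fun t x => (Q (t, x, u t x)).1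

/-- `ξ` along `u = u(t, x)`. -/
def xiAlong (Q : Field) (u : ℝ → ℝ → ℝ) : ℝ → ℝ → ℝ := fun t x => (Q (t, x, u t x)).2.1

/-- `η` along `u = u(t, x)`. -/
def etaAlong (Q : Field) (u : ℝ → ℝ → ℝ) : ℝ → ℝ → ℝ := fun t x => (Q (t, x, u t x)).2.2

/-- The prolongation coefficient `η^t = D_t η - u_t D_t τ - u_x D_t ξ` along `u`. -/
noncomputable def etaT (Q : Field) (u : ℝ → ℝ → ℝ) : ℝ → ℝ → ℝ := fun t x =>
  Dt (etaAlong Q u) t x - Dt u t x * Dt (tauAlong Q u) t x - Dx u t x * Dt (xiAlong Q u) t x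

/-- The prolongation coefficients `η`, `η^x`, `η^xx`, ... along `u`: with `k` letters `x` in
`η^{x...x}`, one has `η^{x...xx} = D_x η^{x...x} - u_{tx...x} D_x τ - u_{x...xx} D_x ξ`. -/
noncomputable def etaX (Q : Field) (u : ℝ → ℝ → ℝ) : ℕ → ℝ → ℝ → ℝ
  | 0 => etaAlong Q u
  | k + 1 => fun t x =>
      Dx (etaX Q u k) t x - Dx^[k] (Dt u) t x * Dx (tauAlong Q u) t x
        - Dx^[k + 1] u t x * Dx (xiAlong Q u) t x

/-- The fifth prolongation of `Q`, applied to the left-hand side of the equation and evaluated at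
the jet of `u` at `(t, x)`. -/
noncomputable def Equation.prolong (E : Equation) (Q : Field) (u : ℝ → ℝ → ℝ) (t x : ℝ) : ℝ :=
  tauAlong Q u t x *
      (deriv E.α t * u t x * Dx u t x + deriv E.β t * Dx^[3] u t x + deriv E.σ t * Dx^[5] u t x)
    + etaAlong Q u t x * (E.α t * Dx u t x)
    + etaT Q u t x + E.α t * u t x * etaX Q u 1 t x + E.β t * etaX Q u 3 t x
    + E.σ t * etaX Q u 5 t x

/-- The infinitesimal invariance criterion: the prolongation of `Q` annihilates the left-hand side
of the equation at every jet that satisfies the equation. Every jet at a point is the jet of a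
smooth function, which need not solve the equation at other points. -/
def Equation.Invariant (E : Equation) (Q : Field) : Prop :=
  ∀ u : ℝ → ℝ → ℝ, ContDiff ℝ ∞ (fun z : ℝ × ℝ => u z.1 z.2) →
    ∀ t ∈ E.dom, ∀ x : ℝ, E.lhs u t x = 0 → E.prolong Q u t x = 0

/-! ### Linearity of the prolongation -/

theorem contDiff_iterate_Dx {F : ℝ → ℝ → ℝ} {t : ℝ} (h : ContDiff ℝ ∞ (F t)) (k : ℕ) :
    ContDiff ℝ ∞ (Dx^[k] F t) := by
  induction k generalizing F with
  | zero => exact h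
  | succ k ih =>
    rw [Function.iterate_succ_apply]
    apply ih
    exact (contDiff_infty_iff_deriv.1 h).2

theorem contDiff_slice {u : ℝ → ℝ → ℝ} (hu : ContDiff ℝ ∞ (fun z : ℝ × ℝ => u z.1 z.2)) (t : ℝ) :
    ContDiff ℝ ∞ (u t) :=
  hu.comp (contDiff_const.prodMk contDiff_id : ContDiff ℝ ∞ fun x : ℝ => (t, x))

theorem contDiff_slice_Dt {u : ℝ → ℝ → ℝ} (hu : ContDiff ℝ ∞ (fun z : ℝ × ℝ => u z.1 z.2))
    (t : ℝ) : ContDiff ℝ ∞ (Dt u t) := by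
  have h1 : Dt u t = fun x => fderiv ℝ (fun z : ℝ × ℝ => u z.1 z.2) (t, x) (1, 0) := by
    funext x
    have hd : HasDerivAt (fun s : ℝ => (s, x)) ((1 : ℝ), (0 : ℝ)) t :=
      (hasDerivAt_id t).prodMk (hasDerivAt_const t x)
    have hf : HasFDerivAt (fun z : ℝ × ℝ => u z.1 z.2)
        (fderiv ℝ (fun z : ℝ × ℝ => u z.1 z.2) (t, x)) (t, x) :=
      (hu.differentiable (by simp) (t, x)).hasFDerivAt
    exact (hf.comp_hasDerivAt t hd).deriv
  rw [h1]
  have h2 : ContDiff ℝ ∞ (fderiv ℝ (fun z : ℝ × ℝ => u z.1 z.2)) :=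
    hu.fderiv_right (by simp)
  exact (h2.comp (contDiff_const.prodMk contDiff_id : ContDiff ℝ ∞ fun x : ℝ => (t, x))).clm_apply
    contDiff_const

theorem contDiff_along {I : Set ℝ} {Q : Field} (hQ : ContDiffOn ℝ ∞ Q (I ×ˢ univ))
    {u : ℝ → ℝ → ℝ} (hu : ContDiff ℝ ∞ (fun z : ℝ × ℝ => u z.1 z.2)) {t : ℝ} (ht : t ∈ I) :
    ContDiff ℝ ∞ (fun x => Q (t, x, u t x)) := by
  have h : ContDiff ℝ ∞ (fun x : ℝ => (t, x, u t x)) :=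
    contDiff_const.prodMk (contDiff_id.prodMk (contDiff_slice hu t))
  exact hQ.comp_contDiff h fun x => ⟨ht, mem_univ _⟩

theorem differentiableAt_along {I : Set ℝ} (hI : IsOpen I) {Q : Field}
    (hQ : ContDiffOn ℝ ∞ Q (I ×ˢ univ)) {u : ℝ → ℝ → ℝ}
    (hu : ContDiff ℝ ∞ (fun z : ℝ × ℝ => u z.1 z.2)) {t : ℝ} (ht : t ∈ I) (x : ℝ) :
    DifferentiableAt ℝ (fun s => Q (s, x, u s x)) t := by
  have hs : ContDiff ℝ ∞ (fun s : ℝ => u s x) :=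
    hu.comp (contDiff_id.prodMk contDiff_const : ContDiff ℝ ∞ fun s : ℝ => (s, x))
  have h : ContDiff ℝ ∞ (fun s : ℝ => (s, x, u s x)) :=
    contDiff_id.prodMk (contDiff_const.prodMk hs)
  have hq : DifferentiableAt ℝ Q (t, x, u t x) :=
    (hQ.contDiffAt ((hI.prod isOpen_univ).mem_nhds ⟨ht, mem_univ _⟩)).differentiableAt (by simp)
  exact hq.comp t (h.differentiable (by simp) t)

theorem contDiff_etaX {I : Set ℝ} {Q : Field} (hQ : ContDiffOn ℝ ∞ Q (I ×ˢ univ))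
    {u : ℝ → ℝ → ℝ} (hu : ContDiff ℝ ∞ (fun z : ℝ × ℝ => u z.1 z.2)) {t : ℝ} (ht : t ∈ I) (k : ℕ) :
    ContDiff ℝ ∞ (etaX Q u k t) := by
  have h := contDiff_along hQ hu ht
  induction k with
  | zero => exact h.snd.snd
  | succ k ih =>
    have h1 : ContDiff ℝ ∞ (Dx (etaX Q u k) t) := (contDiff_infty_iff_deriv.1 ih).2
    have h2 : ContDiff ℝ ∞ (Dx (tauAlong Q u) t) := (contDiff_infty_iff_deriv.1 h.fst).2
    have h3 : ContDiff ℝ ∞ (Dx (xiAlong Q u) t) := (contDiff_infty_iff_deriv.1 h.snd.fst).2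
    exact (h1.sub ((contDiff_iterate_Dx (contDiff_slice_Dt hu t) k).mul h2)).sub
      ((contDiff_iterate_Dx (contDiff_slice hu t) (k + 1)).mul h3)

theorem deriv_lin (c : ℝ) {f g : ℝ → ℝ} {y : ℝ} (hf : DifferentiableAt ℝ f y)
    (hg : DifferentiableAt ℝ g y) :
    deriv (fun z => c * f z + g z) y = c * deriv f y + deriv g y :=
  ((hf.hasDerivAt.const_mul c).add hg.hasDerivAt).deriv

theorem etaX_lin {I : Set ℝ} {P Q : Field} (hP : ContDiffOn ℝ ∞ P (I ×ˢ univ))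
    (hQ : ContDiffOn ℝ ∞ Q (I ×ˢ univ)) {u : ℝ → ℝ → ℝ}
    (hu : ContDiff ℝ ∞ (fun z : ℝ × ℝ => u z.1 z.2)) (c : ℝ) {t : ℝ} (ht : t ∈ I) (k : ℕ) :
    etaX (c • P + Q) u k t = fun x => c * etaX P u k t x + etaX Q u k t x := by
  have dP := (contDiff_along hP hu ht).differentiable (by simp)
  have dQ := (contDiff_along hQ hu ht).differentiable (by simp)
  induction k with
  | zero => rfl
  | succ k ih =>
    funext x
    have h1 : Dx (etaX (c • P + Q) u k) t x
        = c * Dx (etaX P u k) t x + Dx (etaX Q u k) t x := by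
      unfold Dx
      rw [ih]
      exact deriv_lin c ((contDiff_etaX hP hu ht k).differentiable (by simp) x)
        ((contDiff_etaX hQ hu ht k).differentiable (by simp) x)
    have h2 : Dx (tauAlong (c • P + Q) u) t x
        = c * Dx (tauAlong P u) t x + Dx (tauAlong Q u) t x :=
      deriv_lin c (dP x).fst (dQ x).fst
    have h3 : Dx (xiAlong (c • P + Q) u) t x
        = c * Dx (xiAlong P u) t x + Dx (xiAlong Q u) t x :=
      deriv_lin c (dP x).snd.fst (dQ x).snd.fst
    simp only [etaX, h1, h2, h3]
    ring

theorem etaT_lin {I : Set ℝ} (hI : IsOpen I) {P Q : Field} (hP : ContDiffOn ℝ ∞ P (I ×ˢ univ))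
    (hQ : ContDiffOn ℝ ∞ Q (I ×ˢ univ)) {u : ℝ → ℝ → ℝ}
    (hu : ContDiff ℝ ∞ (fun z : ℝ × ℝ => u z.1 z.2)) (c : ℝ) {t : ℝ} (ht : t ∈ I) (x : ℝ) :
    etaT (c • P + Q) u t x = c * etaT P u t x + etaT Q u t x := by
  have dP := differentiableAt_along hI hP hu ht x
  have dQ := differentiableAt_along hI hQ hu ht x
  have h1 : Dt (etaAlong (c • P + Q) u) t x
      = c * Dt (etaAlong P u) t x + Dt (etaAlong Q u) t x := deriv_lin c dP.snd.snd dQ.snd.snd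
  have h2 : Dt (tauAlong (c • P + Q) u) t x
      = c * Dt (tauAlong P u) t x + Dt (tauAlong Q u) t x := deriv_lin c dP.fst dQ.fst
  have h3 : Dt (xiAlong (c • P + Q) u) t x
      = c * Dt (xiAlong P u) t x + Dt (xiAlong Q u) t x := deriv_lin c dP.snd.fst dQ.snd.fst
  simp only [etaT, h1, h2, h3]
  ring

theorem prolong_lin (E : Equation) {P Q : Field} (hP : ContDiffOn ℝ ∞ P (E.dom ×ˢ univ))
    (hQ : ContDiffOn ℝ ∞ Q (E.dom ×ˢ univ)) {u : ℝ → ℝ → ℝ}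
    (hu : ContDiff ℝ ∞ (fun z : ℝ × ℝ => u z.1 z.2)) (c : ℝ) {t : ℝ} (ht : t ∈ E.dom) (x : ℝ) :
    E.prolong (c • P + Q) u t x = c * E.prolong P u t x + E.prolong Q u t x := by
  have h1 : tauAlong (c • P + Q) u t x = c * tauAlong P u t x + tauAlong Q u t x := rfl
  have h2 : etaAlong (c • P + Q) u t x = c * etaAlong P u t x + etaAlong Q u t x := rfl
  simp only [Equation.prolong, h1, h2, etaT_lin E.dom_open hP hQ hu c ht x,
    etaX_lin hP hQ hu c ht]
  ring

theorem Equation.Invariant.lin {E : Equation} {P Q : Field}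
    (hP : ContDiffOn ℝ ∞ P (E.dom ×ˢ univ)) (hQ : ContDiffOn ℝ ∞ Q (E.dom ×ˢ univ))
    (iP : E.Invariant P) (iQ : E.Invariant Q) (c : ℝ) : E.Invariant (c • P + Q) := by
  intro u hu t ht x h
  rw [prolong_lin E hP hQ hu c ht x, iP u hu t ht x h, iQ u hu t ht x h]
  ring

theorem Equation.invariant_zero (E : Equation) : E.Invariant 0 := by
  intro u hu t ht x _
  have h0 : ContDiffOn ℝ ∞ (0 : Field) (E.dom ×ˢ univ) := contDiffOn_const
  have h := prolong_lin E h0 h0 hu 1 ht x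
  have h2 : ((1 : ℝ) • (0 : Field) + 0) = 0 := by simp
  rw [h2] at h
  linarith

/-! ## Maximal Lie invariance algebra and kernel algebra -/

/-- The maximal Lie invariance algebra of an equation: all smooth vector fields on the domain
`dom × ℝ × ℝ` of the variables `(t, x, u)` that satisfy the infinitesimal invariance criterion.
A vector field on `dom × ℝ × ℝ` is represented by its extension by zero. -/
noncomputable def Equation.maxAlgebra (E : Equation) : Submodule ℝ Field where
  carrier := {Q | (∀ z : ℝ × ℝ × ℝ, z.1 ∉ E.dom → Q z = 0) ∧
    ContDiffOn ℝ ∞ Q (E.dom ×ˢ univ) ∧ E.Invariant Q}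
  add_mem' := by
    rintro P Q ⟨h1, h2, h3⟩ ⟨k1, k2, k3⟩
    refine ⟨fun z hz => ?_, h2.add k2, ?_⟩
    · rw [Pi.add_apply, h1 z hz, k1 z hz, add_zero]
    · simpa using Equation.Invariant.lin h2 k2 h3 k3 1
  zero_mem' := ⟨fun _ _ => rfl, contDiffOn_const, E.invariant_zero⟩
  smul_mem' := by
    rintro c Q ⟨h1, h2, h3⟩
    refine ⟨fun z hz => ?_, contDiffOn_const.smul h2, ?_⟩
    · rw [Pi.smul_apply, h1 z hz, smul_zero]
    · have h0 : ContDiffOn ℝ ∞ (0 : Field) (E.dom ×ˢ univ) := contDiffOn_const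
      simpa using Equation.Invariant.lin h2 h0 h3 E.invariant_zero c

/-- The kernel of the maximal Lie invariance algebras of all equations with a given interval `I`
and a given coefficient `α` (and arbitrary `β`, `σ`): the intersection of these algebras. -/
noncomputable def kernelAlgebra (I : Set ℝ) (α : ℝ → ℝ) : Submodule ℝ Field :=
  ⨅ E ∈ {E : Equation | E.dom = I ∧ EqOn E.α α I}, E.maxAlgebra

/-- The vector field with components `f t x u` on `I × ℝ × ℝ`, extended by zero. -/
noncomputable def fieldOn (I : Set ℝ) (f : ℝ → ℝ → ℝ → ℝ × ℝ × ℝ) : Field :=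
  (I ×ˢ (univ : Set (ℝ × ℝ))).indicator fun z => f z.1 z.2.1 z.2.2

/-- `∂_x`. -/
noncomputable def translation (I : Set ℝ) : Field := fieldOn I fun _ _ _ => (0, 1, 0)

/-- `A(t) ∂_x + ∂_u`. -/
noncomputable def boost (I : Set ℝ) (A : ℝ → ℝ) : Field := fieldOn I fun t _ _ => (0, A t, 1)

/-- The equation admits an extension of the kernel algebra. -/
def Equation.HasExtension (E : Equation) : Prop := kernelAlgebra E.dom E.α < E.maxAlgebra

/-! ## Equivalence transformations -/

/-- A transformation `t' = T(t)`, `x' = X(t, x)`, `u' = U(t, x, u)` of the variables. -/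
structure PointTransformation where
  T : ℝ → ℝ
  X : ℝ → ℝ → ℝ
  U : ℝ → ℝ → ℝ → ℝ

/-- The point transformation maps the equation `E` to the equation `E'`: whenever the graph of `v`
is mapped to the graph of `w`, the function `v` satisfies `E` at a point if and only if `w`
satisfies `E'` at the corresponding point. -/
def PointTransformation.MapsEquation (Φ : PointTransformation) (E E' : Equation) : Prop :=
  E'.dom = Φ.T '' E.dom ∧
  ∀ v w : ℝ → ℝ → ℝ,
    ContDiffOn ℝ ∞ (fun z : ℝ × ℝ => v z.1 z.2) (E.dom ×ˢ univ) →
    ContDiffOn ℝ ∞ (fun z : ℝ × ℝ => w z.1 z.2) (E'.dom ×ˢ univ) →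
    (∀ t ∈ E.dom, ∀ x, w (Φ.T t) (Φ.X t x) = Φ.U t x (v t x)) →
    ∀ t ∈ E.dom, ∀ x, (E.lhs v t x = 0 ↔ E'.lhs w (Φ.T t) (Φ.X t x) = 0)

/-- Parameters of the transformations from the usual equivalence group of the gauged class
`u_t + u u_x + β(t) u_xxx + σ(t) u_xxxxx = 0`. -/
structure GaugedTransformation where
  a : ℝ
  b : ℝ
  c : ℝ
  d : ℝ
  e₀ : ℝ
  e₁ : ℝ
  e₂ : ℝ
  det_ne : a * d - b * c ≠ 0
  e₂_ne : e₂ ≠ 0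

namespace GaugedTransformation

variable (g : GaugedTransformation)

/-- The determinant `Δ`. -/
def Δ : ℝ := g.a * g.d - g.b * g.c

/-- The action on the variables. -/
noncomputable def point : PointTransformation where
  T := fun t => (g.a * t + g.b) / (g.c * t + g.d)
  X := fun t x => (g.e₂ * x + g.e₁ * t + g.e₀) / (g.c * t + g.d)
  U := fun t x u =>
    (g.e₂ * (g.c * t + g.d) * u - g.e₂ * g.c * x - g.e₀ * g.c + g.e₁ * g.d) / g.Δ

/-- The transformation `g` is defined on the domain of `E` and carries `E` to `E'`; its action on
the arbitrary elements `β` and `σ` is given explicitly. -/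
def Carries (E E' : Equation) : Prop :=
  (∀ t ∈ E.dom, g.c * t + g.d ≠ 0) ∧ g.point.MapsEquation E E' ∧
  ∀ t ∈ E.dom,
    E'.β (g.point.T t) = g.e₂ ^ 3 / (g.c * t + g.d) * (E.β t / g.Δ) ∧
    E'.σ (g.point.T t) = g.e₂ ^ 5 / (g.c * t + g.d) ^ 3 * (E.σ t / g.Δ)

end GaugedTransformation

/-- Equivalence with respect to the usual equivalence group of the gauged class. -/
def GaugedEquivalent (E E' : Equation) : Prop := ∃ g : GaugedTransformation, g.Carries E E'

/-- Parameters of the transformations from the generalized extended equivalence group of the class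
`u_t + α(t) u u_x + β(t) u_xxx + σ(t) u_xxxxx = 0`. -/
structure ExtendedTransformation where
  T : ℝ → ℝ
  δ₀ : ℝ
  δ₁ : ℝ
  δ₂ : ℝ
  δ₃ : ℝ
  δ₄ : ℝ
  nondegenerate : δ₂ * (δ₃ ^ 2 + δ₄ ^ 2) ≠ 0

namespace ExtendedTransformation

variable (g : ExtendedTransformation)

/-- The function `X¹ = (δ₃ ∫ α dt + δ₄)⁻¹`, where `A = ∫ α dt`. -/
noncomputable def X₁ (A : ℝ → ℝ) (t : ℝ) : ℝ := (g.δ₃ * A t + g.δ₄)⁻¹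

/-- The action on the variables. -/
noncomputable def point (A : ℝ → ℝ) : PointTransformation where
  T := g.T
  X := fun t x => (x + g.δ₁) * g.X₁ A t + g.δ₀
  U := fun t x u => g.δ₂ / g.X₁ A t * u - g.δ₂ * g.δ₃ * (x + g.δ₁)

/-- The transformation `g`, with the antiderivative `A` of the coefficient `α` of `E`, is defined
on the domain of `E` and carries `E` to `E'`; its action on the arbitrary elements is given
explicitly. -/
def Carries (A : ℝ → ℝ) (E E' : Equation) : Prop :=
  (∀ t ∈ E.dom, HasDerivAt A (E.α t) t) ∧
  (∀ t ∈ E.dom, g.δ₃ * A t + g.δ₄ ≠ 0) ∧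
  ContDiffOn ℝ ∞ g.T E.dom ∧ (∀ t ∈ E.dom, deriv g.T t ≠ 0) ∧
  (g.point A).MapsEquation E E' ∧
  ∀ t ∈ E.dom,
    E'.α (g.T t) = g.X₁ A t ^ 2 / (g.δ₂ * deriv g.T t) * E.α t ∧
    E'.β (g.T t) = g.X₁ A t ^ 3 / deriv g.T t * E.β t ∧
    E'.σ (g.T t) = g.X₁ A t ^ 5 / deriv g.T t * E.σ t

end ExtendedTransformation

/-- Equivalence with respect to the generalized extended equivalence group. -/
def ExtendedEquivalent (E E' : Equation) : Prop :=
  ∃ (g : ExtendedTransformation) (A : ℝ → ℝ), g.Carries A E E'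

/-! ## The classification list -/

/-- The four families of the classification list, with their essential parameter. -/
inductive TableCase where
  | power (ρ : ℝ)
  | exponential
  | constant
  | arctangent (ν : ℝ)

namespace TableCase

/-- The range of the parameters `ρ` and `ν`. -/
def Admissible : TableCase → Prop
  | power ρ => 1 / 2 ≤ ρ
  | exponential => True
  | constant => True
  | arctangent ν => 0 ≤ ν

/-- The values of `t` for which the coefficients are considered. -/
def domain : TableCase → Set ℝ
  | power _ => Ioi 0
  | _ => univ

/-- The coefficient `β`, up to a constant factor. -/
noncomputable def betaShape : TableCase → ℝ → ℝ
  | power ρ, t => t ^ ρ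
  | exponential, t => Real.exp t
  | constant, _ => 1
  | arctangent ν, t => (t ^ 2 + 1) ^ (1 / 2 : ℝ) * Real.exp (3 * ν * Real.arctan t)

/-- The coefficient `σ`, up to a constant factor. -/
noncomputable def sigmaShape : TableCase → ℝ → ℝ
  | power ρ, t => t ^ ((5 * ρ + 2) / 3)
  | exponential, t => Real.exp (5 / 3 * t)
  | constant, _ => 1
  | arctangent ν, t => (t ^ 2 + 1) ^ (3 / 2 : ℝ) * Real.exp (5 * ν * Real.arctan t)

/-- The components of the third basis element of the maximal Lie invariance algebra. -/
def generator : TableCase → ℝ → ℝ → ℝ → ℝ × ℝ × ℝ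
  | power ρ, t, x, u => (3 * t, (ρ + 1) * x, (ρ - 2) * u)
  | exponential, _, x, u => (3, x, u)
  | constant, _, _, _ => (1, 0, 0)
  | arctangent ν, t, x, u => (t ^ 2 + 1, (t + ν) * x, (ν - t) * u + x)

end TableCase

/-- `E` is the equation of the gauged class that belongs to the family `k` of the classification
list and has the constant factors `l` and `δ` in `β` and `σ`. -/
def Equation.HasForm (E : Equation) (k : TableCase) (l δ : ℝ) : Prop :=
  E.IsGauged ∧ E.dom ⊆ k.domain ∧
    ∀ t ∈ E.dom, E.β t = l * k.betaShape t ∧ E.σ t = δ * k.sigmaShape t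

end Kawahara

namespace Kawahara

/-! ## Jets of compositions along curves -/

/-! The invariance criterion is polynomial in the derivatives of `u`, so comparing jets that differ
in one derivative splits it. The coefficient of `u_txxxx` makes `τ` a function of `t` (`tau_eq`),
that of `u_xxxxx` makes `ξ` affine in `x` and free of `u` (`xi_affine`), that of `u_xxxx` makes `η`
affine in `u` (`eta_affine`), and that of `u_x` at `u = 0` gives `α η = ξ_t` (`eta_of_xi`).
Integrating what remains with `s = A(t)` as new time, `τ ∂_t` becomes `q(s) ∂_s` with a quadratic
polynomial `q = c s² + p s + r`. There are three further constants: a scaling weight `m` and two for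
the kernel part. The conditions left are `q (log(β/α))' = 3m + q'/2` and `q (log(σ/α))' = 5m +
3q'/2`, with primes for `d/ds` and the logarithms of absolute values (`mem_maxAlgebra_iff`).

The solutions `(q, m)` form a vector space, and a solution whose `q` has a zero on the image of `A`
is trivial (`eq_zero_of_root`): both right-hand sides vanish there, so `m = 0` and the zero is
double, and then `log(β/α)` would be singular at it. Hence evaluation of `q` at a point is
injective, an extension has exactly one dimension, and its `q` has no zeros. One pair `(β, σ)` with
only the trivial solution gives the kernel (`classifying_test`).

Fractional linear changes of `s` act on the fields `q ∂_s` and leave `m` alone. The discriminant of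
`q` decides the normal form (`exists_reduction`): two real roots go to 0 and ∞ (power), a double
root goes to ∞ (exponential if `m ≠ 0`, constant if `m = 0`), complex roots go to ±i (arctangent).
Swapping or reflecting the roots yields `ρ ≥ 1/2` and `ν ≥ 0`. The conditions then fix `β` and `σ`
up to constant factors, and the fifth power of `e₂` normalizes `σ` (`exists_normal_form`).

Conversely, an equivalence between listed equations carries one `(q, m)` to a multiple `κ` of the
other, where the discriminant is multiplied by `κ²` and `m` by `κ` (`eq_of_projective`). These data
separate the cases (`eq_of_invariants`). An extended transformation between gauged equations is
projective in `t`, so both groups are covered at once. -/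

theorem Dx_iterate_eq_iteratedDeriv (F : ℝ → ℝ → ℝ) (k : ℕ) (t : ℝ) :
    Dx^[k] F t = iteratedDeriv k (F t) := by
  induction k generalizing F with
  | zero => rw [iteratedDeriv_zero]; rfl
  | succ k ih => rw [Function.iterate_succ_apply, ih, iteratedDeriv_succ']; rfl

theorem iteratedDeriv_mul_of_smooth {f g : ℝ → ℝ} (hf : ContDiff ℝ ∞ f) (hg : ContDiff ℝ ∞ g)
    (n : ℕ) (x : ℝ) :
    iteratedDeriv n (fun y => f y * g y) x =
      ∑ i ∈ Finset.range (n + 1), n.choose i * iteratedDeriv i f x * iteratedDeriv (n - i) g x :=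
  iteratedDeriv_fun_mul (hf.contDiffAt.of_le (by exact_mod_cast le_top))
    (hg.contDiffAt.of_le (by exact_mod_cast le_top))

theorem iteratedDeriv_add_of_smooth {f g : ℝ → ℝ} (hf : ContDiff ℝ ∞ f) (hg : ContDiff ℝ ∞ g)
    (n : ℕ) (x : ℝ) :
    iteratedDeriv n (fun y => f y + g y) x = iteratedDeriv n f x + iteratedDeriv n g x :=
  iteratedDeriv_fun_add (hf.contDiffAt.of_le (by exact_mod_cast le_top))
    (hg.contDiffAt.of_le (by exact_mod_cast le_top))

theorem iteratedDeriv_sub_of_smooth {f g : ℝ → ℝ} (hf : ContDiff ℝ ∞ f) (hg : ContDiff ℝ ∞ g)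
    (n : ℕ) (x : ℝ) :
    iteratedDeriv n (fun y => f y - g y) x = iteratedDeriv n f x - iteratedDeriv n g x :=
  iteratedDeriv_fun_sub (hf.contDiffAt.of_le (by exact_mod_cast le_top))
    (hg.contDiffAt.of_le (by exact_mod_cast le_top))

theorem contDiff_deriv {f : ℝ → ℝ} (hf : ContDiff ℝ ∞ f) : ContDiff ℝ ∞ (deriv f) :=
  (contDiff_infty_iff_deriv.1 hf).2

theorem contDiff_iteratedDeriv {f : ℝ → ℝ} (hf : ContDiff ℝ ∞ f) (k : ℕ) :
    ContDiff ℝ ∞ (iteratedDeriv k f) := by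
  induction k generalizing f with
  | zero => simpa using hf
  | succ k ih => rw [iteratedDeriv_succ']; exact ih (contDiff_deriv hf)

theorem contDiff_directional {V W : Type*} [NormedAddCommGroup V] [NormedSpace ℝ V]
    [NormedAddCommGroup W] [NormedSpace ℝ W] {G : V → W} (hG : ContDiff ℝ ∞ G) (v : V) :
    ContDiff ℝ ∞ (fun z => fderiv ℝ G z v) :=
  (hG.fderiv_right (by simp)).clm_apply contDiff_const

theorem contDiff_comp_curve {G : ℝ × ℝ → ℝ} (hG : ContDiff ℝ ∞ G) {φ : ℝ → ℝ}
    (hφ : ContDiff ℝ ∞ φ) : ContDiff ℝ ∞ (fun y => G (y, φ y)) :=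
  hG.comp (contDiff_id.prodMk hφ)

theorem deriv_comp_curve {G : ℝ × ℝ → ℝ} (hG : ContDiff ℝ ∞ G) {φ : ℝ → ℝ}
    (hφ : ContDiff ℝ ∞ φ) (y : ℝ) :
    deriv (fun y => G (y, φ y)) y
      = fderiv ℝ G (y, φ y) (1, 0) + fderiv ℝ G (y, φ y) (0, 1) * deriv φ y := by
  have h1 : HasDerivAt (fun s : ℝ => (s, φ s)) ((1 : ℝ), deriv φ y) y :=
    (hasDerivAt_id y).prodMk ((hφ.differentiable (by simp) y).hasDerivAt)
  have h2 : HasFDerivAt G (fderiv ℝ G (y, φ y)) (y, φ y) :=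
    (hG.differentiable (by simp) _).hasFDerivAt
  have h3 := (h2.comp_hasDerivAt y h1).deriv
  have h4 : ((1 : ℝ), deriv φ y) = (1, 0) + deriv φ y • ((0 : ℝ), (1 : ℝ)) := by simp
  rw [h4, map_add, map_smul, smul_eq_mul] at h3
  rw [mul_comm (fderiv ℝ G (y, φ y) (0, 1))]
  exact h3

/-- The derivative of order `k + 1` of a function along a curve. -/
theorem iteratedDeriv_succ_comp_curve {G : ℝ × ℝ → ℝ} (hG : ContDiff ℝ ∞ G) {φ : ℝ → ℝ}
    (hφ : ContDiff ℝ ∞ φ) (k : ℕ) (x : ℝ) :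
    iteratedDeriv (k + 1) (fun y => G (y, φ y)) x
      = iteratedDeriv k (fun y => fderiv ℝ G (y, φ y) (1, 0)) x
        + ∑ i ∈ Finset.range (k + 1), k.choose i *
            iteratedDeriv i (fun y => fderiv ℝ G (y, φ y) (0, 1)) x
              * iteratedDeriv (k - i + 1) φ x := by
  have h1 := contDiff_comp_curve (contDiff_directional hG (1, 0)) hφ
  have h2 := contDiff_comp_curve (contDiff_directional hG (0, 1)) hφ
  have h3 : deriv (fun y => G (y, φ y))
      = fun y => fderiv ℝ G (y, φ y) (1, 0) + fderiv ℝ G (y, φ y) (0, 1) * deriv φ y :=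
    funext (deriv_comp_curve hG hφ)
  rw [iteratedDeriv_succ', h3, iteratedDeriv_add_of_smooth h1 (h2.mul (contDiff_deriv hφ)),
    iteratedDeriv_mul_of_smooth h2 (contDiff_deriv hφ)]
  simp only [← iteratedDeriv_succ']

/-- The derivative of order `k` along a graph sees only the `k`-jet of the graph. The induction
varies `G`, since each differentiation replaces it by its partial derivatives. -/
theorem iteratedDeriv_comp_curve_congr {φ ψ : ℝ → ℝ} (hφ : ContDiff ℝ ∞ φ) (hψ : ContDiff ℝ ∞ ψ)
    {x : ℝ} {n : ℕ} (h : ∀ j < n, iteratedDeriv j φ x = iteratedDeriv j ψ x)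
    {k : ℕ} (hk : k < n) {G : ℝ × ℝ → ℝ} (hG : ContDiff ℝ ∞ G) :
    iteratedDeriv k (fun y => G (y, φ y)) x = iteratedDeriv k (fun y => G (y, ψ y)) x := by
  induction k using Nat.strong_induction_on generalizing G with
  | _ k ih =>
    rcases k with _ | k
    · have := h 0 hk
      simp only [iteratedDeriv_zero] at this ⊢
      rw [this]
    · rw [iteratedDeriv_succ_comp_curve hG hφ, iteratedDeriv_succ_comp_curve hG hψ,
        ih k (by omega) (by omega) (contDiff_directional hG (1, 0))]
      congr 1
      refine Finset.sum_congr rfl fun i hi => ?_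
      have hi' := Finset.mem_range.1 hi
      rw [ih i (by omega) (by omega) (contDiff_directional hG (0, 1)), h (k - i + 1) (by omega)]

/-- The top derivative of `φ` enters a total derivative linearly, with coefficient `G_u`; this
extracts it without expanding the whole formula. -/
theorem iteratedDeriv_comp_curve_sub {φ ψ : ℝ → ℝ} (hφ : ContDiff ℝ ∞ φ) (hψ : ContDiff ℝ ∞ ψ)
    {x : ℝ} {n : ℕ} (h : ∀ j < n + 1, iteratedDeriv j φ x = iteratedDeriv j ψ x)
    {G : ℝ × ℝ → ℝ} (hG : ContDiff ℝ ∞ G) :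
    iteratedDeriv (n + 1) (fun y => G (y, φ y)) x - iteratedDeriv (n + 1) (fun y => G (y, ψ y)) x
      = fderiv ℝ G (x, ψ x) (0, 1)
        * (iteratedDeriv (n + 1) φ x - iteratedDeriv (n + 1) ψ x) := by
  have h0 : φ x = ψ x := by simpa using h 0 (by omega)
  rw [iteratedDeriv_succ_comp_curve hG hφ, iteratedDeriv_succ_comp_curve hG hψ,
    iteratedDeriv_comp_curve_congr hφ hψ h (Nat.lt_succ_self n) (contDiff_directional hG (1, 0)),
    Finset.sum_range_succ', Finset.sum_range_succ']
  have h1 : ∀ i ∈ Finset.range n,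
      ((n.choose (i + 1) : ℕ) : ℝ) * iteratedDeriv (i + 1) (fun y => fderiv ℝ G (y, φ y) (0, 1)) x
              * iteratedDeriv (n - (i + 1) + 1) φ x
      = ((n.choose (i + 1) : ℕ) : ℝ)
          * iteratedDeriv (i + 1) (fun y => fderiv ℝ G (y, ψ y) (0, 1)) x
              * iteratedDeriv (n - (i + 1) + 1) ψ x := by
    intro i hi
    have hi' := Finset.mem_range.1 hi
    rw [iteratedDeriv_comp_curve_congr hφ hψ h (by omega : i + 1 < n + 1)
      (contDiff_directional hG (0, 1)), h (n - (i + 1) + 1) (by omega)]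
  rw [Finset.sum_congr rfl h1]
  simp [h0]
  ring

/-- The next-to-top derivative enters with coefficient `(n + 3) D_x(G_u)` when `n + 3` is the order:
`n + 2` copies come from the Leibniz term `i = 1`, and one more from `G_x` and the last Leibniz term
together. -/
theorem iteratedDeriv_comp_curve_sub_succ {φ ψ : ℝ → ℝ} (hφ : ContDiff ℝ ∞ φ)
    (hψ : ContDiff ℝ ∞ ψ) {x : ℝ} {n : ℕ}
    (h : ∀ j < n + 2, iteratedDeriv j φ x = iteratedDeriv j ψ x)
    (h' : iteratedDeriv (n + 3) φ x = iteratedDeriv (n + 3) ψ x)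
    {G : ℝ × ℝ → ℝ} (hG : ContDiff ℝ ∞ G) :
    iteratedDeriv (n + 3) (fun y => G (y, φ y)) x - iteratedDeriv (n + 3) (fun y => G (y, ψ y)) x
      = (n + 3) * deriv (fun y => fderiv ℝ G (y, ψ y) (0, 1)) x
        * (iteratedDeriv (n + 2) φ x - iteratedDeriv (n + 2) ψ x) := by
  have h0 : φ x = ψ x := by simpa using h 0 (by omega)
  have hG1 := contDiff_directional hG (1, 0)
  have hG2 := contDiff_directional hG (0, 1)
  have h2 := iteratedDeriv_comp_curve_sub hφ hψ (n := n + 1) h hG1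
  have h3 : iteratedDeriv 1 (fun y => fderiv ℝ G (y, φ y) (0, 1)) x
      = iteratedDeriv 1 (fun y => fderiv ℝ G (y, ψ y) (0, 1)) x :=
    iteratedDeriv_comp_curve_congr hφ hψ h (by omega) hG2
  have h4 := iteratedDeriv_comp_curve_sub hφ hψ (n := n + 1) h hG2
  -- Symmetry of the mixed partials lets `G_xu + G_uu ψ'` be recognized as the total derivative of
  -- `G_u`.
  have hsymm : fderiv ℝ (fun z => fderiv ℝ G z (1, 0)) (x, ψ x) (0, 1)
      = fderiv ℝ (fun z => fderiv ℝ G z (0, 1)) (x, ψ x) (1, 0) := by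
    have hd : DifferentiableAt ℝ (fderiv ℝ G) (x, ψ x) :=
      (hG.fderiv_right (m := ∞) (by simp)).differentiable (by simp) _
    have hs : IsSymmSndFDerivAt ℝ G (x, ψ x) :=
      (hG.contDiffAt).isSymmSndFDerivAt (by simpa using WithTop.coe_le_coe.2 (le_top : (2 : ℕ∞) ≤ ⊤))
    rw [fderiv_clm_apply hd (differentiableAt_const _),
      fderiv_clm_apply hd (differentiableAt_const _)]
    simpa using hs (0, 1) (1, 0)
  have h5 := deriv_comp_curve hG2 hψ x
  have h6 : deriv φ x = deriv ψ x := by simpa [iteratedDeriv_one] using h 1 (by omega)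
  rw [iteratedDeriv_succ_comp_curve hG hφ, iteratedDeriv_succ_comp_curve hG hψ,
    Finset.sum_range_succ (n := n + 2), Finset.sum_range_succ (n := n + 2),
    Finset.sum_range_succ' (n := n + 1), Finset.sum_range_succ' (n := n + 1),
    Finset.sum_range_succ' (n := n), Finset.sum_range_succ' (n := n)]
  have h1 : ∀ i ∈ Finset.range n,
      (((n + 2).choose (i + 1 + 1) : ℕ) : ℝ)
          * iteratedDeriv (i + 1 + 1) (fun y => fderiv ℝ G (y, φ y) (0, 1)) x
              * iteratedDeriv (n + 2 - (i + 1 + 1) + 1) φ x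
      = (((n + 2).choose (i + 1 + 1) : ℕ) : ℝ)
          * iteratedDeriv (i + 1 + 1) (fun y => fderiv ℝ G (y, ψ y) (0, 1)) x
              * iteratedDeriv (n + 2 - (i + 1 + 1) + 1) ψ x := by
    intro i hi
    have hi' := Finset.mem_range.1 hi
    rw [iteratedDeriv_comp_curve_congr hφ hψ h (by omega : i + 1 + 1 < n + 2) hG2,
      h (n + 2 - (i + 1 + 1) + 1) (by omega)]
  rw [Finset.sum_congr rfl h1]
  simp only [iteratedDeriv_zero, iteratedDeriv_one, h0, h', h6, Nat.sub_self, zero_add,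
    Nat.sub_zero, Nat.choose_self, Nat.choose_zero_right, Nat.choose_one_right, h5]
    at h2 h3 h4 ⊢
  rw [h3, ← hsymm]
  have e2 : n + 2 - 1 + 1 = n + 2 := by omega
  simp only [e2]
  push_cast
  linear_combination h2 + deriv ψ x * h4

theorem iteratedDeriv_sub_pow (x₀ : ℝ) (m k : ℕ) :
    iteratedDeriv k (fun y : ℝ => (y - x₀) ^ m) x₀ = if k = m then (m.factorial : ℝ) else 0 := by
  have h := iteratedDeriv_comp_sub_const (𝕜 := ℝ) k (fun y : ℝ => y ^ m) x₀
  rw [h]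
  simp only [iteratedDeriv_pow, sub_self]
  split_ifs with hk
  · subst hk; simp [Nat.descFactorial_self]
  · rcases lt_or_gt_of_ne hk with h1 | h1
    · simp [Nat.sub_ne_zero_of_lt h1]
    · simp [Nat.descFactorial_of_lt h1]

/-! ## Closed form of the prolongation coefficients -/

/-- This is the characteristic form of prolongation: with `W = η - τ u_t - ξ u_x`, the coefficient
is `D_x^k W` corrected by `τ` and `ξ` times derivatives of `u`. It replaces the recursion by one
iterated derivative. -/
theorem etaX_eq {I : Set ℝ} {Q : Field} (hQ : ContDiffOn ℝ ∞ Q (I ×ˢ univ)) {u : ℝ → ℝ → ℝ}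
    (hu : ContDiff ℝ ∞ (fun z : ℝ × ℝ => u z.1 z.2)) {t : ℝ} (ht : t ∈ I) (k : ℕ) :
    etaX Q u k t = fun x =>
      iteratedDeriv k (fun y => etaAlong Q u t y - tauAlong Q u t y * Dt u t y
        - xiAlong Q u t y * deriv (u t) y) x
      + tauAlong Q u t x * iteratedDeriv k (Dt u t) x
      + xiAlong Q u t x * iteratedDeriv (k + 1) (u t) x := by
  have h := contDiff_along hQ hu ht
  have hτ : ContDiff ℝ ∞ (tauAlong Q u t) := h.fst
  have hξ : ContDiff ℝ ∞ (xiAlong Q u t) := h.snd.fst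
  have hη : ContDiff ℝ ∞ (etaAlong Q u t) := h.snd.snd
  have hv := contDiff_slice_Dt hu t
  have hut := contDiff_slice hu t
  induction k with
  | zero => funext x; simp [etaX]; ring
  | succ k ih =>
    funext x
    have d1 := ((contDiff_iteratedDeriv ((hη.sub (hτ.mul hv)).sub (hξ.mul (contDiff_deriv hut)))
      k).differentiable (by simp) x).hasDerivAt
    have d2 := ((contDiff_iteratedDeriv hv k).differentiable (by simp) x).hasDerivAt
    have d3 := ((contDiff_iteratedDeriv hut (k + 1)).differentiable (by simp) x).hasDerivAt
    have d4 := (hτ.differentiable (by simp) x).hasDerivAt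
    have d5 := (hξ.differentiable (by simp) x).hasDerivAt
    have d6 := ((d1.add (d4.mul d2)).add (d5.mul d3)).deriv
    have e : etaX Q u (k + 1) t x = deriv (etaX Q u k t) x
        - iteratedDeriv k (Dt u t) x * deriv (tauAlong Q u t) x
        - iteratedDeriv (k + 1) (u t) x * deriv (xiAlong Q u t) x := by
      rw [← Dx_iterate_eq_iteratedDeriv, ← Dx_iterate_eq_iteratedDeriv]
      rfl
    rw [e, ih]
    refine (congrArg (fun z => z - iteratedDeriv k (Dt u t) x * deriv (tauAlong Q u t) x
        - iteratedDeriv (k + 1) (u t) x * deriv (xiAlong Q u t) x) d6).trans ?_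
    rw [iteratedDeriv_succ (n := k + 1), iteratedDeriv_succ (n := k) (f := Dt u t),
      iteratedDeriv_succ (n := k) (f := fun y => _ - _)]
    ring_nf

/-! ### Derivatives of test polynomials and of products with affine functions -/

theorem iteratedDeriv_const_mul_of_smooth {f : ℝ → ℝ} (hf : ContDiff ℝ ∞ f) (c : ℝ)
    (n : ℕ) (x : ℝ) :
    iteratedDeriv n (fun y => c * f y) x = c * iteratedDeriv n f x :=
  iteratedDeriv_const_mul c (hf.contDiffAt.of_le (by exact_mod_cast le_top))

theorem contDiff_trinomial (a b c x₀ : ℝ) (n : ℕ) :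
    ContDiff ℝ ∞ (fun y : ℝ => a + b * (y - x₀) + c * (y - x₀) ^ n) := by
  fun_prop

theorem iteratedDeriv_trinomial (a b c x₀ : ℝ) (n k : ℕ) :
    iteratedDeriv k (fun y : ℝ => a + b * (y - x₀) + c * (y - x₀) ^ n) x₀
      = (if k = 0 then a else 0) + (if k = 1 then b else 0)
        + (if k = n then c * n.factorial else 0) := by
  have h1 : ContDiff ℝ ∞ (fun y : ℝ => (y - x₀) ^ n) := by fun_prop
  have h2 : ContDiff ℝ ∞ (fun y : ℝ => (y - x₀) ^ 1) := by fun_prop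
  have h3 : ContDiff ℝ ∞ (fun _ : ℝ => a) := contDiff_const
  have e : (fun y : ℝ => a + b * (y - x₀) + c * (y - x₀) ^ n)
      = fun y : ℝ => (a + b * (y - x₀) ^ 1) + c * (y - x₀) ^ n := by
    funext y; rw [pow_one]
  rw [e, iteratedDeriv_add_of_smooth (h3.add (contDiff_const.mul h2)) (contDiff_const.mul h1),
    iteratedDeriv_add_of_smooth h3 (contDiff_const.mul h2),
    iteratedDeriv_const_mul_of_smooth h1, iteratedDeriv_const_mul_of_smooth h2,
    iteratedDeriv_sub_pow, iteratedDeriv_sub_pow, iteratedDeriv_const]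
  simp

/-- The Leibniz sum stops after two terms because the second derivative of the affine factor
vanishes. -/
theorem iteratedDeriv_affine_mul {g : ℝ → ℝ} (hg : ContDiff ℝ ∞ g) (a b : ℝ) (k : ℕ) (x : ℝ) :
    iteratedDeriv (k + 1) (fun y => (a * y + b) * g y) x
      = (a * x + b) * iteratedDeriv (k + 1) g x + (k + 1) * a * iteratedDeriv k g x := by
  have hl (y : ℝ) : HasDerivAt (fun y => a * y + b) a y := by
    simpa using ((hasDerivAt_id y).const_mul a).add_const b
  have hd (j : ℕ) (y : ℝ) : HasDerivAt (iteratedDeriv j g) (iteratedDeriv (j + 1) g y) y := by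
    rw [iteratedDeriv_succ]
    exact ((contDiff_iteratedDeriv hg j).differentiable (by simp) y).hasDerivAt
  induction k generalizing x with
  | zero =>
    rw [zero_add, iteratedDeriv_one]
    have := ((hl x).mul (hd 0 x)).deriv
    simp only [iteratedDeriv_zero] at this
    refine Eq.trans this ?_
    simp
    ring
  | succ k ih =>
    rw [iteratedDeriv_succ, funext ih]
    have := (((hl x).mul (hd (k + 1) x)).add ((hd k x).const_mul ((k + 1) * a))).deriv
    refine Eq.trans this ?_
    push_cast
    ring

/-! ## The invariance criterion on jets of the form `f(x) + (t - t₀) v(x)` -/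

/-- The prolongation coefficient with `k` letters `x` at a jet with `u = f` and `u_t = v` along
the line `t = const`. -/
noncomputable def jetCoeff (Q : Field) (t : ℝ) (f v : ℝ → ℝ) (k : ℕ) (x : ℝ) : ℝ :=
  iteratedDeriv k (fun y => (Q (t, y, f y)).2.2 - (Q (t, y, f y)).1 * v y
      - (Q (t, y, f y)).2.1 * deriv f y) x
    + (Q (t, x, f x)).1 * iteratedDeriv k v x + (Q (t, x, f x)).2.1 * iteratedDeriv (k + 1) f x

/-- For `u = f + (s - t) v` the `x`-derivatives of `u` and of `u_t` at time `t` are prescribed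
independently, subject only to the equation at the single point `x`. -/
theorem Equation.Invariant.jet {E : Equation} {Q : Field} (hQ : ContDiffOn ℝ ∞ Q (E.dom ×ˢ univ))
    (hE : E.Invariant Q) {t : ℝ} (ht : t ∈ E.dom) {f v : ℝ → ℝ} (hf : ContDiff ℝ ∞ f)
    (hv : ContDiff ℝ ∞ v) (x : ℝ)
    (h : v x + E.α t * f x * deriv f x + E.β t * iteratedDeriv 3 f x
      + E.σ t * iteratedDeriv 5 f x = 0) :
    (Q (t, x, f x)).1 * (deriv E.α t * f x * deriv f x + deriv E.β t * iteratedDeriv 3 f x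
        + deriv E.σ t * iteratedDeriv 5 f x)
      + (Q (t, x, f x)).2.2 * (E.α t * deriv f x)
      + ((fderiv ℝ Q (t, x, f x) (1, 0, v x)).2.2
        - v x * (fderiv ℝ Q (t, x, f x) (1, 0, v x)).1
        - deriv f x * (fderiv ℝ Q (t, x, f x) (1, 0, v x)).2.1)
      + E.α t * f x * jetCoeff Q t f v 1 x + E.β t * jetCoeff Q t f v 3 x
      + E.σ t * jetCoeff Q t f v 5 x = 0 := by
  set u : ℝ → ℝ → ℝ := fun s y => f y + (s - t) * v y with hu_def
  have hu : ContDiff ℝ ∞ (fun z : ℝ × ℝ => u z.1 z.2) := by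
    have h1 : ContDiff ℝ ∞ (fun z : ℝ × ℝ => f z.2) := hf.comp contDiff_snd
    have h2 : ContDiff ℝ ∞ (fun z : ℝ × ℝ => v z.2) := hv.comp contDiff_snd
    exact h1.add ((contDiff_fst.sub contDiff_const).mul h2)
  have hut : u t = f := by funext y; simp [u]
  have hus (y : ℝ) : HasDerivAt (fun s => u s y) (v y) t := by
    exact ((((hasDerivAt_id t).sub_const t).mul_const (v y)).const_add (f y)).congr_deriv (by simp)
  have hDt : Dt u t = v := by funext y; exact (hus y).deriv
  have hq : HasFDerivAt Q (fderiv ℝ Q (t, x, f x)) (t, x, u t x) := by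
    rw [hut]
    exact ((hQ.contDiffAt ((E.dom_open.prod isOpen_univ).mem_nhds ⟨ht, mem_univ _⟩)).differentiableAt
      (by simp)).hasFDerivAt
  have hc : HasDerivAt (fun s => (s, x, u s x)) ((1 : ℝ), (0 : ℝ), v x) t :=
    (hasDerivAt_id t).prodMk ((hasDerivAt_const t x).prodMk (hus x))
  have hd := hq.comp_hasDerivAt t hc
  have hτ : Dt (tauAlong Q u) t x = (fderiv ℝ Q (t, x, f x) (1, 0, v x)).1 := by
    exact (hasFDerivAt_fst.comp_hasDerivAt t hd).deriv
  have hξ : Dt (xiAlong Q u) t x = (fderiv ℝ Q (t, x, f x) (1, 0, v x)).2.1 := by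
    exact ((hasFDerivAt_fst.comp_hasDerivAt t (hasFDerivAt_snd.comp_hasDerivAt t hd))).deriv
  have hη : Dt (etaAlong Q u) t x = (fderiv ℝ Q (t, x, f x) (1, 0, v x)).2.2 := by
    exact ((hasFDerivAt_snd.comp_hasDerivAt t (hasFDerivAt_snd.comp_hasDerivAt t hd))).deriv
  have hX (k : ℕ) : etaX Q u k t x = jetCoeff Q t f v k x := by
    rw [etaX_eq hQ hu ht]
    simp only [jetCoeff, tauAlong, xiAlong, etaAlong, hut, hDt]
  have h1 : Dx u t x = deriv f x := by simp only [Dx, hut]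
  have key := hE u hu t ht x (by
    simp only [Equation.lhs, Dx_iterate_eq_iteratedDeriv, hut, hDt, h1]
    exact h)
  simp only [Equation.prolong, etaT, hX, hτ, hξ, hη, Dx_iterate_eq_iteratedDeriv, hut, hDt, h1,
    tauAlong, etaAlong] at key
  linear_combination key

/-! ## The determining equations -/

theorem eq_of_partials_eq_zero {h : ℝ × ℝ → ℝ} (hh : Differentiable ℝ h)
    (h1 : ∀ z, fderiv ℝ h z (1, 0) = 0) (h2 : ∀ z, fderiv ℝ h z (0, 1) = 0) (z w : ℝ × ℝ) :
    h z = h w := by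
  refine is_const_of_fderiv_eq_zero (𝕜 := ℝ) hh (fun y => ?_) z w
  ext
  · simpa using h1 y
  · simpa using h2 y

theorem contDiff_slice_field {I : Set ℝ} {Q : Field} (hQ : ContDiffOn ℝ ∞ Q (I ×ˢ univ)) {t : ℝ}
    (ht : t ∈ I) : ContDiff ℝ ∞ (fun z : ℝ × ℝ => Q (t, z.1, z.2)) := by
  have h : ContDiff ℝ ∞ (fun z : ℝ × ℝ => (t, z.1, z.2)) := by fun_prop
  exact hQ.comp_contDiff h fun x => ⟨ht, mem_univ _⟩

/-- The derivative `u_txxxx` is absent from the equation and enters the criterion only through `-5 σ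
u_txxxx D_x τ`. So `D_x τ = τ_x + τ_u u_x` vanishes for every slope `u_x`. -/
theorem Equation.Invariant.tau_eq {E : Equation} {Q : Field}
    (hQ : ContDiffOn ℝ ∞ Q (E.dom ×ˢ univ)) (hE : E.Invariant Q) {t : ℝ} (ht : t ∈ E.dom)
    (x y : ℝ) : (Q (t, x, y)).1 = (Q (t, 0, 0)).1 := by
  have hs : ContDiff ℝ ∞ (fun z : ℝ × ℝ => (Q (t, z.1, z.2)).1) := (contDiff_slice_field hQ ht).fst
  have key (x₀ a p : ℝ) : fderiv ℝ (fun z : ℝ × ℝ => (Q (t, z.1, z.2)).1) (x₀, a) (1, 0)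
      + fderiv ℝ (fun z : ℝ × ℝ => (Q (t, z.1, z.2)).1) (x₀, a) (0, 1) * p = 0 := by
    -- The curve is affine: the term with coefficient 0 only makes the general trinomial formula
    -- applicable.
    set f : ℝ → ℝ := fun y => a + p * (y - x₀) + 0 * (y - x₀) ^ 7 with hf_def
    have hf : ContDiff ℝ ∞ f := contDiff_trinomial _ _ _ _ _
    have hfk (k : ℕ) : iteratedDeriv k f x₀ = (if k = 0 then a else 0) + (if k = 1 then p else 0)
        + (if k = 7 then 0 * (Nat.factorial 7 : ℝ) else 0) := iteratedDeriv_trinomial a p 0 x₀ 7 k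
    have hf0 : f x₀ = a := by simp [f]
    have hf1 : deriv f x₀ = p := by rw [← iteratedDeriv_one, hfk]; simp
    -- Only the fourth derivative of `v` at `x₀` depends on `c`; the constant term puts the jet on
    -- the equation.
    set v : ℝ → ℝ → ℝ := fun c y => -(E.α t * a * p) + 0 * (y - x₀) + c * (y - x₀) ^ 4 with hv_def
    have hv (c : ℝ) : ContDiff ℝ ∞ (v c) := contDiff_trinomial _ _ _ _ _
    have hv0 (c : ℝ) : v c x₀ = -(E.α t * a * p) := by simp [v]
    have hinv (c : ℝ) := hE.jet hQ ht hf (hv c) x₀ (by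
      rw [hv0, hf0, hf1, hfk, hfk]; simp)
    have hτ : ContDiff ℝ ∞ (fun y => (Q (t, y, f y)).1) := contDiff_comp_curve hs hf
    have hξ : ContDiff ℝ ∞ (fun y => (Q (t, y, f y)).2.1) :=
      contDiff_comp_curve (contDiff_slice_field hQ ht).snd.fst hf
    have hη : ContDiff ℝ ∞ (fun y => (Q (t, y, f y)).2.2) :=
      contDiff_comp_curve (contDiff_slice_field hQ ht).snd.snd hf
    have hjet (c : ℝ) (k : ℕ) : jetCoeff Q t f (v c) k x₀ =
        iteratedDeriv k (fun y => (Q (t, y, f y)).2.2) x₀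
        - ∑ i ∈ Finset.range (k + 1), k.choose i *
            iteratedDeriv i (fun y => (Q (t, y, f y)).1) x₀ * iteratedDeriv (k - i) (v c) x₀
        - iteratedDeriv k (fun y => (Q (t, y, f y)).2.1 * deriv f y) x₀
        + (Q (t, x₀, f x₀)).1 * iteratedDeriv k (v c) x₀
        + (Q (t, x₀, f x₀)).2.1 * iteratedDeriv (k + 1) f x₀ := by
      rw [jetCoeff, iteratedDeriv_sub_of_smooth (hη.sub (hτ.mul (hv c)))
        (hξ.mul (contDiff_deriv hf)), iteratedDeriv_sub_of_smooth hη (hτ.mul (hv c)),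
        iteratedDeriv_mul_of_smooth hτ (hv c)]
    have hvk (c : ℝ) (k : ℕ) : iteratedDeriv k (v c) x₀ =
        (if k = 0 then -(E.α t * a * p) else 0) + (if k = 1 then 0 else 0)
        + (if k = 4 then c * (Nat.factorial 4 : ℝ) else 0) := iteratedDeriv_trinomial _ _ _ _ _ _
    have hD := deriv_comp_curve hs hf x₀
    simp only [hf0, hf1] at hD
    rw [← hD]
    have e0 := hinv 0
    have e1 := hinv 1
    simp only [hjet, hvk, hv0, Finset.sum_range_succ, Finset.sum_range_zero] at e0 e1
    norm_num [Nat.factorial, iteratedDeriv_one] at e0 e1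
    have hσ := E.σ_ne t ht
    -- The factor is `120 = 5 · 4!`.
    have e2 : E.σ t * deriv (fun y => (Q (t, y, f y)).1) x₀ = 0 := by
      linear_combination (e0 - e1) / 120
    exact (mul_eq_zero.1 e2).resolve_left hσ
  have h1 (z : ℝ × ℝ) : fderiv ℝ (fun z : ℝ × ℝ => (Q (t, z.1, z.2)).1) z (1, 0) = 0 := by
    simpa using key z.1 z.2 0
  have h2 (z : ℝ × ℝ) : fderiv ℝ (fun z : ℝ × ℝ => (Q (t, z.1, z.2)).1) z (0, 1) = 0 := by
    simpa [h1] using key z.1 z.2 1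
  exact eq_of_partials_eq_zero (hs.differentiable (by simp)) h1 h2 (x, y) (0, 0)

theorem differentiableAt_field {I : Set ℝ} (hI : IsOpen I) {Q : Field}
    (hQ : ContDiffOn ℝ ∞ Q (I ×ˢ univ)) {t : ℝ} (ht : t ∈ I) (z : ℝ × ℝ) :
    DifferentiableAt ℝ Q (t, z) :=
  (hQ.contDiffAt ((hI.prod isOpen_univ).mem_nhds ⟨ht, mem_univ _⟩)).differentiableAt (by simp)

theorem fderiv_field_direction {I : Set ℝ} (hI : IsOpen I) {Q : Field}
    (hQ : ContDiffOn ℝ ∞ Q (I ×ˢ univ)) {t : ℝ} (ht : t ∈ I) (x y v : ℝ) :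
    fderiv ℝ Q (t, x, y) (1, 0, v) = fderiv ℝ Q (t, x, y) (1, 0, 0)
      + v • fderiv ℝ (fun z : ℝ × ℝ => Q (t, z.1, z.2)) (x, y) (0, 1) := by
  have hd := (differentiableAt_field hI hQ ht (x, y)).hasFDerivAt
  have h1 : HasDerivAt (fun s : ℝ => (t, x, s)) ((0 : ℝ), (0 : ℝ), (1 : ℝ)) y :=
    (hasDerivAt_const y t).prodMk ((hasDerivAt_const y x).prodMk (hasDerivAt_id y))
  have h2 : HasDerivAt (fun s : ℝ => (x, s)) ((0 : ℝ), (1 : ℝ)) y :=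
    (hasDerivAt_const y x).prodMk (hasDerivAt_id y)
  have h3 : HasFDerivAt (fun z : ℝ × ℝ => Q (t, z.1, z.2))
      (fderiv ℝ (fun z : ℝ × ℝ => Q (t, z.1, z.2)) (x, y)) (x, y) :=
    ((contDiff_slice_field hQ ht).differentiable (by simp) (x, y)).hasFDerivAt
  have h4 := (hd.comp_hasDerivAt y h1).unique (h3.comp_hasDerivAt y h2)
  rw [← h4]
  have e : ((1 : ℝ), (0 : ℝ), v) = (1, 0, 0) + v • ((0 : ℝ), (0 : ℝ), (1 : ℝ)) := by simp
  rw [e, map_add, map_smul]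

theorem Equation.Invariant.fderiv_tau {E : Equation} {Q : Field}
    (hQ : ContDiffOn ℝ ∞ Q (E.dom ×ˢ univ)) (hE : E.Invariant Q) {t : ℝ} (ht : t ∈ E.dom)
    (x y v : ℝ) :
    (fderiv ℝ Q (t, x, y) (1, 0, v)).1 = deriv (fun s => (Q (s, 0, 0)).1) t := by
  have hd := (differentiableAt_field E.dom_open hQ ht (x, y)).hasFDerivAt
  have h1 : HasDerivAt (fun s : ℝ => (s, x, y + (s - t) * v)) ((1 : ℝ), (0 : ℝ), v) t :=
    (hasDerivAt_id t).prodMk ((hasDerivAt_const t x).prodMk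
      (((((hasDerivAt_id t).sub_const t).mul_const v).const_add y).congr_deriv (by simp)))
  have hd' : HasFDerivAt Q (fderiv ℝ Q (t, x, y)) (t, x, y + (t - t) * v) := by simpa using hd
  have h2 := hasFDerivAt_fst.comp_hasDerivAt t (hd'.comp_hasDerivAt t h1)
  have h3 : (fun s => (Q (s, 0, 0)).1) =ᶠ[nhds t] fun s => (Q (s, x, y + (s - t) * v)).1 := by
    filter_upwards [E.dom_open.mem_nhds ht] with s hs
    exact (hE.tau_eq hQ hs _ _).symm
  rw [h3.deriv_eq]
  exact h2.deriv.symm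

/-- As `τ` is constant along the line, its contribution inside the derivative cancels the one
outside, and `v` disappears. -/
theorem Equation.Invariant.jetCoeff_eq {E : Equation} {Q : Field}
    (hQ : ContDiffOn ℝ ∞ Q (E.dom ×ˢ univ)) (hE : E.Invariant Q) {t : ℝ} (ht : t ∈ E.dom)
    {f v : ℝ → ℝ} (hf : ContDiff ℝ ∞ f) (hv : ContDiff ℝ ∞ v) (k : ℕ) (x : ℝ) :
    jetCoeff Q t f v k x = iteratedDeriv k (fun y => (Q (t, y, f y)).2.2) x
      - iteratedDeriv k (fun y => (Q (t, y, f y)).2.1 * deriv f y) x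
      + (Q (t, x, f x)).2.1 * iteratedDeriv (k + 1) f x := by
  have hξ : ContDiff ℝ ∞ (fun y => (Q (t, y, f y)).2.1) :=
    contDiff_comp_curve (contDiff_slice_field hQ ht).snd.fst hf
  have hη : ContDiff ℝ ∞ (fun y => (Q (t, y, f y)).2.2) :=
    contDiff_comp_curve (contDiff_slice_field hQ ht).snd.snd hf
  have hτ (y z : ℝ) : (Q (t, y, z)).1 = (Q (t, 0, 0)).1 := hE.tau_eq hQ ht y z
  simp only [jetCoeff, hτ]
  rw [iteratedDeriv_sub_of_smooth (hη.sub (contDiff_const.mul hv))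
    (hξ.mul (contDiff_deriv hf)), iteratedDeriv_sub_of_smooth hη (contDiff_const.mul hv),
    iteratedDeriv_const_mul_of_smooth hv]
  ring

/-- The coefficient of `u_xxxxx` gives `5 σ D_x ξ = τ σ' + σ τ_t`. The right-hand side depends on
`t` only, and `D_x ξ = ξ_x + ξ_u u_x` for an arbitrary slope, so `ξ_u = 0` and `ξ_x` is a function
of `t`. -/
theorem Equation.Invariant.xi_affine {E : Equation} {Q : Field}
    (hQ : ContDiffOn ℝ ∞ Q (E.dom ×ˢ univ)) (hE : E.Invariant Q) {t : ℝ} (ht : t ∈ E.dom) :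
    ∃ a b : ℝ, ∀ x y : ℝ, (Q (t, x, y)).2.1 = a * x + b := by
  have hsQ := contDiff_slice_field hQ ht
  have hs : ContDiff ℝ ∞ (fun z : ℝ × ℝ => (Q (t, z.1, z.2)).2.1) := hsQ.snd.fst
  have hsη : ContDiff ℝ ∞ (fun z : ℝ × ℝ => (Q (t, z.1, z.2)).2.2) := hsQ.snd.snd
  have hσ := E.σ_ne t ht
  set τ₁ := deriv (fun s => (Q (s, 0, 0)).1) t with hτ₁
  have key (x₀ a p : ℝ) :
      5 * E.σ t * (fderiv ℝ (fun z : ℝ × ℝ => (Q (t, z.1, z.2)).2.1) (x₀, a) (1, 0)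
      + fderiv ℝ (fun z : ℝ × ℝ => (Q (t, z.1, z.2)).2.1) (x₀, a) (0, 1) * p)
      = (Q (t, 0, 0)).1 * deriv E.σ t + E.σ t * τ₁ := by
    set f : ℝ → ℝ → ℝ := fun c y => a + p * (y - x₀) + c * (y - x₀) ^ 5 with hf_def
    have hf (c : ℝ) : ContDiff ℝ ∞ (f c) := contDiff_trinomial _ _ _ _ _
    have hfk (c : ℝ) (k : ℕ) : iteratedDeriv k (f c) x₀ = (if k = 0 then a else 0)
        + (if k = 1 then p else 0) + (if k = 5 then c * (Nat.factorial 5 : ℝ) else 0) :=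
      iteratedDeriv_trinomial a p c x₀ 5 k
    have hf0 (c : ℝ) : f c x₀ = a := by simp [f]
    have hf1 (c : ℝ) : deriv (f c) x₀ = p := by rw [← iteratedDeriv_one, hfk]; simp
    -- The fifth derivative `5! c` is compensated by `u_t`. Therefore the terms with `η_u` and `ξ_u`
    -- coming from `u_t` cancel those coming from the fifth derivative.
    have hinv (c : ℝ) := hE.jet hQ ht (hf c)
      (contDiff_const (c := -(E.α t * a * p + E.σ t * (120 * c)))) x₀ (by
      rw [hf0, hf1, hfk, hfk]; norm_num [Nat.factorial]; ring)
    have hξ (c : ℝ) : ContDiff ℝ ∞ (fun y => (Q (t, y, f c y)).2.1) :=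
      contDiff_comp_curve hs (hf c)
    have hdf (c : ℝ) (k : ℕ) : iteratedDeriv k (deriv (f c)) x₀ = iteratedDeriv (k + 1) (f c) x₀ := by
      rw [iteratedDeriv_succ']
    have hagree : ∀ j < 4 + 1, iteratedDeriv j (f 1) x₀ = iteratedDeriv j (f 0) x₀ := by
      intro j hj
      simp only [hfk, if_neg (show ¬ j = 5 by omega)]
    have hη1 := iteratedDeriv_comp_curve_congr (hf 1) (hf 0) hagree (k := 1) (by omega) hsη
    have hη3 := iteratedDeriv_comp_curve_congr (hf 1) (hf 0) hagree (k := 3) (by omega) hsη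
    have hη5 := iteratedDeriv_comp_curve_sub (hf 1) (hf 0) hagree hsη
    have hξ1 := iteratedDeriv_comp_curve_congr (hf 1) (hf 0) hagree (k := 1) (by omega) hs
    have hξ3 := iteratedDeriv_comp_curve_congr (hf 1) (hf 0) hagree (k := 3) (by omega) hs
    have hξ5 := iteratedDeriv_comp_curve_sub (hf 1) (hf 0) hagree hs
    have hη6 (z : ℝ × ℝ) : fderiv ℝ (fun z : ℝ × ℝ => (Q (t, z.1, z.2)).2.2) z (0, 1)
        = (fderiv ℝ (fun z : ℝ × ℝ => Q (t, z.1, z.2)) z (0, 1)).2.2 := by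
      have := (hsQ.differentiable (by simp) z).hasFDerivAt.snd.snd.fderiv
      rw [this]; rfl
    have hξ6 (z : ℝ × ℝ) : fderiv ℝ (fun z : ℝ × ℝ => (Q (t, z.1, z.2)).2.1) z (0, 1)
        = (fderiv ℝ (fun z : ℝ × ℝ => Q (t, z.1, z.2)) z (0, 1)).2.1 := by
      have := (hsQ.differentiable (by simp) z).hasFDerivAt.snd.fst.fderiv
      rw [this]; rfl
    have hD := deriv_comp_curve hs (hf 0) x₀
    simp only [hf0, hf1] at hD
    rw [← hD]
    have hjet (c w : ℝ) (k : ℕ) := hE.jetCoeff_eq hQ ht (hf c) (contDiff_const (c := w)) k x₀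
    simp only [iteratedDeriv_mul_of_smooth (hξ _) (contDiff_deriv (hf _)), hdf, hfk, hf0] at hjet
    have hj1 (c w : ℝ) := hjet c w 1
    have hj3 (c w : ℝ) := hjet c w 3
    have hj5 (c w : ℝ) := hjet c w 5
    norm_num [Finset.sum_range_succ, Nat.factorial] at hj1 hj3 hj5
    have e0 := hinv 0
    have e1 := hinv 1
    rw [hj1, hj3, hj5] at e0 e1
    simp only [fderiv_field_direction E.dom_open hQ ht x₀ _ (-_), hf0, hf1] at e0 e1
    have ht1 := hE.fderiv_tau hQ ht x₀ a 0
    have ht2 := hE.fderiv_tau hQ ht x₀ a 1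
    rw [fderiv_field_direction E.dom_open hQ ht] at ht2
    have hτ (y z : ℝ) : (Q (t, y, z)).1 = (Q (t, 0, 0)).1 := hE.tau_eq hQ ht y z
    simp only [hf0, hfk, hη6, hξ6] at hη5 hξ5
    norm_num [Nat.factorial] at hη5 hξ5
    simp only [Prod.fst_add, Prod.snd_add, Prod.smul_fst, Prod.smul_snd, smul_eq_mul, one_mul,
      ht1, hτ, hfk] at e0 e1 ht2
    norm_num [Nat.factorial] at e0 e1 ht2
    rw [ht2] at e0 e1
    norm_num [iteratedDeriv_one] at e0 e1 hξ1 hη1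
    rw [hξ1, hη1, hη3, hξ3] at e1
    linear_combination (e0 - e1 + E.σ t * hη5 - E.σ t * p * hξ5) / 120
  have h1 (z : ℝ × ℝ) : fderiv ℝ (fun z : ℝ × ℝ => (Q (t, z.1, z.2)).2.1) z (1, 0)
      = ((Q (t, 0, 0)).1 * deriv E.σ t + E.σ t * τ₁) / (5 * E.σ t) := by
    have := key z.1 z.2 0
    rw [mul_zero, add_zero] at this
    rw [eq_div_iff (mul_ne_zero (by norm_num) hσ)]
    linear_combination this
  have h2 (z : ℝ × ℝ) : fderiv ℝ (fun z : ℝ × ℝ => (Q (t, z.1, z.2)).2.1) z (0, 1) = 0 := by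
    have e0 := key z.1 z.2 0
    have e1 := key z.1 z.2 1
    have : E.σ t * fderiv ℝ (fun z : ℝ × ℝ => (Q (t, z.1, z.2)).2.1) z (0, 1) = 0 := by
      linear_combination (e1 - e0) / 5
    exact (mul_eq_zero.1 this).resolve_left hσ
  set κ := ((Q (t, 0, 0)).1 * deriv E.σ t + E.σ t * τ₁) / (5 * E.σ t)
  have hd (z : ℝ × ℝ) : HasFDerivAt (fun z : ℝ × ℝ => (Q (t, z.1, z.2)).2.1 - κ * z.1)
      (fderiv ℝ (fun z : ℝ × ℝ => (Q (t, z.1, z.2)).2.1) z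
        - κ • ContinuousLinearMap.fst ℝ ℝ ℝ) z :=
    (hs.differentiable (by simp) z).hasFDerivAt.sub (hasFDerivAt_fst.const_mul κ)
  have hconst := eq_of_partials_eq_zero (fun z => (hd z).differentiableAt)
    (fun z => by rw [(hd z).fderiv]; simp [h1]) (fun z => by rw [(hd z).fderiv]; simp [h2])
  refine ⟨κ, (Q (t, 0, 0)).2.1, fun x y => ?_⟩
  have := hconst (x, y) (0, 0)
  simp only at this
  linarith

/-- The equation does not contain `u_xxxx`, and once `ξ` is affine its coefficient in the criterion
is `5 σ D_x(η_u)`. Hence `η_u` is constant in `x` and `u`. -/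
theorem Equation.Invariant.eta_affine {E : Equation} {Q : Field}
    (hQ : ContDiffOn ℝ ∞ Q (E.dom ×ˢ univ)) (hE : E.Invariant Q) {t : ℝ} (ht : t ∈ E.dom) :
    ∃ a : ℝ, ∀ x y : ℝ, (Q (t, x, y)).2.2 = a * y + (Q (t, x, 0)).2.2 := by
  have hsη : ContDiff ℝ ∞ (fun z : ℝ × ℝ => (Q (t, z.1, z.2)).2.2) :=
    (contDiff_slice_field hQ ht).snd.snd
  have hs := contDiff_directional hsη (0, 1)
  obtain ⟨ξ₁, ξ₀, hξ⟩ := hE.xi_affine hQ ht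
  have key (x₀ a p : ℝ) :
      fderiv ℝ (fun z => fderiv ℝ (fun z : ℝ × ℝ => (Q (t, z.1, z.2)).2.2) z (0, 1)) (x₀, a) (1, 0)
      + fderiv ℝ (fun z => fderiv ℝ (fun z : ℝ × ℝ => (Q (t, z.1, z.2)).2.2) z (0, 1)) (x₀, a)
          (0, 1) * p = 0 := by
    set f : ℝ → ℝ → ℝ := fun c y => a + p * (y - x₀) + c * (y - x₀) ^ 4 with hf_def
    have hf (c : ℝ) : ContDiff ℝ ∞ (f c) := contDiff_trinomial _ _ _ _ _
    have hfk (c : ℝ) (k : ℕ) : iteratedDeriv k (f c) x₀ = (if k = 0 then a else 0)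
        + (if k = 1 then p else 0) + (if k = 4 then c * (Nat.factorial 4 : ℝ) else 0) :=
      iteratedDeriv_trinomial a p c x₀ 4 k
    have hf0 (c : ℝ) : f c x₀ = a := by simp [f]
    have hf1 (c : ℝ) : deriv (f c) x₀ = p := by rw [← iteratedDeriv_one, hfk]; simp
    have hinv (c : ℝ) := hE.jet hQ ht (hf c)
      (contDiff_const (c := -(E.α t * a * p))) x₀ (by
      rw [hf0, hf1, hfk, hfk]; norm_num)
    have hdf (c : ℝ) (k : ℕ) : iteratedDeriv k (deriv (f c)) x₀ = iteratedDeriv (k + 1) (f c) x₀ := by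
      rw [iteratedDeriv_succ']
    have hagree : ∀ j < 2 + 2, iteratedDeriv j (f 1) x₀ = iteratedDeriv j (f 0) x₀ := by
      intro j hj
      simp only [hfk, if_neg (show ¬ j = 4 by omega)]
    have hη1 := iteratedDeriv_comp_curve_congr (hf 1) (hf 0) hagree (k := 1) (by omega) hsη
    have hη3 := iteratedDeriv_comp_curve_congr (hf 1) (hf 0) hagree (k := 3) (by omega) hsη
    have hη5 := iteratedDeriv_comp_curve_sub_succ (hf 1) (hf 0) hagree
      (by rw [hfk, hfk]; norm_num) hsη
    have hD := deriv_comp_curve hs (hf 0) x₀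
    simp only [hf0, hf1] at hD
    rw [← hD]
    have hj (c : ℝ) (k : ℕ) : jetCoeff Q t (f c) (fun _ => -(E.α t * a * p)) (k + 1) x₀
        = iteratedDeriv (k + 1) (fun y => (Q (t, y, f c y)).2.2) x₀
          - (k + 1) * ξ₁ * iteratedDeriv (k + 1) (f c) x₀ := by
      rw [hE.jetCoeff_eq hQ ht (hf c) contDiff_const]
      simp only [hξ]
      rw [iteratedDeriv_affine_mul (contDiff_deriv (hf c)), hdf, hdf]
      ring
    have hj1 (c : ℝ) := hj c 0
    have hj3 (c : ℝ) := hj c 2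
    have hj5 (c : ℝ) := hj c 4
    simp only [hfk] at hj1 hj3 hj5 hη5
    norm_num [Nat.factorial] at hj1 hj3 hj5 hη5
    have e0 := hinv 0
    have e1 := hinv 1
    rw [hj1, hj3, hj5] at e0 e1
    simp only [hf0, hf1, hfk] at e0 e1
    norm_num [Nat.factorial, iteratedDeriv_one] at e0 e1 hη1
    rw [hη1, hη3] at e1
    have hσ := E.σ_ne t ht
    have : E.σ t * deriv (fun y =>
        fderiv ℝ (fun z : ℝ × ℝ => (Q (t, z.1, z.2)).2.2) (y, f 0 y) (0, 1)) x₀ = 0 := by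
      linear_combination (e1 - e0 - E.σ t * hη5) / 120
    exact (mul_eq_zero.1 this).resolve_left hσ
  have h1 (z : ℝ × ℝ) : fderiv ℝ
      (fun z => fderiv ℝ (fun z : ℝ × ℝ => (Q (t, z.1, z.2)).2.2) z (0, 1)) z (1, 0) = 0 := by
    simpa using key z.1 z.2 0
  have h2 (z : ℝ × ℝ) : fderiv ℝ
      (fun z => fderiv ℝ (fun z : ℝ × ℝ => (Q (t, z.1, z.2)).2.2) z (0, 1)) z (0, 1) = 0 := by
    simpa [h1] using key z.1 z.2 1
  have hc := eq_of_partials_eq_zero (hs.differentiable (by simp)) h1 h2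
  set κ := fderiv ℝ (fun z : ℝ × ℝ => (Q (t, z.1, z.2)).2.2) (0, 0) (0, 1)
  refine ⟨κ, fun x y => ?_⟩
  have hd (y : ℝ) : HasDerivAt (fun y => (Q (t, x, y)).2.2 - κ * y) 0 y := by
    have h3 : HasDerivAt (fun s : ℝ => (x, s)) ((0 : ℝ), (1 : ℝ)) y :=
      (hasDerivAt_const y x).prodMk (hasDerivAt_id y)
    have h4 := (hsη.differentiable (by simp) (x, y)).hasFDerivAt.comp_hasDerivAt y h3
    rw [hc (x, y) (0, 0)] at h4
    exact (h4.sub ((hasDerivAt_id y).const_mul κ)).congr_deriv (by simp [κ])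
  have := is_const_of_deriv_eq_zero (fun y => (hd y).differentiableAt) (fun y => (hd y).deriv) y 0
  simp only [mul_zero, sub_zero] at this
  linarith

/-- The coefficient of `u_x` in the invariance criterion. -/
theorem Equation.Invariant.eta_of_xi {E : Equation} {Q : Field}
    (hQ : ContDiffOn ℝ ∞ Q (E.dom ×ˢ univ)) (hE : E.Invariant Q) {t : ℝ} (ht : t ∈ E.dom)
    (x : ℝ) : E.α t * (Q (t, x, 0)).2.2 = (fderiv ℝ Q (t, x, 0) (1, 0, 0)).2.1 := by
  obtain ⟨ξ₁, ξ₀, hξ⟩ := hE.xi_affine hQ ht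
  obtain ⟨η₁, hη⟩ := hE.eta_affine hQ ht
  have hη0 : ContDiff ℝ ∞ (fun y => (Q (t, y, 0)).2.2) :=
    contDiff_comp_curve (contDiff_slice_field hQ ht).snd.snd contDiff_const
  -- At `x` this jet has `u = 0`, `u_x = p` and `u_t = 0`, so it lies on the equation for every `p`;
  -- the difference between `p = 1` and `p = 0` is the coefficient of `u_x`.
  set f : ℝ → ℝ → ℝ := fun p y => 0 + p * (y - x) + 0 * (y - x) ^ 7 with hf_def
  have hf (p : ℝ) : ContDiff ℝ ∞ (f p) := contDiff_trinomial _ _ _ _ _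
  have hfk (p : ℝ) (k : ℕ) : iteratedDeriv k (f p) x = (if k = 0 then 0 else 0)
      + (if k = 1 then p else 0) + (if k = 7 then 0 * (Nat.factorial 7 : ℝ) else 0) :=
    iteratedDeriv_trinomial 0 p 0 x 7 k
  have hf0 (p : ℝ) : f p x = 0 := by simp [f]
  have hf1 (p : ℝ) : deriv (f p) x = p := by rw [← iteratedDeriv_one, hfk]; simp
  have hinv (p : ℝ) := hE.jet hQ ht (hf p) (contDiff_const (c := 0)) x (by
      rw [hf0, hf1, hfk, hfk]; norm_num)
  have hdf (c : ℝ) (k : ℕ) : iteratedDeriv k (deriv (f c)) x = iteratedDeriv (k + 1) (f c) x := by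
    rw [iteratedDeriv_succ']
  have hj (c : ℝ) (k : ℕ) : jetCoeff Q t (f c) (fun _ => 0) (k + 1) x
      = η₁ * iteratedDeriv (k + 1) (f c) x + iteratedDeriv (k + 1) (fun y => (Q (t, y, 0)).2.2) x
        - (k + 1) * ξ₁ * iteratedDeriv (k + 1) (f c) x := by
    rw [hE.jetCoeff_eq hQ ht (hf c) contDiff_const]
    have : (fun y => (Q (t, y, f c y)).2.2) = fun y => η₁ * f c y + (Q (t, y, 0)).2.2 :=
      funext fun y => hη _ _
    simp only [hξ, this]
    rw [iteratedDeriv_affine_mul (contDiff_deriv (hf c)), hdf, hdf,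
      iteratedDeriv_add_of_smooth (contDiff_const.mul (hf c)) hη0,
      iteratedDeriv_const_mul_of_smooth (hf c)]
    ring
  have hj3 (c : ℝ) := hj c 2
  have hj5 (c : ℝ) := hj c 4
  simp only [hfk] at hj3 hj5
  norm_num at hj3 hj5
  have e0 := hinv 0
  have e1 := hinv 1
  rw [hj3, hj5] at e0 e1
  simp only [hf0, hf1, hfk] at e0 e1
  norm_num at e0 e1
  linear_combination e1 - e0

/-! ## Fields with affine components -/

/-- Subtracting `(η₁ - τ')` times the left-hand side of the equation eliminates `u_t`. In what is
left, `u`, `u_x`, `u_xxx`, `u_xxxxx` and `x` are free, so on the equation every coefficient must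
vanish. -/
theorem prolong_affine (E : Equation) {Q : Field} (hQ : ContDiffOn ℝ ∞ Q (E.dom ×ˢ univ))
    {τ ξ₁ ξ₀ η₁ η₂ η₀ : ℝ → ℝ}
    (hform : ∀ s ∈ E.dom, ∀ x y, Q (s, x, y) = (τ s, ξ₁ s * x + ξ₀ s, η₁ s * y + η₂ s * x + η₀ s))
    {t : ℝ} (ht : t ∈ E.dom) {τ' ξ₁' ξ₀' η₁' η₂' η₀' : ℝ} (hτ : HasDerivAt τ τ' t)
    (hξ₁ : HasDerivAt ξ₁ ξ₁' t) (hξ₀ : HasDerivAt ξ₀ ξ₀' t) (hη₁ : HasDerivAt η₁ η₁' t)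
    (hη₂ : HasDerivAt η₂ η₂' t) (hη₀ : HasDerivAt η₀ η₀' t) {u : ℝ → ℝ → ℝ}
    (hu : ContDiff ℝ ∞ (fun z : ℝ × ℝ => u z.1 z.2)) (x : ℝ) :
    E.prolong Q u t x - (η₁ t - τ') * E.lhs u t x
      = deriv (u t) x * ((E.α t * η₂ t - ξ₁') * x + (E.α t * η₀ t - ξ₀'))
        + u t x * deriv (u t) x * (τ t * deriv E.α t + E.α t * (τ' + η₁ t - ξ₁ t))
        + iteratedDeriv 3 (u t) x * (τ t * deriv E.β t + E.β t * (τ' - 3 * ξ₁ t))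
        + iteratedDeriv 5 (u t) x * (τ t * deriv E.σ t + E.σ t * (τ' - 5 * ξ₁ t))
        + u t x * (η₁' + E.α t * η₂ t) + η₂' * x + η₀' := by
  have hnhds := E.dom_open.mem_nhds ht
  have hut := contDiff_slice hu t
  have hv := contDiff_slice_Dt hu t
  have hd : HasDerivAt (fun s => u s x) (Dt u t x) t := by
    have h1 : ContDiff ℝ ∞ (fun s : ℝ => u s x) :=
      hu.comp (contDiff_id.prodMk contDiff_const : ContDiff ℝ ∞ fun s : ℝ => (s, x))
    exact (h1.differentiable (by simp) t).hasDerivAt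
  have e1 : Dt (tauAlong Q u) t x = τ' := by
    have : (fun s => tauAlong Q u s x) =ᶠ[nhds t] τ := by
      filter_upwards [hnhds] with s hs
      simp [tauAlong, hform s hs]
    exact this.deriv_eq.trans hτ.deriv
  have e2 : Dt (xiAlong Q u) t x = ξ₁' * x + ξ₀' := by
    have : (fun s => xiAlong Q u s x) =ᶠ[nhds t] fun s => ξ₁ s * x + ξ₀ s := by
      filter_upwards [hnhds] with s hs
      simp [xiAlong, hform s hs]
    exact this.deriv_eq.trans ((hξ₁.mul_const x).add hξ₀).deriv
  have e3 : Dt (etaAlong Q u) t x = η₁' * u t x + η₁ t * Dt u t x + η₂' * x + η₀' := by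
    have : (fun s => etaAlong Q u s x) =ᶠ[nhds t] fun s => η₁ s * u s x + η₂ s * x + η₀ s := by
      filter_upwards [hnhds] with s hs
      simp [etaAlong, hform s hs]
    exact this.deriv_eq.trans (((hη₁.mul hd).add (hη₂.mul_const x)).add hη₀).deriv
  have e4 (k : ℕ) : etaX Q u (k + 1) t x = (η₁ t - (k + 1) * ξ₁ t) * iteratedDeriv (k + 1) (u t) x
      + (if k = 0 then η₂ t else 0) := by
    rw [etaX_eq hQ hu ht]
    simp only [etaAlong, tauAlong, xiAlong, hform t ht]
    have s1 : ContDiff ℝ ∞ (fun y => η₁ t * u t y) := contDiff_const.mul hut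
    have s2 : ContDiff ℝ ∞ (fun y => (η₂ t * y + η₀ t) * 1) := by fun_prop
    have s3 : ContDiff ℝ ∞ (fun y => τ t * Dt u t y) := contDiff_const.mul hv
    have s4 : ContDiff ℝ ∞ (fun y => (ξ₁ t * y + ξ₀ t) * deriv (u t) y) :=
      (by fun_prop : ContDiff ℝ ∞ (fun y => ξ₁ t * y + ξ₀ t)).mul (contDiff_deriv hut)
    have e : (fun y => η₁ t * u t y + η₂ t * y + η₀ t - τ t * Dt u t y
        - (ξ₁ t * y + ξ₀ t) * deriv (u t) y)
        = fun y => ((η₁ t * u t y + (η₂ t * y + η₀ t) * 1) - τ t * Dt u t y)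
        - (ξ₁ t * y + ξ₀ t) * deriv (u t) y := by funext y; ring
    rw [e, iteratedDeriv_sub_of_smooth ((s1.add s2).sub s3) s4,
      iteratedDeriv_sub_of_smooth (s1.add s2) s3, iteratedDeriv_add_of_smooth s1 s2,
      iteratedDeriv_const_mul_of_smooth hut, iteratedDeriv_const_mul_of_smooth hv,
      iteratedDeriv_affine_mul (contDiff_deriv hut), iteratedDeriv_affine_mul contDiff_const,
      ← iteratedDeriv_succ', ← iteratedDeriv_succ', iteratedDeriv_const, iteratedDeriv_const]
    rcases k with _ | k
    · simp; ring
    · simp; ring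
  have e5 : Dx u t x = deriv (u t) x := rfl
  have e6 := e4 0
  have e7 := e4 2
  have e8 := e4 4
  norm_num [iteratedDeriv_one] at e6 e7 e8
  simp only [Equation.prolong, Equation.lhs, etaT, e1, e2, e3, e5, e6, e7, e8,
    Dx_iterate_eq_iteratedDeriv, etaAlong, tauAlong, hform t ht]
  ring

/-- An invariant field has components that are affine in `x` and `u`. -/
theorem Equation.Invariant.affine {E : Equation} {Q : Field}
    (hQ : ContDiffOn ℝ ∞ Q (E.dom ×ˢ univ)) (hE : E.Invariant Q) {t : ℝ} (ht : t ∈ E.dom)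
    (x y : ℝ) : Q (t, x, y) = ((Q (t, 0, 0)).1,
      ((Q (t, 1, 0)).2.1 - (Q (t, 0, 0)).2.1) * x + (Q (t, 0, 0)).2.1,
      ((Q (t, 0, 1)).2.2 - (Q (t, 0, 0)).2.2) * y
        + ((Q (t, 1, 0)).2.2 - (Q (t, 0, 0)).2.2) * x + (Q (t, 0, 0)).2.2) := by
  have hξ (s : ℝ) (hs : s ∈ E.dom) (x y : ℝ) : (Q (s, x, y)).2.1
      = ((Q (s, 1, 0)).2.1 - (Q (s, 0, 0)).2.1) * x + (Q (s, 0, 0)).2.1 := by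
    obtain ⟨a, b, h⟩ := hE.xi_affine hQ hs
    rw [h, h, h]; ring
  have hd (x : ℝ) : HasDerivAt (fun s => (Q (s, x, 0)).2.1)
      (fderiv ℝ Q (t, x, 0) (1, 0, 0)).2.1 t := by
    have h1 : HasDerivAt (fun s : ℝ => (s, x, (0 : ℝ))) ((1 : ℝ), (0 : ℝ), (0 : ℝ)) t :=
      (hasDerivAt_id t).prodMk ((hasDerivAt_const t x).prodMk (hasDerivAt_const t 0))
    exact (hasFDerivAt_fst.comp_hasDerivAt t (hasFDerivAt_snd.comp_hasDerivAt t
      ((differentiableAt_field E.dom_open hQ ht (x, 0)).hasFDerivAt.comp_hasDerivAt t h1)))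
  -- Differentiating the affine form of `ξ` in `t` shows that `ξ_t` is affine in `x`; by `eta_of_xi`
  -- so is `η` at `u = 0`.
  have hd' : HasDerivAt (fun s => (Q (s, x, 0)).2.1)
      (((fderiv ℝ Q (t, 1, 0) (1, 0, 0)).2.1 - (fderiv ℝ Q (t, 0, 0) (1, 0, 0)).2.1) * x
        + (fderiv ℝ Q (t, 0, 0) (1, 0, 0)).2.1) t := by
    refine ((((hd 1).sub (hd 0)).mul_const x).add (hd 0)).congr_of_eventuallyEq ?_
    filter_upwards [E.dom_open.mem_nhds ht] with s hs
    exact hξ s hs x 0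
  have hu := (hd x).unique hd'
  rw [← hE.eta_of_xi hQ ht, ← hE.eta_of_xi hQ ht, ← hE.eta_of_xi hQ ht] at hu
  have hη : (Q (t, x, 0)).2.2
      = ((Q (t, 1, 0)).2.2 - (Q (t, 0, 0)).2.2) * x + (Q (t, 0, 0)).2.2 :=
    mul_left_cancel₀ (E.α_ne t ht) (by linear_combination hu)
  obtain ⟨a, ha⟩ := hE.eta_affine hQ ht
  refine Prod.ext (hE.tau_eq hQ ht x y) (Prod.ext (hξ t ht x y) ?_)
  have h1 := ha 0 1
  have h2 := ha x y
  change (Q (t, x, y)).2.2 = _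
  rw [h2, hη, h1]
  ring

/-! ## The maximal Lie invariance algebra -/

/-- The field that corresponds to the quadratic polynomial `c s² + p s + r` of `s = A(t)`, the
scaling parameter `m` and the parameters `k₀`, `k₁` of the kernel part. -/
noncomputable def Equation.symmetryField (E : Equation) (A : ℝ → ℝ) (c p r m k₀ k₁ : ℝ) : Field :=
  fieldOn E.dom fun t x u => ((c * A t ^ 2 + p * A t + r) / E.α t,
    (m + p / 2 + c * A t) * x + (k₀ * A t + k₁), (m - p / 2 - c * A t) * u + c * x + k₀)

/-- The classifying equations for the coefficients. -/
def Equation.Classifying (E : Equation) (A : ℝ → ℝ) (c p r m : ℝ) : Prop :=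
  ∀ t ∈ E.dom,
    (c * A t ^ 2 + p * A t + r) * (deriv E.β t * E.α t - deriv E.α t * E.β t)
      = (3 * m + (p / 2 + c * A t)) * E.α t ^ 2 * E.β t ∧
    (c * A t ^ 2 + p * A t + r) * (deriv E.σ t * E.α t - deriv E.α t * E.σ t)
      = (5 * m + 3 * (p / 2 + c * A t)) * E.α t ^ 2 * E.σ t

theorem Equation.exists_eq_const (E : Equation) {f : ℝ → ℝ} (hf : ∀ t ∈ E.dom, HasDerivAt f 0 t) :
    ∃ C, ∀ t ∈ E.dom, f t = C := by
  obtain ⟨t₀, h₀⟩ := E.dom_nonempty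
  refine ⟨f t₀, fun t ht => ?_⟩
  exact E.dom_open.is_const_of_deriv_eq_zero E.dom_interval.isPreconnected
    (fun s hs => (hf s hs).differentiableAt.differentiableWithinAt)
    (fun s hs => (hf s hs).deriv) ht h₀

/-! ### Evaluation and smoothness of fields and coefficients -/

theorem fieldOn_apply {I : Set ℝ} {t : ℝ} (ht : t ∈ I) (f : ℝ → ℝ → ℝ → ℝ × ℝ × ℝ) (x y : ℝ) :
    fieldOn I f (t, x, y) = f t x y :=
  indicator_of_mem (show (t, x, y) ∈ I ×ˢ (univ : Set (ℝ × ℝ)) from ⟨ht, mem_univ _⟩) _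

theorem fieldOn_apply_of_notMem {I : Set ℝ} {z : ℝ × ℝ × ℝ} (hz : z.1 ∉ I)
    (f : ℝ → ℝ → ℝ → ℝ × ℝ × ℝ) : fieldOn I f z = 0 :=
  indicator_of_notMem (fun h => hz h.1) _

theorem Equation.hasDerivAt_α (E : Equation) {t : ℝ} (ht : t ∈ E.dom) :
    HasDerivAt E.α (deriv E.α t) t :=
  ((E.α_smooth.contDiffAt (E.dom_open.mem_nhds ht)).differentiableAt (by simp)).hasDerivAt

theorem Equation.hasDerivAt_β (E : Equation) {t : ℝ} (ht : t ∈ E.dom) :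
    HasDerivAt E.β (deriv E.β t) t :=
  ((E.β_smooth.contDiffAt (E.dom_open.mem_nhds ht)).differentiableAt (by simp)).hasDerivAt

theorem Equation.hasDerivAt_σ (E : Equation) {t : ℝ} (ht : t ∈ E.dom) :
    HasDerivAt E.σ (deriv E.σ t) t :=
  ((E.σ_smooth.contDiffAt (E.dom_open.mem_nhds ht)).differentiableAt (by simp)).hasDerivAt

theorem Equation.antiderivative_smooth (E : Equation) {A : ℝ → ℝ}
    (hA : ∀ t ∈ E.dom, HasDerivAt A (E.α t) t) : ContDiffOn ℝ ∞ A E.dom := by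
  rw [contDiffOn_infty_iff_deriv_of_isOpen E.dom_open]
  exact ⟨fun t ht => (hA t ht).differentiableAt.differentiableWithinAt,
    E.α_smooth.congr fun t ht => (hA t ht).deriv⟩

theorem Equation.symmetryField_smooth (E : Equation) {A : ℝ → ℝ}
    (hA : ∀ t ∈ E.dom, HasDerivAt A (E.α t) t) (c p r m k₀ k₁ : ℝ) :
    ContDiffOn ℝ ∞ (E.symmetryField A c p r m k₀ k₁) (E.dom ×ˢ univ) := by
  have h1 : ContDiffOn ℝ ∞ (fun z : ℝ × ℝ × ℝ => A z.1) (E.dom ×ˢ univ) :=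
    (E.antiderivative_smooth hA).comp contDiff_fst.contDiffOn fun z hz => hz.1
  have h2 : ContDiffOn ℝ ∞ (fun z : ℝ × ℝ × ℝ => E.α z.1) (E.dom ×ˢ univ) :=
    E.α_smooth.comp contDiff_fst.contDiffOn fun z hz => hz.1
  have hx : ContDiffOn ℝ ∞ (fun z : ℝ × ℝ × ℝ => z.2.1) (E.dom ×ˢ univ) :=
    (contDiff_fst.comp contDiff_snd).contDiffOn
  have hy : ContDiffOn ℝ ∞ (fun z : ℝ × ℝ × ℝ => z.2.2) (E.dom ×ˢ univ) :=
    (contDiff_snd.comp contDiff_snd).contDiffOn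
  have h : ContDiffOn ℝ ∞ (fun z : ℝ × ℝ × ℝ => (((c * A z.1 ^ 2 + p * A z.1 + r) / E.α z.1,
    (m + p / 2 + c * A z.1) * z.2.1 + (k₀ * A z.1 + k₁),
    (m - p / 2 - c * A z.1) * z.2.2 + c * z.2.1 + k₀) : ℝ × ℝ × ℝ)) (E.dom ×ˢ univ) := by
    refine ContDiffOn.prodMk ?_ (ContDiffOn.prodMk ?_ ?_)
    · exact (((contDiffOn_const.mul (h1.pow 2)).add (contDiffOn_const.mul h1)).add
        contDiffOn_const).div h2 fun z hz => E.α_ne _ hz.1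
    · exact ((contDiffOn_const.add (contDiffOn_const.mul h1)).mul hx).add
        ((contDiffOn_const.mul h1).add contDiffOn_const)
    · exact (((contDiffOn_const.sub (contDiffOn_const.mul h1)).mul hy).add
        (contDiffOn_const.mul hx)).add contDiffOn_const
  exact h.congr fun z hz => fieldOn_apply hz.1 _ _ _

/-- The split determining equations integrate explicitly: `η₂` and `η₀` are constant, `ξ₁ - cA` and
`η₁ + cA` are constant, and `τ α` is quadratic in `A`. Eliminating `τ'` from the conditions on `α`,
`β`, `σ` leaves exactly the classifying equations. -/
theorem Equation.mem_maxAlgebra_iff (E : Equation) {A : ℝ → ℝ}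
    (hA : ∀ t ∈ E.dom, HasDerivAt A (E.α t) t) (Q : Field) :
    Q ∈ E.maxAlgebra ↔ ∃ c p r m k₀ k₁ : ℝ,
      Q = E.symmetryField A c p r m k₀ k₁ ∧ E.Classifying A c p r m := by
  constructor
  · rintro ⟨hzero, hQ, hE⟩
    have hdiff (x y : ℝ) {t : ℝ} (ht : t ∈ E.dom) :
        DifferentiableAt ℝ (fun s => Q (s, x, y)) t :=
      DifferentiableAt.comp t (differentiableAt_field E.dom_open hQ ht (x, y))
        (differentiableAt_id.prodMk (differentiableAt_const _))
    set τ : ℝ → ℝ := fun s => (Q (s, 0, 0)).1 with hτ_def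
    set ξ₀ : ℝ → ℝ := fun s => (Q (s, 0, 0)).2.1 with hξ₀_def
    set ξ₁ : ℝ → ℝ := fun s => (Q (s, 1, 0)).2.1 - (Q (s, 0, 0)).2.1 with hξ₁_def
    set η₀ : ℝ → ℝ := fun s => (Q (s, 0, 0)).2.2 with hη₀_def
    set η₂ : ℝ → ℝ := fun s => (Q (s, 1, 0)).2.2 - (Q (s, 0, 0)).2.2 with hη₂_def
    set η₁ : ℝ → ℝ := fun s => (Q (s, 0, 1)).2.2 - (Q (s, 0, 0)).2.2 with hη₁_def
    have hform : ∀ s ∈ E.dom, ∀ x y,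
        Q (s, x, y) = (τ s, ξ₁ s * x + ξ₀ s, η₁ s * y + η₂ s * x + η₀ s) :=
      fun s hs x y => hE.affine hQ hs x y
    have dτ (t) (ht : t ∈ E.dom) : HasDerivAt τ (deriv τ t) t := (hdiff 0 0 ht).fst.hasDerivAt
    have dξ₀ (t) (ht : t ∈ E.dom) : HasDerivAt ξ₀ (deriv ξ₀ t) t :=
      (hdiff 0 0 ht).snd.fst.hasDerivAt
    have dξ₁ (t) (ht : t ∈ E.dom) : HasDerivAt ξ₁ (deriv ξ₁ t) t :=
      ((hdiff 1 0 ht).snd.fst.sub (hdiff 0 0 ht).snd.fst).hasDerivAt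
    have dη₀ (t) (ht : t ∈ E.dom) : HasDerivAt η₀ (deriv η₀ t) t :=
      (hdiff 0 0 ht).snd.snd.hasDerivAt
    have dη₂ (t) (ht : t ∈ E.dom) : HasDerivAt η₂ (deriv η₂ t) t :=
      ((hdiff 1 0 ht).snd.snd.sub (hdiff 0 0 ht).snd.snd).hasDerivAt
    have dη₁ (t) (ht : t ∈ E.dom) : HasDerivAt η₁ (deriv η₁ t) t :=
      ((hdiff 0 1 ht).snd.snd.sub (hdiff 0 0 ht).snd.snd).hasDerivAt
    -- Here `a = u` and `b = u_x`, while `n` selects which of `u_xxx = 3! d` and `u_xxxxx = 5! d` is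
    -- present.
    have main (t) (ht : t ∈ E.dom) (x a b d : ℝ) (n : ℕ) :
        b * ((E.α t * η₂ t - deriv ξ₁ t) * x + (E.α t * η₀ t - deriv ξ₀ t))
        + a * b * (τ t * deriv E.α t + E.α t * (deriv τ t + η₁ t - ξ₁ t))
        + (if n = 0 then d * 6 else 0) * (τ t * deriv E.β t + E.β t * (deriv τ t - 3 * ξ₁ t))
        + (if n = 0 then 0 else d * 120) * (τ t * deriv E.σ t + E.σ t * (deriv τ t - 5 * ξ₁ t))
        + a * (deriv η₁ t + E.α t * η₂ t) + deriv η₂ t * x + deriv η₀ t = 0 := by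
      obtain ⟨j, hj⟩ : ∃ j : ℕ, j = if n = 0 then 3 else 5 := ⟨_, rfl⟩
      have hj2 : 2 ≤ j := by rw [hj]; split_ifs <;> norm_num
      set f : ℝ → ℝ := fun y => a + b * (y - x) + d * (y - x) ^ j with hf_def
      have hf : ContDiff ℝ ∞ f := contDiff_trinomial _ _ _ _ _
      have hfk (k : ℕ) := iteratedDeriv_trinomial a b d x j k
      have hf0 : f x = a := by simp [f, show j ≠ 0 by omega]
      have hf1 : deriv f x = b := by
        rw [← iteratedDeriv_one, hfk]; simp [show (1 : ℕ) ≠ j by omega]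
      have hf3 : iteratedDeriv 3 f x = if n = 0 then d * 6 else 0 := by
        rw [hfk, hj]
        by_cases hn : n = 0
        · simp only [hn, if_true]; norm_num [Nat.factorial]
        · simp only [hn, if_false]; norm_num [Nat.factorial]
      have hf5 : iteratedDeriv 5 f x = if n = 0 then 0 else d * 120 := by
        rw [hfk, hj]
        by_cases hn : n = 0
        · simp only [hn, if_true]; norm_num [Nat.factorial]
        · simp only [hn, if_false]; norm_num [Nat.factorial]
      -- The number `w` is the value of `u_t` that the equation dictates.
      obtain ⟨w, hw⟩ : ∃ w : ℝ, w = -(E.α t * a * b + E.β t * iteratedDeriv 3 f x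
        + E.σ t * iteratedDeriv 5 f x) := ⟨_, rfl⟩
      set u : ℝ → ℝ → ℝ := fun s y => f y + (s - t) * w with hu_def
      have hu : ContDiff ℝ ∞ (fun z : ℝ × ℝ => u z.1 z.2) := by
        have h1 : ContDiff ℝ ∞ (fun z : ℝ × ℝ => f z.2) := hf.comp contDiff_snd
        exact h1.add ((contDiff_fst.sub contDiff_const).mul contDiff_const)
      have hut : u t = f := by funext y; simp [u]
      have hDt : Dt u t x = w :=
        (((((hasDerivAt_id t).sub_const t).mul_const w).const_add (f x)).congr_deriv
          (by simp)).deriv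
      have hlhs : E.lhs u t x = 0 := by
        have h1 : Dx u t x = b := by simp only [Dx, hut, hf1]
        simp only [Equation.lhs, Dx_iterate_eq_iteratedDeriv, hut, hDt, h1, hf0]
        rw [hw]; ring
      have h := prolong_affine E hQ hform ht (dτ t ht) (dξ₁ t ht) (dξ₀ t ht) (dη₁ t ht)
        (dη₂ t ht) (dη₀ t ht) hu x
      rw [hE u hu t ht x hlhs, hlhs, hut, hf0, hf1, hf3, hf5] at h
      linear_combination -h
    -- Values 0 and 1 of the free jet variables isolate the coefficients one after another.
    have q1 (t) (ht : t ∈ E.dom) : deriv η₀ t = 0 := by simpa using main t ht 0 0 0 0 0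
    have q2 (t) (ht : t ∈ E.dom) : deriv η₂ t = 0 := by simpa [q1 t ht] using main t ht 1 0 0 0 0
    have q3 (t) (ht : t ∈ E.dom) : deriv η₁ t + E.α t * η₂ t = 0 := by
      simpa [q1 t ht] using main t ht 0 1 0 0 0
    have q4 (t) (ht : t ∈ E.dom) : E.α t * η₀ t - deriv ξ₀ t = 0 := by
      simpa [q1 t ht] using main t ht 0 0 1 0 0
    have q5 (t) (ht : t ∈ E.dom) : E.α t * η₂ t - deriv ξ₁ t = 0 := by
      simpa [q1 t ht, q2 t ht, q4 t ht] using main t ht 1 0 1 0 0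
    have q6 (t) (ht : t ∈ E.dom) :
        τ t * deriv E.α t + E.α t * (deriv τ t + η₁ t - ξ₁ t) = 0 := by
      simpa [q1 t ht, q3 t ht, q4 t ht] using main t ht 0 1 1 0 0
    have q7 (t) (ht : t ∈ E.dom) :
        τ t * deriv E.β t + E.β t * (deriv τ t - 3 * ξ₁ t) = 0 := by
      simpa [q1 t ht] using main t ht 0 0 0 1 0
    have q8 (t) (ht : t ∈ E.dom) :
        τ t * deriv E.σ t + E.σ t * (deriv τ t - 5 * ξ₁ t) = 0 := by
      simpa [q1 t ht] using main t ht 0 0 0 1 1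
    obtain ⟨k₀, hk₀⟩ := E.exists_eq_const fun t ht => (dη₀ t ht).congr_deriv (q1 t ht)
    obtain ⟨c, hc⟩ := E.exists_eq_const fun t ht => (dη₂ t ht).congr_deriv (q2 t ht)
    obtain ⟨k₁, hk₁⟩ := E.exists_eq_const (f := fun t => ξ₀ t - k₀ * A t) fun t ht =>
      ((dξ₀ t ht).sub ((hA t ht).const_mul k₀)).congr_deriv (by
        rw [← hk₀ t ht]; linear_combination -(q4 t ht))
    obtain ⟨a₁, ha₁⟩ := E.exists_eq_const (f := fun t => ξ₁ t - c * A t) fun t ht =>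
      ((dξ₁ t ht).sub ((hA t ht).const_mul c)).congr_deriv (by
        rw [← hc t ht]; linear_combination -(q5 t ht))
    obtain ⟨a₃, ha₃⟩ := E.exists_eq_const (f := fun t => η₁ t + c * A t) fun t ht =>
      ((dη₁ t ht).add ((hA t ht).const_mul c)).congr_deriv (by
        rw [← hc t ht]; linear_combination (q3 t ht))
    obtain ⟨r, hr⟩ := E.exists_eq_const
      (f := fun t => τ t * E.α t - c * A t ^ 2 - (a₁ - a₃) * A t) fun t ht =>
      ((((dτ t ht).mul (E.hasDerivAt_α ht)).sub (((hA t ht).pow 2).const_mul c)).sub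
        ((hA t ht).const_mul (a₁ - a₃))).congr_deriv (by
        simp only [Nat.cast_ofNat, Nat.add_one_sub_one, pow_one]
        linear_combination q6 t ht - E.α t * ha₃ t ht + E.α t * ha₁ t ht)
    -- With `ξ₁ = a₁ + cA` and `η₁ = a₃ - cA`, the half sum is the weight `m` and the difference is
    -- the linear coefficient `p`.
    refine ⟨c, a₁ - a₃, r, (a₁ + a₃) / 2, k₀, k₁, ?_, fun t ht => ?_⟩
    · funext z
      obtain ⟨t, x, y⟩ := z
      by_cases ht : t ∈ E.dom
      · rw [Equation.symmetryField, fieldOn_apply ht, hform t ht]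
        have hα := E.α_ne t ht
        have e1 := ha₁ t ht
        have e2 := ha₃ t ht
        have e3 := hr t ht
        have e4 := hk₁ t ht
        refine Prod.ext ?_ (Prod.ext ?_ ?_)
        · change τ t = _
          rw [eq_div_iff hα]
          linear_combination e3
        · change ξ₁ t * x + ξ₀ t = _
          linear_combination x * e1 + e4
        · change η₁ t * y + η₂ t * x + η₀ t = _
          linear_combination y * e2 + x * hc t ht + hk₀ t ht
      · rw [Equation.symmetryField, fieldOn_apply_of_notMem ht, hzero _ ht]
    · have e1 := ha₁ t ht
      have e2 := ha₃ t ht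
      have e3 := hr t ht
      have e6 := q6 t ht
      constructor
      · linear_combination (-(deriv E.β t * E.α t - deriv E.α t * E.β t)) * e3
          + E.α t ^ 2 * q7 t ht - E.α t * E.β t * e6 + E.α t ^ 2 * E.β t * (2 * e1 + e2)
      · linear_combination (-(deriv E.σ t * E.α t - deriv E.α t * E.σ t)) * e3
          + E.α t ^ 2 * q8 t ht - E.α t * E.σ t * e6 + E.α t ^ 2 * E.σ t * (4 * e1 + e2)
  · rintro ⟨c, p, r, m, k₀, k₁, rfl, hcl⟩
    refine ⟨fun z hz => fieldOn_apply_of_notMem hz _, E.symmetryField_smooth hA c p r m k₀ k₁, ?_⟩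
    intro u hu t ht x hlhs
    have hα := E.α_ne t ht
    have hform : ∀ s ∈ E.dom, ∀ x y, E.symmetryField A c p r m k₀ k₁ (s, x, y)
        = ((c * A s ^ 2 + p * A s + r) / E.α s,
          (m + p / 2 + c * A s) * x + (k₀ * A s + k₁),
          (m - p / 2 - c * A s) * y + c * x + k₀) := fun s hs x y => fieldOn_apply hs _ x y
    have d1 := (hA t ht).const_mul c
    have dq : HasDerivAt (fun s => c * A s ^ 2 + p * A s + r)
        ((2 * c * A t + p) * E.α t) t :=
      (((((hA t ht).pow 2).const_mul c).add ((hA t ht).const_mul p)).add_const r).congr_deriv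
        (by push_cast; ring)
    have h := prolong_affine E (E.symmetryField_smooth hA c p r m k₀ k₁)
      (τ := fun s => (c * A s ^ 2 + p * A s + r) / E.α s)
      (ξ₁ := fun s => m + p / 2 + c * A s) (ξ₀ := fun s => k₀ * A s + k₁)
      (η₁ := fun s => m - p / 2 - c * A s) (η₂ := fun _ => c) (η₀ := fun _ => k₀) hform ht
      (dq.div (E.hasDerivAt_α ht) hα) (d1.const_add (m + p / 2))
      (((hA t ht).const_mul k₀).add_const k₁) (d1.const_sub (m - p / 2))
      (hasDerivAt_const t c) (hasDerivAt_const t k₀) hu x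
    rw [hlhs, mul_zero, sub_zero] at h
    rw [h]
    obtain ⟨hβ, hσ⟩ := hcl t ht
    have w1 : (c * A t ^ 2 + p * A t + r) / E.α t * deriv E.α t + E.α t
        * (((2 * c * A t + p) * E.α t * E.α t - (c * A t ^ 2 + p * A t + r) * deriv E.α t)
          / E.α t ^ 2 + (m - p / 2 - c * A t) - (m + p / 2 + c * A t)) = 0 := by
      field_simp; ring
    have w2 : (c * A t ^ 2 + p * A t + r) / E.α t * deriv E.β t + E.β t
        * (((2 * c * A t + p) * E.α t * E.α t - (c * A t ^ 2 + p * A t + r) * deriv E.α t)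
          / E.α t ^ 2 - 3 * (m + p / 2 + c * A t)) = 0 := by
      field_simp; linear_combination 2 * hβ
    have w3 : (c * A t ^ 2 + p * A t + r) / E.α t * deriv E.σ t + E.σ t
        * (((2 * c * A t + p) * E.α t * E.α t - (c * A t ^ 2 + p * A t + r) * deriv E.α t)
          / E.α t ^ 2 - 5 * (m + p / 2 + c * A t)) = 0 := by
      field_simp; linear_combination 2 * hσ
    simp only [w1, w2, w3]
    ring

/-! ## Solutions of the classifying equations -/

theorem exists_antiderivative {I : Set ℝ} (hI : IsOpen I) (hc : I.OrdConnected) {f : ℝ → ℝ}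
    (hf : ContinuousOn f I) : ∃ A : ℝ → ℝ, ∀ t ∈ I, HasDerivAt A (f t) t := by
  rcases I.eq_empty_or_nonempty with rfl | ⟨t₀, h₀⟩
  · exact ⟨0, fun t ht => ht.elim⟩
  refine ⟨fun t => ∫ s in t₀..t, f s, fun t ht => ?_⟩
  refine intervalIntegral.integral_hasDerivAt_right ?_ ?_ (hf.continuousAt (hI.mem_nhds ht))
  · exact (hf.mono (hc.uIcc_subset h₀ ht)).intervalIntegrable
  · exact hf.stronglyMeasurableAtFilter hI t ht

theorem Equation.exists_antiderivative (E : Equation) :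
    ∃ A : ℝ → ℝ, ∀ t ∈ E.dom, HasDerivAt A (E.α t) t :=
  Kawahara.exists_antiderivative E.dom_open E.dom_interval E.α_smooth.continuousOn

theorem Equation.classifying_zero (E : Equation) (A : ℝ → ℝ) : E.Classifying A 0 0 0 0 := by
  intro t _
  constructor <;> ring

/-- At a root the factors `3m + q'/2` and `5m + 3q'/2` both vanish, so `m = q' = 0` and `q = c (s -
A t₀)²`. If `c ≠ 0`, cancelling `c (A - A t₀)` off `t₀` and passing to the limit gives `0 = α² β` at
`t₀`. -/
theorem Equation.Classifying.eq_zero_of_root {E : Equation} {A : ℝ → ℝ}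
    (hA : ∀ t ∈ E.dom, HasDerivAt A (E.α t) t) {c p r m : ℝ} (h : E.Classifying A c p r m)
    {t₀ : ℝ} (h₀ : t₀ ∈ E.dom) (hroot : c * A t₀ ^ 2 + p * A t₀ + r = 0) :
    c = 0 ∧ p = 0 ∧ r = 0 ∧ m = 0 := by
  have hα := E.α_ne t₀ h₀
  have hβ := E.β_ne t₀ h₀
  have hσ := E.σ_ne t₀ h₀
  obtain ⟨e1, e2⟩ := h t₀ h₀
  rw [hroot, zero_mul] at e1 e2
  have f1 : 3 * m + (p / 2 + c * A t₀) = 0 := by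
    have : (3 * m + (p / 2 + c * A t₀)) * (E.α t₀ ^ 2 * E.β t₀) = 0 := by linear_combination -e1
    exact (mul_eq_zero.1 this).resolve_right (mul_ne_zero (pow_ne_zero 2 hα) hβ)
  have f2 : 5 * m + 3 * (p / 2 + c * A t₀) = 0 := by
    have : (5 * m + 3 * (p / 2 + c * A t₀)) * (E.α t₀ ^ 2 * E.σ t₀) = 0 := by
      linear_combination -e2
    exact (mul_eq_zero.1 this).resolve_right (mul_ne_zero (pow_ne_zero 2 hα) hσ)
  have hm : m = 0 := by linarith
  have hp : p = -2 * c * A t₀ := by linarith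
  have hr : r = c * A t₀ ^ 2 := by rw [hp] at hroot; linarith
  have hc : c = 0 := by
    by_contra hc
    have hnhds := E.dom_open.mem_nhds h₀
    have cα := (E.hasDerivAt_α h₀).continuousAt
    have cβ := (E.hasDerivAt_β h₀).continuousAt
    have cα' : ContinuousAt (deriv E.α) t₀ :=
      (E.α_smooth.continuousOn_deriv_of_isOpen E.dom_open (by simp)).continuousAt hnhds
    have cβ' : ContinuousAt (deriv E.β) t₀ :=
      (E.β_smooth.continuousOn_deriv_of_isOpen E.dom_open (by simp)).continuousAt hnhds
    have cA := (hA t₀ h₀).continuousAt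
    have l1 : ContinuousAt (fun t => (A t - A t₀) * (deriv E.β t * E.α t - deriv E.α t * E.β t)) t₀ :=
      (cA.sub continuousAt_const).mul ((cβ'.mul cα).sub (cα'.mul cβ))
    have l2 : ContinuousAt (fun t => E.α t ^ 2 * E.β t) t₀ := (cα.pow 2).mul cβ
    have hev : (fun t => (A t - A t₀) * (deriv E.β t * E.α t - deriv E.α t * E.β t))
        =ᶠ[nhdsWithin t₀ {t₀}ᶜ] fun t => E.α t ^ 2 * E.β t := by
      -- Since `A' = α ≠ 0`, the factor `A - A t₀` is nonzero on a punctured neighbourhood.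
      filter_upwards [(hA t₀ h₀).eventually_ne (c := A t₀) hα,
        mem_nhdsWithin_of_mem_nhds hnhds] with t hne ht
      have e := (h t ht).1
      rw [hm, hp, hr] at e
      refine mul_left_cancel₀ (mul_ne_zero hc (sub_ne_zero.2 hne)) ?_
      linear_combination e
    have := tendsto_nhds_unique ((l1.tendsto.mono_left nhdsWithin_le_nhds).congr' hev)
      (l2.tendsto.mono_left nhdsWithin_le_nhds)
    rw [sub_self, zero_mul] at this
    exact mul_ne_zero (pow_ne_zero 2 hα) hβ this.symm
  refine ⟨hc, ?_, ?_, hm⟩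
  · rw [hp, hc]; ring
  · rw [hr, hc]; ring

theorem Equation.Classifying.lin {E : Equation} {A : ℝ → ℝ} {c p r m c' p' r' m' : ℝ}
    (h : E.Classifying A c p r m) (h' : E.Classifying A c' p' r' m') (a : ℝ) :
    E.Classifying A (c' - a * c) (p' - a * p) (r' - a * r) (m' - a * m) := by
  intro t ht
  obtain ⟨e1, e2⟩ := h t ht
  obtain ⟨e3, e4⟩ := h' t ht
  constructor
  · linear_combination e3 - a * e1
  · linear_combination e4 - a * e2

/-- Subtracting the multiple that cancels the value of the second quadratic at `A t₀` produces a
solution with a root, hence zero. -/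
theorem Equation.Classifying.proportional {E : Equation} {A : ℝ → ℝ}
    (hA : ∀ t ∈ E.dom, HasDerivAt A (E.α t) t) {c p r m c' p' r' m' : ℝ}
    (h : E.Classifying A c p r m) (h' : E.Classifying A c' p' r' m')
    {t₀ : ℝ} (h₀ : t₀ ∈ E.dom) (hne : c * A t₀ ^ 2 + p * A t₀ + r ≠ 0) :
    ∃ a : ℝ, c' = a * c ∧ p' = a * p ∧ r' = a * r ∧ m' = a * m := by
  obtain ⟨h1, h2, h3, h4⟩ := (h.lin h'
    ((c' * A t₀ ^ 2 + p' * A t₀ + r') / (c * A t₀ ^ 2 + p * A t₀ + r))).eq_zero_of_root hA h₀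
    (by linear_combination -(div_mul_cancel₀ (c' * A t₀ ^ 2 + p' * A t₀ + r') hne))
  exact ⟨_, sub_eq_zero.1 h1, sub_eq_zero.1 h2, sub_eq_zero.1 h3, sub_eq_zero.1 h4⟩

/-! ## Bases of the kernel algebra and of its extensions -/

theorem Equation.translation_eq (E : Equation) (A : ℝ → ℝ) :
    translation E.dom = E.symmetryField A 0 0 0 0 0 1 := by
  simp [translation, Equation.symmetryField]

theorem Equation.boost_eq (E : Equation) (A : ℝ → ℝ) :
    boost E.dom A = E.symmetryField A 0 0 0 0 1 0 := by
  simp [boost, Equation.symmetryField]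

theorem Equation.symmetryField_eq (E : Equation) (A : ℝ → ℝ) (a c p r m k₀ k₁ : ℝ) :
    E.symmetryField A (a * c) (a * p) (a * r) (a * m) k₀ k₁
      = k₁ • translation E.dom + (k₀ • boost E.dom A + a • E.symmetryField A c p r m 0 0) := by
  funext z
  obtain ⟨t, x, y⟩ := z
  simp only [Pi.add_apply, Pi.smul_apply, Equation.symmetryField, translation, boost]
  by_cases ht : t ∈ E.dom
  · simp only [fieldOn_apply ht]
    refine Prod.ext ?_ (Prod.ext ?_ ?_)
    · simp only [Prod.fst_add, Prod.smul_fst, smul_eq_mul]; ring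
    · simp only [Prod.fst_add, Prod.snd_add, Prod.smul_fst, Prod.smul_snd, smul_eq_mul]; ring
    · simp only [Prod.snd_add, Prod.smul_snd, smul_eq_mul]; ring
  · simp only [fieldOn_apply_of_notMem (z := (t, x, y)) ht]
    simp

theorem Equation.translation_mem (E : Equation) : translation E.dom ∈ E.maxAlgebra := by
  obtain ⟨A, hA⟩ := E.exists_antiderivative
  exact (E.mem_maxAlgebra_iff hA _).2 ⟨0, 0, 0, 0, 0, 1, E.translation_eq A, E.classifying_zero A⟩

theorem Equation.boost_mem (E : Equation) {A : ℝ → ℝ}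
    (hA : ∀ t ∈ E.dom, HasDerivAt A (E.α t) t) : boost E.dom A ∈ E.maxAlgebra :=
  (E.mem_maxAlgebra_iff hA _).2 ⟨0, 0, 0, 0, 1, 0, E.boost_eq A, E.classifying_zero A⟩

theorem Equation.linearIndependent_fields (E : Equation) {A : ℝ → ℝ} {c p r m t₀ : ℝ}
    (h₀ : t₀ ∈ E.dom) (hne : c * A t₀ ^ 2 + p * A t₀ + r ≠ 0) :
    LinearIndependent ℝ ![translation E.dom, boost E.dom A, E.symmetryField A c p r m 0 0] := by
  rw [Fintype.linearIndependent_iff]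
  intro g hg
  rw [Fin.sum_univ_three] at hg
  change g 0 • translation E.dom + g 1 • boost E.dom A
    + g 2 • E.symmetryField A c p r m 0 0 = 0 at hg
  have h := congrFun hg (t₀, 0, 0)
  simp only [Pi.add_apply, Pi.smul_apply, Equation.symmetryField, translation, boost,
    fieldOn_apply h₀, Pi.zero_apply] at h
  have h1 := congrArg Prod.fst h
  have h2 := congrArg (fun z => z.2.1) h
  have h3 := congrArg (fun z => z.2.2) h
  simp at h1 h2 h3
  have h4 : g 2 = 0 := by
    rcases h1 with h1 | h1 | h1
    · exact h1
    · exact absurd h1 hne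
    · exact absurd h1 (E.α_ne t₀ h₀)
  have h3 : g 1 = 0 := by simpa [h4] using h3
  have h5 : g 0 = 0 := by simpa [h3, h4] using h2
  intro i
  fin_cases i
  · exact h5
  · exact h3
  · exact h4

theorem Equation.finrank_span_fields (E : Equation) {A : ℝ → ℝ} {c p r m t₀ : ℝ}
    (h₀ : t₀ ∈ E.dom) (hne : c * A t₀ ^ 2 + p * A t₀ + r ≠ 0) :
    Module.finrank ℝ (Submodule.span ℝ
      {translation E.dom, boost E.dom A, E.symmetryField A c p r m 0 0}) = 3 := by
  have h := finrank_span_eq_card (E.linearIndependent_fields (m := m) h₀ hne)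
  have e : Set.range ![translation E.dom, boost E.dom A, E.symmetryField A c p r m 0 0]
      = {translation E.dom, boost E.dom A, E.symmetryField A c p r m 0 0} := by
    simp only [Matrix.range_cons, Matrix.range_empty, union_empty, singleton_union]
  rwa [e, Fintype.card_fin] at h

theorem Equation.finrank_span_kernel (E : Equation) (A : ℝ → ℝ) :
    Module.finrank ℝ (Submodule.span ℝ {translation E.dom, boost E.dom A}) = 2 := by
  obtain ⟨t₀, h₀⟩ := E.dom_nonempty
  have hl : LinearIndependent ℝ ![translation E.dom, boost E.dom A] := by
    rw [LinearIndependent.pair_iff]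
    intro a b hab
    have h := congrFun hab (t₀, 0, 0)
    simp only [Pi.add_apply, Pi.smul_apply, translation, boost,
      fieldOn_apply h₀, Pi.zero_apply] at h
    have h2 := congrArg (fun z => z.2.1) h
    have h3 := congrArg (fun z => z.2.2) h
    simp at h2 h3
    simp only [h3, zero_mul, add_zero] at h2
    exact ⟨h2, h3⟩
  have h := finrank_span_eq_card hl
  have e : Set.range ![translation E.dom, boost E.dom A]
      = {translation E.dom, boost E.dom A} := by
    simp only [Matrix.range_cons, Matrix.range_empty, union_empty, singleton_union]
  rwa [e, Fintype.card_fin] at h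

/-- The coefficients `β = α ((t - t₀)² + 1)` and `σ = α` admit only the kernel algebra. -/
theorem classifying_test {I : Set ℝ} {A α : ℝ → ℝ} (hI : IsOpen I)
    (hα : ContDiffOn ℝ ∞ α I) (hα0 : ∀ t ∈ I, α t ≠ 0) (hA : ∀ t ∈ I, HasDerivAt A (α t) t)
    {t₀ : ℝ} (h₀ : t₀ ∈ I) {c p r m : ℝ}
    (h : ∀ t ∈ I, (c * A t ^ 2 + p * A t + r)
        * (deriv (fun t => α t * ((t - t₀) ^ 2 + 1)) t * α t
          - deriv α t * (α t * ((t - t₀) ^ 2 + 1)))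
        = (3 * m + (p / 2 + c * A t)) * α t ^ 2 * (α t * ((t - t₀) ^ 2 + 1)) ∧
      (c * A t ^ 2 + p * A t + r) * (deriv α t * α t - deriv α t * α t)
      = (5 * m + 3 * (p / 2 + c * A t)) * α t ^ 2 * α t) :
    c = 0 ∧ p = 0 ∧ r = 0 ∧ m = 0 := by
  -- The quotient `σ/α` is constant here, so the left-hand side of the second equation is zero.
  -- Nonconstancy of `A` will then force `c = 0`.
  have h2 : ∀ t ∈ I, 5 * m + 3 * (p / 2 + c * A t) = 0 := by
    intro t ht
    have e := (h t ht).2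
    rw [sub_self, mul_zero, mul_assoc] at e
    exact (mul_eq_zero.1 e.symm).resolve_right
      (mul_ne_zero (pow_ne_zero 2 (hα0 t ht)) (hα0 t ht))
  have hd (t : ℝ) (ht : t ∈ I) : deriv (fun t => α t * ((t - t₀) ^ 2 + 1)) t
      = deriv α t * ((t - t₀) ^ 2 + 1) + α t * (2 * (t - t₀)) := by
    have d1 : HasDerivAt α (deriv α t) t :=
      ((hα.contDiffAt (hI.mem_nhds ht)).differentiableAt (by simp)).hasDerivAt
    have d2 : HasDerivAt (fun t => (t - t₀) ^ 2 + 1) (2 * (t - t₀)) t :=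
      ((((hasDerivAt_id t).sub_const t₀).pow 2).add_const 1).congr_deriv (by simp)
    exact (d1.mul d2).deriv
  obtain ⟨t₁, h₁, hne, hAne⟩ : ∃ t₁ ∈ I, t₁ ≠ t₀ ∧ A t₁ ≠ A t₀ := by
    have hev := ((hA t₀ h₀).eventually_ne (c := A t₀) (hα0 t₀ h₀)).and
      ((mem_nhdsWithin_of_mem_nhds (hI.mem_nhds h₀) : I ∈ nhdsWithin t₀ {t₀}ᶜ))
    obtain ⟨t₁, ⟨ha, hb⟩, hc⟩ := (hev.and self_mem_nhdsWithin).exists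
    exact ⟨t₁, hb, hc, ha⟩
  have hc : c = 0 := by
    have : c * (A t₁ - A t₀) = 0 := by linear_combination (h2 t₁ h₁ - h2 t₀ h₀) / 3
    exact (mul_eq_zero.1 this).resolve_right (sub_ne_zero.2 hAne)
  subst hc
  have e0 := (h t₀ h₀).1
  have e1 := (h t₁ h₁).1
  rw [hd _ h₀] at e0
  rw [hd _ h₁] at e1
  -- The derivative of `β/α` vanishes at `t₀` but not at `t₁`: the first point kills `m` and `p`,
  -- the second kills `r`.
  have f0 : 3 * m + p / 2 = 0 := by
    have : (3 * m + p / 2) * (α t₀ ^ 3) = 0 := by linear_combination -e0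
    exact (mul_eq_zero.1 this).resolve_right (pow_ne_zero 3 (hα0 t₀ h₀))
  have hm : m = 0 := by linarith [h2 t₀ h₀]
  have hp : p = 0 := by linarith
  subst hm hp
  have hr : r * (2 * (t₁ - t₀) * α t₁ ^ 2) = 0 := by linear_combination e1
  exact ⟨rfl, rfl, (mul_eq_zero.1 hr).resolve_right (mul_ne_zero
    (mul_ne_zero two_ne_zero (sub_ne_zero.2 hne)) (pow_ne_zero 2 (hα0 t₁ h₁))), rfl⟩

/-- The two fields are invariant for all `β`, `σ`; one test equation without further symmetries
bounds the intersection from above. -/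
theorem kernelAlgebra_eq {I : Set ℝ} {α A : ℝ → ℝ} (hI : IsOpen I) (hne : I.Nonempty)
    (hc : I.OrdConnected) (hα : ContDiffOn ℝ ∞ α I) (hα0 : ∀ t ∈ I, α t ≠ 0)
    (hA : ∀ t ∈ I, HasDerivAt A (α t) t) :
    kernelAlgebra I α = Submodule.span ℝ {translation I, boost I A} ∧
      Module.finrank ℝ (kernelAlgebra I α) = 2 := by
  obtain ⟨t₀, h₀⟩ := hne
  let E₀ : Equation :=
    { dom := I, α := α, β := fun t => α t * ((t - t₀) ^ 2 + 1), σ := α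
      dom_open := hI, dom_nonempty := ⟨t₀, h₀⟩, dom_interval := hc
      α_smooth := hα
      β_smooth := hα.mul (by fun_prop : ContDiff ℝ ∞ fun t : ℝ => (t - t₀) ^ 2 + 1).contDiffOn
      σ_smooth := hα
      α_ne := hα0
      β_ne := fun t ht => mul_ne_zero (hα0 t ht) (by positivity)
      σ_ne := hα0 }
  have key : kernelAlgebra I α = Submodule.span ℝ {translation I, boost I A} := by
    apply le_antisymm
    · intro Q hQ
      have hQ₀ : Q ∈ E₀.maxAlgebra := by
        simp only [kernelAlgebra, Submodule.mem_iInf] at hQ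
        exact hQ E₀ ⟨rfl, fun _ _ => rfl⟩
      obtain ⟨c, p, r, m, k₀, k₁, hQe, hcl⟩ := (E₀.mem_maxAlgebra_iff hA Q).1 hQ₀
      obtain ⟨rfl, rfl, rfl, rfl⟩ := classifying_test hI hα hα0 hA h₀ hcl
      have e := E₀.symmetryField_eq A 0 0 0 0 0 k₀ k₁
      simp only [mul_zero, zero_smul, add_zero] at e
      rw [hQe, e]
      exact Submodule.add_mem _
        (Submodule.smul_mem _ _ (Submodule.subset_span (mem_insert _ _)))
        (Submodule.smul_mem _ _ (Submodule.subset_span (mem_insert_of_mem _ rfl)))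
    · rw [Submodule.span_le]
      simp only [kernelAlgebra]
      intro Q hQ
      simp only [SetLike.mem_coe, Submodule.mem_iInf]
      rintro E ⟨rfl, hEα⟩
      rcases hQ with rfl | rfl
      · exact E.translation_mem
      · exact E.boost_mem fun t ht => by rw [hEα ht]; exact hA t ht
  exact ⟨key, by rw [key]; exact E₀.finrank_span_kernel A⟩

theorem Equation.kernelAlgebra_le (E : Equation) : kernelAlgebra E.dom E.α ≤ E.maxAlgebra :=
  iInf₂_le E ⟨rfl, fun _ _ => rfl⟩

theorem Equation.exists_classifying (E : Equation) {A : ℝ → ℝ}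
    (hA : ∀ t ∈ E.dom, HasDerivAt A (E.α t) t) (h : E.HasExtension) :
    ∃ c p r m : ℝ, E.Classifying A c p r m ∧ ∀ t ∈ E.dom, c * A t ^ 2 + p * A t + r ≠ 0 := by
  obtain ⟨Q, hQ, hQk⟩ := SetLike.exists_of_lt h
  obtain ⟨c, p, r, m, k₀, k₁, hQe, hcl⟩ := (E.mem_maxAlgebra_iff hA Q).1 hQ
  refine ⟨c, p, r, m, hcl, fun t ht hroot => hQk ?_⟩
  obtain ⟨rfl, rfl, rfl, rfl⟩ := hcl.eq_zero_of_root hA ht hroot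
  rw [(kernelAlgebra_eq E.dom_open E.dom_nonempty E.dom_interval E.α_smooth E.α_ne hA).1, hQe]
  have e := E.symmetryField_eq A 0 0 0 0 0 k₀ k₁
  simp only [mul_zero, zero_smul, add_zero] at e
  rw [e]
  exact Submodule.add_mem _
    (Submodule.smul_mem _ _ (Submodule.subset_span (mem_insert _ _)))
    (Submodule.smul_mem _ _ (Submodule.subset_span (mem_insert_of_mem _ rfl)))

/-- By `proportional`, one nontrivial solution of the classifying equations determines all others up
to a factor, so it contributes a single field beyond the kernel. -/
theorem Equation.Classifying.maxAlgebra_eq {E : Equation} {A : ℝ → ℝ}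
    (hA : ∀ t ∈ E.dom, HasDerivAt A (E.α t) t) {c p r m : ℝ} (h : E.Classifying A c p r m)
    {t₀ : ℝ} (h₀ : t₀ ∈ E.dom) (hne : c * A t₀ ^ 2 + p * A t₀ + r ≠ 0) :
    E.HasExtension ∧
    E.maxAlgebra = Submodule.span ℝ
      {translation E.dom, boost E.dom A, E.symmetryField A c p r m 0 0} ∧
    Module.finrank ℝ E.maxAlgebra = 3 := by
  have key : E.maxAlgebra = Submodule.span ℝ
      {translation E.dom, boost E.dom A, E.symmetryField A c p r m 0 0} := by
    apply le_antisymm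
    · intro Q hQ
      obtain ⟨c', p', r', m', k₀, k₁, hQe, hcl⟩ := (E.mem_maxAlgebra_iff hA Q).1 hQ
      obtain ⟨a, rfl, rfl, rfl, rfl⟩ := h.proportional hA hcl h₀ hne
      rw [hQe, E.symmetryField_eq A a c p r m k₀ k₁]
      refine Submodule.add_mem _ (Submodule.smul_mem _ _ (Submodule.subset_span (by simp)))
        (Submodule.add_mem _ (Submodule.smul_mem _ _ (Submodule.subset_span (by simp)))
          (Submodule.smul_mem _ _ (Submodule.subset_span (by simp))))
    · rw [Submodule.span_le]
      rintro Q (rfl | rfl | rfl)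
      · exact E.translation_mem
      · exact E.boost_mem hA
      · exact (E.mem_maxAlgebra_iff hA _).2 ⟨c, p, r, m, 0, 0, rfl, h⟩
  have hrank : Module.finrank ℝ E.maxAlgebra = 3 := by
    rw [key]; exact E.finrank_span_fields h₀ hne
  refine ⟨lt_of_le_of_ne E.kernelAlgebra_le fun he => ?_, key, hrank⟩
  have := (kernelAlgebra_eq E.dom_open E.dom_nonempty E.dom_interval E.α_smooth E.α_ne hA).2
  rw [he, hrank] at this
  norm_num at this

theorem Equation.finrank_maxAlgebra (E : Equation) (h : E.HasExtension) :
    Module.finrank ℝ E.maxAlgebra = 3 := by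
  obtain ⟨A, hA⟩ := E.exists_antiderivative
  obtain ⟨c, p, r, m, hcl, hne⟩ := E.exists_classifying hA h
  obtain ⟨t₀, h₀⟩ := E.dom_nonempty
  exact (hcl.maxAlgebra_eq hA h₀ (hne t₀ h₀)).2.2

/-! ## The equations from the classification list -/

namespace TableCase

/-- The leading coefficient of the `t`-component of the third basis element. -/
def lead : TableCase → ℝ
  | arctangent _ => 1
  | _ => 0

/-- The linear coefficient of the `t`-component of the third basis element. -/
def mid : TableCase → ℝ
  | power _ => 3
  | _ => 0

/-- The constant coefficient of the `t`-component of the third basis element. -/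
def free : TableCase → ℝ
  | power _ => 0
  | exponential => 3
  | _ => 1

/-- The scaling parameter of the third basis element. -/
noncomputable def weight : TableCase → ℝ
  | power ρ => ρ - 1 / 2
  | exponential => 1
  | constant => 0
  | arctangent ν => ν

theorem tau_ne_zero (k : TableCase) {t : ℝ} (ht : t ∈ k.domain) :
    k.lead * t ^ 2 + k.mid * t + k.free ≠ 0 := by
  cases k
  · have : (0 : ℝ) < t := ht
    simp [lead, mid, free, this.ne']
  · simp [lead, mid, free]
  · simp [lead, mid, free]
  · have : (1 : ℝ) * t ^ 2 + 0 * t + 1 = t ^ 2 + 1 := by ring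
    simp only [lead, mid, free, this]; positivity

theorem betaShape_pos (k : TableCase) {t : ℝ} (ht : t ∈ k.domain) : 0 < k.betaShape t := by
  cases k
  · have : (0 : ℝ) < t := ht
    simp only [betaShape]; positivity
  all_goals simp only [betaShape]; positivity

theorem sigmaShape_pos (k : TableCase) {t : ℝ} (ht : t ∈ k.domain) : 0 < k.sigmaShape t := by
  cases k
  · have : (0 : ℝ) < t := ht
    simp only [sigmaShape]; positivity
  all_goals simp only [sigmaShape]; positivity

/-! ### Smoothness and logarithmic derivatives of the listed coefficients -/

theorem contDiff_arctan_factor (a b : ℝ) :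
    ContDiff ℝ ∞ fun t : ℝ => (t ^ 2 + 1) ^ a * Real.exp (b * Real.arctan t) := by
  have h1 : ContDiff ℝ ∞ fun t : ℝ => t ^ 2 + 1 := by fun_prop
  have h2 : ContDiff ℝ ∞ fun t : ℝ => b * Real.arctan t :=
    contDiff_const.mul Real.contDiff_arctan
  exact (h1.rpow_const_of_ne fun t => by positivity).mul h2.exp

theorem betaShape_smooth (k : TableCase) : ContDiffOn ℝ ∞ k.betaShape k.domain := by
  cases k with
  | power ρ => exact fun t ht =>
      (Real.contDiffAt_rpow_const_of_ne (ne_of_gt ht)).contDiffWithinAt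
  | exponential => exact Real.contDiff_exp.contDiffOn
  | constant => exact contDiffOn_const
  | arctangent ν => exact (contDiff_arctan_factor _ _).contDiffOn

theorem sigmaShape_smooth (k : TableCase) : ContDiffOn ℝ ∞ k.sigmaShape k.domain := by
  cases k with
  | power ρ => exact fun t ht =>
      (Real.contDiffAt_rpow_const_of_ne (ne_of_gt ht)).contDiffWithinAt
  | exponential =>
    exact (by fun_prop : ContDiff ℝ ∞ fun t : ℝ => Real.exp (5 / 3 * t)).contDiffOn
  | constant => exact contDiffOn_const
  | arctangent ν => exact (contDiff_arctan_factor _ _).contDiffOn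

theorem hasDerivAt_rpow_shape (a : ℝ) {t : ℝ} (ht : 0 < t) :
    ∃ b', HasDerivAt (fun t : ℝ => t ^ a) b' t ∧ t * b' = a * t ^ a := by
  refine ⟨a * t ^ (a - 1), Real.hasDerivAt_rpow_const (Or.inl ht.ne'), ?_⟩
  rw [Real.rpow_sub_one ht.ne']
  field_simp

theorem hasDerivAt_arctan_factor (a b t : ℝ) :
    ∃ b', HasDerivAt (fun t : ℝ => (t ^ 2 + 1) ^ a * Real.exp (b * Real.arctan t)) b' t ∧
      (t ^ 2 + 1) * b' = (2 * a * t + b) * ((t ^ 2 + 1) ^ a * Real.exp (b * Real.arctan t)) := by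
  have hpos : 0 < t ^ 2 + 1 := by positivity
  have h1 : HasDerivAt (fun t : ℝ => t ^ 2 + 1) (2 * t) t :=
    (((hasDerivAt_id t).pow 2).add_const 1).congr_deriv (by simp)
  have h2 := h1.rpow_const (p := a) (Or.inl hpos.ne')
  have h3 := ((Real.hasDerivAt_arctan t).const_mul b).exp
  refine ⟨_, h2.mul h3, ?_⟩
  rw [Real.rpow_sub_one hpos.ne']
  have : 1 + t ^ 2 = t ^ 2 + 1 := by ring
  rw [this]
  field_simp

/-- This is the first classifying equation for `α = 1`, `A = t`, with the quadratic polynomial and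
the weight of the case. -/
theorem hasDerivAt_betaShape (k : TableCase) {t : ℝ} (ht : t ∈ k.domain) :
    ∃ b', HasDerivAt k.betaShape b' t ∧ (k.lead * t ^ 2 + k.mid * t + k.free) * b'
      = (3 * k.weight + (k.mid / 2 + k.lead * t)) * k.betaShape t := by
  cases k with
  | power ρ =>
    obtain ⟨b', h1, h2⟩ := hasDerivAt_rpow_shape ρ (show 0 < t from ht)
    refine ⟨b', h1, ?_⟩
    simp only [lead, mid, free, weight, betaShape]
    linear_combination 3 * h2
  | exponential =>
    refine ⟨_, Real.hasDerivAt_exp t, ?_⟩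
    simp only [lead, mid, free, weight, betaShape]
    ring
  | constant =>
    refine ⟨0, hasDerivAt_const t 1, ?_⟩
    simp only [lead, mid, free, weight, betaShape]
    ring
  | arctangent ν =>
    obtain ⟨b', h1, h2⟩ := hasDerivAt_arctan_factor (1 / 2) (3 * ν) t
    refine ⟨b', h1, ?_⟩
    simp only [lead, mid, free, weight, betaShape]
    linear_combination h2

theorem hasDerivAt_sigmaShape (k : TableCase) {t : ℝ} (ht : t ∈ k.domain) :
    ∃ b', HasDerivAt k.sigmaShape b' t ∧ (k.lead * t ^ 2 + k.mid * t + k.free) * b'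
      = (5 * k.weight + 3 * (k.mid / 2 + k.lead * t)) * k.sigmaShape t := by
  cases k with
  | power ρ =>
    obtain ⟨b', h1, h2⟩ := hasDerivAt_rpow_shape ((5 * ρ + 2) / 3) (show 0 < t from ht)
    refine ⟨b', h1, ?_⟩
    simp only [lead, mid, free, weight, sigmaShape]
    linear_combination 3 * h2
  | exponential =>
    refine ⟨_, ((hasDerivAt_id t).const_mul (5 / 3)).exp, ?_⟩
    simp only [lead, mid, free, weight, sigmaShape, id]
    ring
  | constant =>
    refine ⟨0, hasDerivAt_const t 1, ?_⟩
    simp only [lead, mid, free, weight, sigmaShape]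
    ring
  | arctangent ν =>
    obtain ⟨b', h1, h2⟩ := hasDerivAt_arctan_factor (3 / 2) (5 * ν) t
    refine ⟨b', h1, ?_⟩
    simp only [lead, mid, free, weight, sigmaShape]
    linear_combination h2

end TableCase

theorem Equation.HasForm.derivs {E : Equation} {k : TableCase} {l δ : ℝ} (h : E.HasForm k l δ)
    {t : ℝ} (ht : t ∈ E.dom) :
    deriv E.α t = 0 ∧
    (k.lead * t ^ 2 + k.mid * t + k.free) * deriv E.β t
      = (3 * k.weight + (k.mid / 2 + k.lead * t)) * E.β t ∧
    (k.lead * t ^ 2 + k.mid * t + k.free) * deriv E.σ t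
      = (5 * k.weight + 3 * (k.mid / 2 + k.lead * t)) * E.σ t := by
  obtain ⟨hα, hdom, hf⟩ := h
  have hn := E.dom_open.mem_nhds ht
  refine ⟨?_, ?_, ?_⟩
  · have : E.α =ᶠ[nhds t] fun _ => 1 := Filter.mem_of_superset hn fun s hs => hα s hs
    rw [this.deriv_eq, deriv_const]
  · obtain ⟨b', h1, h2⟩ := k.hasDerivAt_betaShape (hdom ht)
    have : E.β =ᶠ[nhds t] fun s => l * k.betaShape s :=
      Filter.mem_of_superset hn fun s hs => (hf s hs).1
    rw [this.deriv_eq, (h1.const_mul l).deriv, (hf t ht).1]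
    linear_combination l * h2
  · obtain ⟨b', h1, h2⟩ := k.hasDerivAt_sigmaShape (hdom ht)
    have : E.σ =ᶠ[nhds t] fun s => δ * k.sigmaShape s :=
      Filter.mem_of_superset hn fun s hs => (hf s hs).2
    rw [this.deriv_eq, (h1.const_mul δ).deriv, (hf t ht).2]
    linear_combination δ * h2

theorem Equation.HasForm.classifying {E : Equation} {k : TableCase} {l δ : ℝ}
    (h : E.HasForm k l δ) :
    E.Classifying (fun t => t) k.lead k.mid k.free k.weight := by
  intro t ht
  obtain ⟨h1, h2, h3⟩ := h.derivs ht
  simp only [h1, h.1 t ht]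
  constructor
  · linear_combination h2
  · linear_combination h3

theorem Equation.HasForm.symmetryField_eq {E : Equation} {k : TableCase} {l δ : ℝ}
    (h : E.HasForm k l δ) :
    E.symmetryField (fun t => t) k.lead k.mid k.free k.weight 0 0 = fieldOn E.dom k.generator := by
  funext z
  obtain ⟨t, x, y⟩ := z
  by_cases ht : t ∈ E.dom
  · rw [Equation.symmetryField, fieldOn_apply ht, fieldOn_apply ht, h.1 t ht]
    refine Prod.ext ?_ (Prod.ext ?_ ?_) <;> cases k <;>
      simp only [TableCase.lead, TableCase.mid, TableCase.free, TableCase.weight,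
        TableCase.generator] <;> ring
  · rw [Equation.symmetryField, fieldOn_apply_of_notMem (z := (t, x, y)) ht,
      fieldOn_apply_of_notMem (z := (t, x, y)) ht]

theorem Equation.HasForm.maxAlgebra_eq {E : Equation} {k : TableCase} {l δ : ℝ}
    (h : E.HasForm k l δ) :
    E.HasExtension ∧
    E.maxAlgebra = Submodule.span ℝ {translation E.dom, boost E.dom (fun t => t),
      fieldOn E.dom k.generator} ∧
    Module.finrank ℝ E.maxAlgebra = 3 := by
  obtain ⟨t₀, h₀⟩ := E.dom_nonempty
  have hA : ∀ t ∈ E.dom, HasDerivAt (fun t => t) (E.α t) t := fun t ht => by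
    rw [h.1 t ht]; exact hasDerivAt_id t
  rw [← h.symmetryField_eq]
  exact h.classifying.maxAlgebra_eq hA h₀ (k.tau_ne_zero (h.2.1 h₀))

/-! ## Equations mapped by point transformations -/

theorem contDiff_line {I : Set ℝ} {v : ℝ → ℝ → ℝ}
    (hv : ContDiffOn ℝ ∞ (fun z : ℝ × ℝ => v z.1 z.2) (I ×ˢ univ)) {t : ℝ} (ht : t ∈ I) :
    ContDiff ℝ ∞ (v t) :=
  hv.comp_contDiff (contDiff_const.prodMk contDiff_id : ContDiff ℝ ∞ fun x : ℝ => (t, x))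
    fun _ => ⟨ht, mem_univ _⟩

theorem hasDerivAt_comp_of_smooth {I : Set ℝ} (hI : IsOpen I) {v : ℝ → ℝ → ℝ}
    (hv : ContDiffOn ℝ ∞ (fun z : ℝ × ℝ => v z.1 z.2) (I ×ˢ univ)) {f g : ℝ → ℝ} {f' g' t : ℝ}
    (ht : f t ∈ I) (hf : HasDerivAt f f' t) (hg : HasDerivAt g g' t) :
    HasDerivAt (fun s => v (f s) (g s)) (f' * Dt v (f t) (g t) + g' * Dx v (f t) (g t)) t := by
  have hd : HasFDerivAt (fun z : ℝ × ℝ => v z.1 z.2)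
      (fderiv ℝ (fun z : ℝ × ℝ => v z.1 z.2) (f t, g t)) (f t, g t) :=
    ((hv.contDiffAt ((hI.prod isOpen_univ).mem_nhds ⟨ht, mem_univ _⟩)).differentiableAt
      (by simp)).hasFDerivAt
  have c1 : HasDerivAt (fun s : ℝ => (s, g t)) ((1 : ℝ), (0 : ℝ)) (f t) :=
    (hasDerivAt_id (f t)).prodMk (hasDerivAt_const (f t) (g t))
  have c2 : HasDerivAt (fun s : ℝ => (f t, s)) ((0 : ℝ), (1 : ℝ)) (g t) :=
    (hasDerivAt_const (g t) (f t)).prodMk (hasDerivAt_id (g t))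
  have k1 := HasFDerivAt.comp_hasDerivAt (l := fun z : ℝ × ℝ => v z.1 z.2) (f t) hd c1
  have k2 := HasFDerivAt.comp_hasDerivAt (l := fun z : ℝ × ℝ => v z.1 z.2) (g t) hd c2
  have h1 : Dt v (f t) (g t) = fderiv ℝ (fun z : ℝ × ℝ => v z.1 z.2) (f t, g t) (1, 0) :=
    k1.deriv
  have h2 : Dx v (f t) (g t) = fderiv ℝ (fun z : ℝ × ℝ => v z.1 z.2) (f t, g t) (0, 1) :=
    k2.deriv
  refine (hd.comp_hasDerivAt t (hf.prodMk hg)).congr_deriv ?_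
  have e : (f', g') = f' • ((1 : ℝ), (0 : ℝ)) + g' • ((0 : ℝ), (1 : ℝ)) := by simp
  rw [h1, h2, e, map_add, map_smul, map_smul, smul_eq_mul, smul_eq_mul]

/-- A common core for both groups: `Y` is affine in `A`, and the shear `-γ x` in `u` offsets the
term produced by the time dependence of `x / Y`. The two left-hand sides then differ by the
nonvanishing factor `κ² Y³ / α`. -/
theorem mapsEquation_of_projective {E E' : Equation} {Φ : PointTransformation} {Y : ℝ → ℝ}
    {γ κ : ℝ} (hκ : κ ≠ 0) (hY0 : ∀ t ∈ E.dom, Y t ≠ 0)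
    (hY : ∀ t ∈ E.dom, HasDerivAt Y (γ * E.α t) t)
    (hT : ∀ t ∈ E.dom, HasDerivAt Φ.T (E.α t / (κ * Y t ^ 2)) t)
    (hX : ∀ t ∈ E.dom, ∀ x, Φ.X t x = x / Y t)
    (hU : ∀ t ∈ E.dom, ∀ x u, Φ.U t x u = κ * (Y t * u - γ * x))
    (hdom : E'.dom = Φ.T '' E.dom) (hα : ∀ t ∈ E.dom, E'.α (Φ.T t) = 1)
    (hβ : ∀ t ∈ E.dom, E'.β (Φ.T t) = κ * E.β t / (E.α t * Y t))
    (hσ : ∀ t ∈ E.dom, E'.σ (Φ.T t) = κ * E.σ t / (E.α t * Y t ^ 3)) :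
    Φ.MapsEquation E E' := by
  refine ⟨hdom, fun v w hv hw hvw t ht x => ?_⟩
  have hα0 := E.α_ne t ht
  have hY0t := hY0 t ht
  have hTt : Φ.T t ∈ E'.dom := by rw [hdom]; exact mem_image_of_mem _ ht
  have hvt := contDiff_line hv ht
  have hvY : ContDiff ℝ ∞ (fun x => v t (Y t * x)) := hvt.comp (by fun_prop)
  -- The shapes `+ 0` and `* 1` fit `iteratedDeriv_affine_mul`.
  have hwt : w (Φ.T t)
      = fun x => (κ * Y t) * v t (Y t * x) - (κ * γ * Y t * x + 0) * 1 := by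
    funext x
    have h := hvw t ht (Y t * x)
    rw [hX t ht, hU t ht, mul_div_cancel_left₀ _ hY0t] at h
    rw [h]; ring
  have hk (k : ℕ) : iteratedDeriv (k + 1) (w (Φ.T t)) (x / Y t)
      = κ * Y t ^ (k + 2) * iteratedDeriv (k + 1) (v t) x - if k = 0 then κ * γ * Y t else 0 := by
    rw [hwt, iteratedDeriv_sub_of_smooth (contDiff_const.mul hvY) (by fun_prop),
      iteratedDeriv_const_mul_of_smooth hvY, iteratedDeriv_affine_mul contDiff_const,
      iteratedDeriv_comp_const_mul (hvt.of_le (by exact_mod_cast le_top))]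
    simp only [mul_div_cancel₀ x hY0t, iteratedDeriv_const]
    rcases k with _ | k
    · simp; ring
    · simp; ring
  have hw0 : w (Φ.T t) (x / Y t) = κ * (Y t * v t x - γ * x) := by
    have h := hvw t ht x
    rwa [hX t ht, hU t ht] at h
  -- The time derivative is computed twice, by the chain rule for `w` and from the formula for `U`;
  -- comparison yields `w_t`.
  have d1 : HasDerivAt (fun s => w (Φ.T s) (x / Y s)) _ t :=
    hasDerivAt_comp_of_smooth E'.dom_open hw hTt (hT t ht)
    ((hasDerivAt_const t x).div (hY t ht) hY0t)
  have d2 := (((hY t ht).mul (hasDerivAt_comp_of_smooth E.dom_open hv (f := id)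
    (g := fun _ => x) ht (hasDerivAt_id t) (hasDerivAt_const t x))).sub_const
      (γ * x)).const_mul κ
  have d3 : HasDerivAt (fun s => w (Φ.T s) (x / Y s)) _ t :=
    d2.congr_of_eventuallyEq (by
      filter_upwards [E.dom_open.mem_nhds ht] with s hs
      have h := hvw s hs x
      rwa [hX s hs, hU s hs] at h)
  have h1 := d1.unique d3
  have hx1 : Dx w (Φ.T t) (x / Y t) = κ * Y t ^ 2 * deriv (v t) x - κ * γ * Y t := by
    have := hk 0
    change deriv (w (Φ.T t)) (x / Y t) = _
    simpa [iteratedDeriv_one] using this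
  have hx3 : iteratedDeriv 3 (w (Φ.T t)) (x / Y t) = κ * Y t ^ 4 * iteratedDeriv 3 (v t) x := by
    simpa using hk 2
  have hx5 : iteratedDeriv 5 (w (Φ.T t)) (x / Y t) = κ * Y t ^ 6 * iteratedDeriv 5 (v t) x := by
    simpa using hk 4
  have hxv : Dx v t x = deriv (v t) x := rfl
  rw [hx1] at h1
  simp only [id, hxv] at h1
  have key : E.α t / (κ * Y t ^ 2) * E'.lhs w (Φ.T t) (x / Y t) = κ * Y t * E.lhs v t x := by
    simp only [Equation.lhs, Dx_iterate_eq_iteratedDeriv, hα t ht, hβ t ht, hσ t ht, hx1, hx3,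
      hx5, hxv, hw0]
    have e : E.α t / (κ * Y t ^ 2) * (Dt w (Φ.T t) (x / Y t)
        + 1 * (κ * (Y t * v t x - γ * x)) * (κ * Y t ^ 2 * deriv (v t) x - κ * γ * Y t)
        + κ * E.β t / (E.α t * Y t) * (κ * Y t ^ 4 * iteratedDeriv 3 (v t) x)
        + κ * E.σ t / (E.α t * Y t ^ 3) * (κ * Y t ^ 6 * iteratedDeriv 5 (v t) x))
        = E.α t / (κ * Y t ^ 2) * Dt w (Φ.T t) (x / Y t)
          + κ * E.α t * (Y t * v t x - γ * x) * (deriv (v t) x - γ / Y t)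
          + κ * Y t * E.β t * iteratedDeriv 3 (v t) x
          + κ * Y t * E.σ t * iteratedDeriv 5 (v t) x := by
      field_simp
    rw [e, eq_sub_of_add_eq h1]
    field_simp
    ring
  rw [hX t ht]
  have hne1 : E.α t / (κ * Y t ^ 2) ≠ 0 :=
    div_ne_zero hα0 (mul_ne_zero hκ (pow_ne_zero 2 hY0t))
  have hne2 : κ * Y t ≠ 0 := mul_ne_zero hκ hY0t
  constructor
  · intro h
    rw [h, mul_zero] at key
    exact (mul_eq_zero.1 key).resolve_left hne1
  · intro h
    rw [h, mul_zero] at key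
    exact (mul_eq_zero.1 key.symm).resolve_left hne2

/-! ## Normal forms of quadratic polynomials -/

theorem exists_sign {J : Set ℝ} (hJ : J.OrdConnected) {f : ℝ → ℝ} (hf : Continuous f)
    (h : ∀ s ∈ J, f s ≠ 0) : ∃ ε : ℝ, ε ≠ 0 ∧ ∀ s ∈ J, 0 < ε * f s := by
  by_cases hpos : ∀ s ∈ J, 0 < f s
  · exact ⟨1, one_ne_zero, fun s hs => by simpa using hpos s hs⟩
  · push Not at hpos
    obtain ⟨s₀, h₀, hs₀⟩ := hpos
    refine ⟨-1, by norm_num, fun s hs => ?_⟩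
    by_contra hcon
    have hs' : 0 ≤ f s := by linarith
    obtain ⟨z, hz, hz0⟩ := hJ.isPreconnected.intermediate_value h₀ hs hf.continuousOn ⟨hs₀, hs'⟩
    exact h z hz hz0

/-- The fractional linear function `(a s + b) / (c' s + d)` reduces the quadratic polynomial
`c s² + p s + r` with the scaling parameter `m` to a case of the classification list on `J`. -/
structure IsReduction (J : Set ℝ) (c p r m : ℝ) (k : TableCase) (a b c' d κ : ℝ) : Prop where
  admissible : k.Admissible
  det_ne : a * d - b * c' ≠ 0
  denom_ne : ∀ s ∈ J, c' * s + d ≠ 0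
  mem_domain : ∀ s ∈ J, (a * s + b) / (c' * s + d) ∈ k.domain
  factor_ne : κ ≠ 0
  -- With `T = (a s + b)/(c' s + d)` and `T' = (a d - b c')/(c' s + d)²`, this says that `T` carries
  -- `q ∂_s` to `κ` times the listed field.
  tau_eq : ∀ s, κ * (k.lead * (a * s + b) ^ 2 + k.mid * (a * s + b) * (c' * s + d)
    + k.free * (c' * s + d) ^ 2) = (a * d - b * c') * (c * s ^ 2 + p * s + r)
  weight_eq : κ * k.weight = m

theorem exists_linear_factors {c p r : ℝ} (hD : 0 < p ^ 2 - 4 * c * r) :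
    ∃ a₁ b₁ a₂ b₂ : ℝ, a₁ * b₂ - b₁ * a₂ ≠ 0 ∧
      ∀ s, (a₁ * s + b₁) * (a₂ * s + b₂) = c * s ^ 2 + p * s + r := by
  by_cases hc : c = 0
  · subst hc
    refine ⟨p, r, 0, 1, ?_, fun s => by ring⟩
    rintro h
    simp at h
    simp [h] at hD
  · have hw := Real.sq_sqrt hD.le
    have hw0 := (Real.sqrt_pos.2 hD).ne'
    set w := Real.sqrt (p ^ 2 - 4 * c * r)
    refine ⟨c, (p - w) / 2, 1, (p + w) / (2 * c), ?_, fun s => ?_⟩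
    · have : c * ((p + w) / (2 * c)) - (p - w) / 2 * 1 = w := by field_simp; ring
      rwa [this]
    · field_simp
      linear_combination -hw

/-- The sign of the discriminant selects the case. The choices left over, reflection or interchange
of the roots, put the parameter into its admissible range. -/
theorem exists_reduction {J : Set ℝ} (hJ : J.OrdConnected) (hne : J.Nonempty) {c p r m : ℝ}
    (hq : ∀ s ∈ J, c * s ^ 2 + p * s + r ≠ 0) :
    ∃ (k : TableCase) (a b c' d κ : ℝ), IsReduction J c p r m k a b c' d κ := by
  rcases lt_trichotomy (p ^ 2 - 4 * c * r) 0 with hD | hD | hD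
  · have hc : c ≠ 0 := by
      rintro rfl
      nlinarith [sq_nonneg p]
    set D := p ^ 2 - 4 * c * r with hD_def
    have hw := Real.sq_sqrt (show 0 ≤ -D by linarith)
    have hw0 := (Real.sqrt_pos.2 (show 0 < -D by linarith))
    set v := Real.sqrt (-D)
    obtain ⟨h, hh, hm⟩ : ∃ h : ℝ, h ^ 2 = 1 ∧ 0 ≤ h * m := by
      rcases le_total 0 m with h1 | h1
      · exact ⟨1, by norm_num, by linarith⟩
      · exact ⟨-1, by norm_num, by linarith⟩
    have hh0 : h ≠ 0 := by rintro rfl; norm_num at hh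
    -- Here `T = h (2cs + p)/v` carries the complex roots to ±i, and the sign `h` makes `ν`
    -- nonnegative.
    refine ⟨TableCase.arctangent (2 * (h * m) / v), h, h * p / (2 * c), 0, v / 2 / c,
      h * v / 2, ?_, ?_, ?_, ?_, ?_, ?_, ?_⟩
    · change 0 ≤ _
      positivity
    · simp [hh0, hw0.ne', hc]
    · intro s _
      simp [hw0.ne', hc]
    · exact fun _ _ => mem_univ _
    · positivity
    · intro s
      simp only [TableCase.lead, TableCase.mid, TableCase.free]
      field_simp
      linear_combination v * (2 * s * c + p) ^ 2 * hh + v * hw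
    · simp only [TableCase.weight]
      field_simp
      linear_combination m * hh
  · by_cases hc : c = 0
    · subst hc
      have hp : p = 0 := by simpa using hD
      subst hp
      obtain ⟨s₀, h₀⟩ := hne
      have hr : r ≠ 0 := by simpa using hq s₀ h₀
      by_cases hm : m = 0
      · subst hm
        refine ⟨TableCase.constant, 1, 0, 0, 1, r, trivial, by norm_num, fun s _ => by norm_num,
          fun _ _ => mem_univ _, hr, fun s => ?_, by simp [TableCase.weight]⟩
        simp only [TableCase.lead, TableCase.mid, TableCase.free]; ring
      · refine ⟨TableCase.exponential, 3 * m / r, 0, 0, 1, m, trivial, by simp [hm, hr],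
          fun s _ => by norm_num, fun _ _ => mem_univ _, hm, fun s => ?_,
          by simp [TableCase.weight]⟩
        simp only [TableCase.lead, TableCase.mid, TableCase.free]; field_simp; ring
    · have hsq : ∀ s, c * s ^ 2 + p * s + r = c * (s + p / (2 * c)) ^ 2 := by
        intro s; field_simp; linear_combination -hD
      have hden : ∀ s ∈ J, 1 * s + p / (2 * c) ≠ 0 := by
        intro s hs h0
        rw [one_mul] at h0
        exact hq s hs (by rw [hsq, h0]; ring)
      by_cases hm : m = 0
      · subst hm
        -- The inversion `T = 1/(s + p/(2c))` sends the double root to infinity and turns `q ∂_s`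
        -- into `-c ∂_T`.
        refine ⟨TableCase.constant, 0, 1, 1, p / (2 * c), -c, trivial, by norm_num, hden,
          fun _ _ => mem_univ _, neg_ne_zero.2 hc, fun s => ?_, by simp [TableCase.weight]⟩
        rw [hsq]
        simp only [TableCase.lead, TableCase.mid, TableCase.free]; ring
      · refine ⟨TableCase.exponential, 0, -3 * m / c, 1, p / (2 * c), m, trivial,
          by simp [hm, hc], hden, fun _ _ => mem_univ _, hm, fun s => ?_,
          by simp [TableCase.weight]⟩
        rw [hsq]
        simp only [TableCase.lead, TableCase.mid, TableCase.free]; field_simp; ring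
  · obtain ⟨a₁, b₁, a₂, b₂, hdet, hfac⟩ : ∃ a₁ b₁ a₂ b₂ : ℝ, (a₁ * b₂ - b₁ * a₂ ≠ 0 ∧
        0 ≤ m / (a₁ * b₂ - b₁ * a₂)) ∧
        ∀ s, (a₁ * s + b₁) * (a₂ * s + b₂) = c * s ^ 2 + p * s + r := by
      obtain ⟨a₁, b₁, a₂, b₂, hdet, hfac⟩ := exists_linear_factors hD
      rcases le_total 0 (m / (a₁ * b₂ - b₁ * a₂)) with h | h
      · exact ⟨a₁, b₁, a₂, b₂, ⟨hdet, h⟩, hfac⟩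
      -- Interchanging the factors replaces `T` by `1/T` and reverses the sign of the determinant,
      -- hence of `ρ - 1/2`.
      · have e : a₂ * b₁ - b₂ * a₁ = -(a₁ * b₂ - b₁ * a₂) := by ring
        refine ⟨a₂, b₂, a₁, b₁, ⟨?_, ?_⟩, fun s => by rw [← hfac]; ring⟩
        · rw [e]; exact neg_ne_zero.2 hdet
        · rw [e, div_neg]; linarith
    obtain ⟨hdet, hsign⟩ := hdet
    obtain ⟨ε, hε, hεpos⟩ := exists_sign hJ
      (by fun_prop : Continuous fun s : ℝ => c * s ^ 2 + p * s + r) hq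
    have hden : ∀ s ∈ J, a₂ * s + b₂ ≠ 0 := fun s hs h0 =>
      hq s hs (by rw [← hfac, h0, mul_zero])
    set Δ := a₁ * b₂ - b₁ * a₂ with hΔ
    -- The roots go to 0 and ∞, and `ε` makes `T` positive on `J`. The field `3T ∂_T` forces `κ =
    -- Δ/3`, and then `κ (ρ - 1/2) = m` determines `ρ`.
    refine ⟨TableCase.power (1 / 2 + 3 * (m / Δ)), ε * a₁, ε * b₁, a₂, b₂, Δ / 3, ?_, ?_, hden, ?_,
      by positivity, fun s => ?_, ?_⟩
    · change 1 / 2 ≤ _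
      linarith
    · have : ε * a₁ * b₂ - ε * b₁ * a₂ = ε * Δ := by rw [hΔ]; ring
      rw [this]; exact mul_ne_zero hε hdet
    · intro s hs
      change (0 : ℝ) < (ε * a₁ * s + ε * b₁) / (a₂ * s + b₂)
      have h1 := hden s hs
      have h2 : (ε * a₁ * s + ε * b₁) / (a₂ * s + b₂)
          = ε * (c * s ^ 2 + p * s + r) / (a₂ * s + b₂) ^ 2 := by
        rw [← hfac]; field_simp
      rw [h2]
      have := hεpos s hs
      positivity
    · rw [← hfac]
      simp only [TableCase.lead, TableCase.mid, TableCase.free]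
      rw [hΔ]; ring
    · simp only [TableCase.weight]
      field_simp
      ring

/-! ## Reduction to the classification list -/

/-- Negative numbers have real fifth roots too, so the factor in `σ` can always be scaled to 1. -/
theorem exists_pow_five_eq (y : ℝ) : ∃ e : ℝ, e ^ 5 = y := by
  have key (z : ℝ) (hz : 0 ≤ z) : ∃ e : ℝ, e ^ 5 = z :=
    ⟨z ^ (((5 : ℕ) : ℝ)⁻¹), Real.rpow_inv_natCast_pow hz (by norm_num)⟩
  rcases le_total 0 y with h | h
  · exact key y h
  · obtain ⟨e, he⟩ := key (-y) (by linarith)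
    exact ⟨-e, by linear_combination -he⟩

namespace IsReduction

variable {J : Set ℝ} {c p r m : ℝ} {k : TableCase} {a b c' d κ : ℝ}

theorem tau_comp (h : IsReduction J c p r m k a b c' d κ) {s : ℝ} (hs : s ∈ J) :
    κ * (k.lead * ((a * s + b) / (c' * s + d)) ^ 2 + k.mid * ((a * s + b) / (c' * s + d)) + k.free)
      * (c' * s + d) ^ 2 = (a * d - b * c') * (c * s ^ 2 + p * s + r) := by
  have hY := h.denom_ne s hs
  rw [← h.tau_eq s]
  generalize c' * s + d = Y at hY ⊢
  field_simp

theorem tau_deriv_comp (h : IsReduction J c p r m k a b c' d κ) {s : ℝ} (hs : s ∈ J) :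
    κ * (2 * k.lead * ((a * s + b) / (c' * s + d)) + k.mid) * (c' * s + d)
      = (c' * s + d) * (2 * c * s + p) - 2 * c' * (c * s ^ 2 + p * s + r) := by
  have hY := h.denom_ne s hs
  have e : κ * (2 * k.lead * ((a * s + b) / (c' * s + d)) + k.mid) * (c' * s + d)
      = κ * (2 * k.lead * (a * s + b) + k.mid * (c' * s + d)) := by
    generalize c' * s + d = Y at hY ⊢
    field_simp
  rw [e]
  refine mul_left_cancel₀ h.det_ne ?_
  -- For a quadratic polynomial the symmetric difference with step 1 is the exact derivative, so
  -- `tau_eq` is differentiated algebraically.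
  linear_combination (c' * s + d) * (h.tau_eq (s + 1) - h.tau_eq (s - 1)) / 2
    - 2 * c' * h.tau_eq s

/-- Both `g ∘ T` and `f/α` satisfy first-order linear equations related by `T`; the power of the
denominator accounts for the transformation of `q'/2`. Thus the logarithmic derivative of the
quotient is zero. It serves `β` with `n = 0`, `μ = 3` and `σ` with `n = 2`, `μ = 5`. -/
theorem shape_const {E : Equation} {A : ℝ → ℝ} (hA : ∀ t ∈ E.dom, HasDerivAt A (E.α t) t)
    (h : IsReduction (A '' E.dom) c p r m k a b c' d κ)
    (hq : ∀ t ∈ E.dom, c * A t ^ 2 + p * A t + r ≠ 0) {g f : ℝ → ℝ} {n : ℕ} {μ : ℝ}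
    (hg : ∀ s ∈ k.domain, ∃ g', HasDerivAt g g' s ∧ (k.lead * s ^ 2 + k.mid * s + k.free) * g'
      = (μ * k.weight + (n + 1) * (k.mid / 2 + k.lead * s)) * g s)
    (hf : ∀ t ∈ E.dom, HasDerivAt f (deriv f t) t) (hf0 : ∀ t ∈ E.dom, f t ≠ 0)
    (hcl : ∀ t ∈ E.dom, (c * A t ^ 2 + p * A t + r) * (deriv f t * E.α t - deriv E.α t * f t)
      = (μ * m + (n + 1) * (p / 2 + c * A t)) * E.α t ^ 2 * f t) :
    ∃ C, ∀ t ∈ E.dom, g ((a * A t + b) / (c' * A t + d)) * (c' * A t + d) ^ (n + 1) * E.α t / f t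
      = C := by
  refine E.exists_eq_const fun t ht => ?_
  have hAt := hA t ht
  have hmem : A t ∈ A '' E.dom := mem_image_of_mem _ ht
  have hY := h.denom_ne _ hmem
  obtain ⟨g', hg1, hg2⟩ := hg _ (h.mem_domain _ hmem)
  have hP : HasDerivAt (fun t => a * A t + b) (a * E.α t) t := (hAt.const_mul a).add_const b
  have hYd : HasDerivAt (fun t => c' * A t + d) (c' * E.α t) t := (hAt.const_mul c').add_const d
  have hT : HasDerivAt (fun t => (a * A t + b) / (c' * A t + d))
      ((a * d - b * c') * E.α t / (c' * A t + d) ^ 2) t :=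
    (hP.div hYd hY).congr_deriv (by ring)
  have e0 := h.tau_comp hmem
  have e1 := h.tau_deriv_comp hmem
  have hgT : HasDerivAt (fun t => g ((a * A t + b) / (c' * A t + d)))
      (g' * ((a * d - b * c') * E.α t / (c' * A t + d) ^ 2)) t :=
    HasDerivAt.comp (h₂ := g) t hg1 hT
  have hfull := ((hgT.mul (hYd.pow (n + 1))).mul (E.hasDerivAt_α ht)).div (hf t ht) (hf0 t ht)
  refine hfull.congr_deriv ?_
  have hcl' := hcl t ht
  have hqt := hq t ht
  have hft := hf0 t ht
  have hw := h.weight_eq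
  simp only [Nat.add_sub_cancel, Nat.cast_add, Nat.cast_one, Pi.mul_apply]
  set Y := c' * A t + d with hY_def
  set T := (a * A t + b) / Y with hT_def
  set q := c * A t ^ 2 + p * A t + r with hq_def
  set G := g T with hG
  set qk := k.lead * T ^ 2 + k.mid * T + k.free with hqk
  have e2 : q * (g' * ((a * d - b * c') * E.α t / Y ^ 2)) = κ * E.α t * (g' * qk) := by
    field_simp
    linear_combination -g' * E.α t * e0
  rw [div_eq_zero_iff]
  left
  -- Multiplying by the nonzero `q Y` allows the classifying equations to be substituted without
  -- division.
  have e3 : q * Y * (((g' * ((a * d - b * c') * E.α t / Y ^ 2) * Y ^ (n + 1)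
      + G * (((n : ℝ) + 1) * Y ^ n * (c' * E.α t))) * E.α t + G * Y ^ (n + 1) * deriv E.α t) * f t
      - G * Y ^ (n + 1) * E.α t * deriv f t) = 0 := by
    have hg3 : g' * qk = (μ * k.weight + (n + 1) * (k.mid / 2 + k.lead * T)) * G := by
      rw [← hg2]; ring
    rw [hg3] at e2
    rw [← hw] at hcl'
    linear_combination Y * Y ^ (n + 1) * E.α t * f t * e2 - Y * G * Y ^ (n + 1) * hcl'
      + G * Y ^ (n + 1) * E.α t ^ 2 * f t * (n + 1) / 2 * e1
  exact (mul_eq_zero.1 e3).resolve_left (mul_ne_zero hqt hY)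

end IsReduction

/-- The target equation is built on the image interval from the shapes of the case. It depends on
`E` only through `A`, which lets one construction serve both equivalence groups. -/
theorem Equation.exists_normal_form (E : Equation) {A : ℝ → ℝ}
    (hA : ∀ t ∈ E.dom, HasDerivAt A (E.α t) t) (hext : E.HasExtension) :
    ∃ (k : TableCase) (l : ℝ) (E' : Equation) (a b c d e : ℝ),
      k.Admissible ∧ l ≠ 0 ∧ E'.HasForm k l 1 ∧ a * d - b * c ≠ 0 ∧ e ≠ 0 ∧
      (∀ t ∈ E.dom, c * A t + d ≠ 0) ∧
      E'.dom = (fun t => (a * A t + b) / (c * A t + d)) '' E.dom ∧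
      ∀ t ∈ E.dom,
        E'.α ((a * A t + b) / (c * A t + d)) = 1 ∧
        E'.β ((a * A t + b) / (c * A t + d))
          = e ^ 3 / (c * A t + d) * (E.β t / (E.α t * (a * d - b * c))) ∧
        E'.σ ((a * A t + b) / (c * A t + d))
          = e ^ 5 / (c * A t + d) ^ 3 * (E.σ t / (E.α t * (a * d - b * c))) := by
  obtain ⟨q₂, q₁, q₀, m, hcl, hq⟩ := E.exists_classifying hA hext
  have hAs := E.antiderivative_smooth hA
  have hconn : IsPreconnected (A '' E.dom) :=
    E.dom_interval.isPreconnected.image A hAs.continuousOn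
  obtain ⟨k, a, b, c, d, κ, hred⟩ := exists_reduction (m := m) hconn.ordConnected
    (E.dom_nonempty.image A) (by rintro _ ⟨t, ht, rfl⟩; exact hq t ht)
  have hden (t) (ht : t ∈ E.dom) : c * A t + d ≠ 0 := hred.denom_ne _ (mem_image_of_mem _ ht)
  have hmem (t) (ht : t ∈ E.dom) : (a * A t + b) / (c * A t + d) ∈ k.domain :=
    hred.mem_domain _ (mem_image_of_mem _ ht)
  obtain ⟨C₁, hC₁⟩ := hred.shape_const hA hq (n := 0) (μ := 3) (f := E.β) (g := k.betaShape)
    (fun s hs => by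
      obtain ⟨g', h1, h2⟩ := k.hasDerivAt_betaShape hs
      exact ⟨g', h1, by push_cast; linear_combination h2⟩)
    (fun t ht => E.hasDerivAt_β ht) E.β_ne
    (fun t ht => by push_cast; linear_combination (hcl t ht).1)
  obtain ⟨C₂, hC₂⟩ := hred.shape_const hA hq (n := 2) (μ := 5) (f := E.σ) (g := k.sigmaShape)
    (fun s hs => by
      obtain ⟨g', h1, h2⟩ := k.hasDerivAt_sigmaShape hs
      exact ⟨g', h1, by push_cast; linear_combination h2⟩)
    (fun t ht => E.hasDerivAt_σ ht) E.σ_ne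
    (fun t ht => by push_cast; linear_combination (hcl t ht).2)
  obtain ⟨t₀, h₀⟩ := E.dom_nonempty
  have hC₁0 : C₁ ≠ 0 := by
    rw [← hC₁ t₀ h₀]
    exact div_ne_zero (mul_ne_zero (mul_ne_zero (k.betaShape_pos (hmem t₀ h₀)).ne'
      (pow_ne_zero _ (hden t₀ h₀))) (E.α_ne t₀ h₀)) (E.β_ne t₀ h₀)
  have hC₂0 : C₂ ≠ 0 := by
    rw [← hC₂ t₀ h₀]
    exact div_ne_zero (mul_ne_zero (mul_ne_zero (k.sigmaShape_pos (hmem t₀ h₀)).ne'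
      (pow_ne_zero _ (hden t₀ h₀))) (E.α_ne t₀ h₀)) (E.σ_ne t₀ h₀)
  have hΔ := hred.det_ne
  -- This value of `e₂` cancels the constant `C₂` and the determinant, so the factor in `σ` becomes
  -- 1.
  obtain ⟨e, he⟩ := exists_pow_five_eq (C₂ * (a * d - b * c))
  have he0 : e ≠ 0 := by
    rintro rfl
    exact mul_ne_zero hC₂0 hΔ (by rw [← he]; norm_num)
  set T : ℝ → ℝ := fun t => (a * A t + b) / (c * A t + d) with hT_def
  have hTs : ContDiffOn ℝ ∞ T E.dom :=
    ((contDiffOn_const.mul hAs).add contDiffOn_const).div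
      ((contDiffOn_const.mul hAs).add contDiffOn_const) hden
  have hTd (t) (ht : t ∈ E.dom) :
      HasDerivAt T ((a * d - b * c) * E.α t / (c * A t + d) ^ 2) t :=
    ((((hA t ht).const_mul a).add_const b).div (((hA t ht).const_mul c).add_const d)
      (hden t ht)).congr_deriv (by ring)
  -- Since `T' ≠ 0`, the inverse function theorem makes `T` an open map.
  have hopen : IsOpen (T '' E.dom) := by
    rw [isOpen_iff_mem_nhds]
    rintro _ ⟨t, ht, rfl⟩
    have hs : HasStrictDerivAt T ((a * d - b * c) * E.α t / (c * A t + d) ^ 2) t :=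
      (hTs.contDiffAt (E.dom_open.mem_nhds ht)).hasStrictDerivAt' (hTd t ht) (by simp)
    rw [← hs.map_nhds_eq (div_ne_zero (mul_ne_zero hΔ (E.α_ne t ht))
      (pow_ne_zero 2 (hden t ht)))]
    exact Filter.image_mem_map (E.dom_open.mem_nhds ht)
  have hsub : T '' E.dom ⊆ k.domain := by rintro _ ⟨t, ht, rfl⟩; exact hmem t ht
  have hl0 : e ^ 3 / ((a * d - b * c) * C₁) ≠ 0 :=
    div_ne_zero (pow_ne_zero 3 he0) (mul_ne_zero hΔ hC₁0)
  let E' : Equation :=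
    { dom := T '' E.dom
      α := fun _ => 1
      β := fun t => e ^ 3 / ((a * d - b * c) * C₁) * k.betaShape t
      σ := fun t => 1 * k.sigmaShape t
      dom_open := hopen
      dom_nonempty := ⟨T t₀, mem_image_of_mem _ h₀⟩
      dom_interval := (E.dom_interval.isPreconnected.image T hTs.continuousOn).ordConnected
      α_smooth := contDiffOn_const
      β_smooth := contDiffOn_const.mul (k.betaShape_smooth.mono hsub)
      σ_smooth := contDiffOn_const.mul (k.sigmaShape_smooth.mono hsub)
      α_ne := fun _ _ => one_ne_zero
      β_ne := fun t ht => mul_ne_zero hl0 (k.betaShape_pos (hsub ht)).ne'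
      σ_ne := fun t ht => mul_ne_zero one_ne_zero (k.sigmaShape_pos (hsub ht)).ne' }
  refine ⟨k, e ^ 3 / ((a * d - b * c) * C₁), E', a, b, c, d, e, hred.admissible, hl0,
    ⟨fun _ _ => rfl, hsub, fun _ _ => ⟨rfl, rfl⟩⟩, hΔ, he0, hden, rfl, fun t ht => ⟨rfl, ?_, ?_⟩⟩
  · change e ^ 3 / ((a * d - b * c) * C₁) * k.betaShape _ = _
    have h1 := hC₁ t ht
    have hα := E.α_ne t ht
    have hβ := E.β_ne t ht
    have hY := hden t ht
    rw [zero_add, pow_one, div_eq_iff hβ] at h1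
    have h2 : k.betaShape ((a * A t + b) / (c * A t + d))
        = C₁ * E.β t / ((c * A t + d) * E.α t) := by
      rw [eq_div_iff (mul_ne_zero hY hα)]; linear_combination h1
    rw [h2]
    field_simp
  · change 1 * k.sigmaShape _ = _
    have h1 := hC₂ t ht
    have hα := E.α_ne t ht
    have hσ := E.σ_ne t ht
    have hY := hden t ht
    rw [div_eq_iff hσ] at h1
    have h2 : k.sigmaShape ((a * A t + b) / (c * A t + d))
        = C₂ * E.σ t / ((c * A t + d) ^ 3 * E.α t) := by
      rw [eq_div_iff (mul_ne_zero (pow_ne_zero 3 hY) hα)]; linear_combination h1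
    rw [h2, he]
    generalize a * d - b * c = D at hΔ ⊢
    field_simp

theorem Equation.exists_gaugedEquivalent (E : Equation) (hE : E.IsGauged)
    (hext : E.HasExtension) :
    ∃ (k : TableCase) (l δ : ℝ) (E' : Equation), k.Admissible ∧ l ≠ 0 ∧ (δ = 1 ∨ δ = -1) ∧
      E'.HasForm k l δ ∧ GaugedEquivalent E E' := by
  have hA : ∀ t ∈ E.dom, HasDerivAt (fun t => t) (E.α t) t := fun t ht => by
    rw [hE t ht]; exact hasDerivAt_id t
  obtain ⟨k, l, E', a, b, c, d, e, hk, hl, hform, hΔ, he, hden, hdom, hcoef⟩ :=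
    E.exists_normal_form hA hext
  let g : GaugedTransformation :=
    { a := a, b := b, c := c, d := d, e₀ := 0, e₁ := 0, e₂ := e, det_ne := hΔ, e₂_ne := he }
  refine ⟨k, l, 1, E', hk, hl, Or.inl rfl, hform, g, hden, ?_, fun t ht => ?_⟩
  -- Dividing by `e` makes `X = x / Y`; then `κ = e²/Δ` reproduces `T' = Δ/(c t + d)²`.
  · refine mapsEquation_of_projective (Y := fun t => (c * t + d) / e) (γ := c / e)
      (κ := e ^ 2 / (a * d - b * c)) (div_ne_zero (pow_ne_zero 2 he) hΔ)
      (fun t ht => div_ne_zero (hden t ht) he) (fun t ht => ?_) (fun t ht => ?_)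
      (fun t ht x => ?_) (fun t ht x u => ?_) hdom (fun t ht => (hcoef t ht).1)
      (fun t ht => ?_) (fun t ht => ?_)
    · exact ((((hA t ht).const_mul c).add_const d).div_const e).congr_deriv (by ring)
    · refine ((((hA t ht).const_mul a).add_const b).div (((hA t ht).const_mul c).add_const d)
        (hden t ht)).congr_deriv ?_
      have := hden t ht
      field_simp
      ring
    · change (e * x + 0 * t + 0) / (c * t + d) = _
      have := hden t ht
      field_simp
      ring
    · change (e * (c * t + d) * u - e * c * x - 0 * c + 0 * d) / (a * d - b * c) = _
      field_simp
      ring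
    · refine (hcoef t ht).2.1.trans ?_
      have := hden t ht
      have := E.α_ne t ht
      field_simp
    · refine (hcoef t ht).2.2.trans ?_
      have := hden t ht
      have := E.α_ne t ht
      field_simp
  · have := hcoef t ht
    rw [hE t ht, one_mul] at this
    exact this.2

theorem Equation.exists_extendedEquivalent (E : Equation) (hext : E.HasExtension) :
    ∃ (k : TableCase) (l δ : ℝ) (E' : Equation), k.Admissible ∧ l ≠ 0 ∧ (δ = 1 ∨ δ = -1) ∧
      E'.HasForm k l δ ∧ ExtendedEquivalent E E' := by
  obtain ⟨A, hA⟩ := E.exists_antiderivative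
  have hAs := E.antiderivative_smooth hA
  obtain ⟨k, l, E', a, b, c, d, e, hk, hl, hform, hΔ, he, hden, hdom, hcoef⟩ :=
    E.exists_normal_form hA hext
  have hcd : c ^ 2 + d ^ 2 ≠ 0 := by
    intro h
    have hc : c = 0 := by nlinarith [sq_nonneg c, sq_nonneg d]
    have hd : d = 0 := by nlinarith [sq_nonneg c, sq_nonneg d]
    exact hΔ (by rw [hc, hd]; ring)
  have hnd : e ^ 2 / (a * d - b * c) * ((c / e) ^ 2 + (d / e) ^ 2) ≠ 0 := by
    have : e ^ 2 / (a * d - b * c) * ((c / e) ^ 2 + (d / e) ^ 2)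
        = (c ^ 2 + d ^ 2) / (a * d - b * c) := by field_simp
    rw [this]
    exact div_ne_zero hcd hΔ
  let g : ExtendedTransformation :=
    { T := fun t => (a * A t + b) / (c * A t + d)
      δ₀ := 0, δ₁ := 0, δ₂ := e ^ 2 / (a * d - b * c), δ₃ := c / e, δ₄ := d / e
      nondegenerate := hnd }
  have hY (t : ℝ) : g.δ₃ * A t + g.δ₄ = (c * A t + d) / e := by
    change c / e * A t + d / e = _
    ring
  have hX₁ (t : ℝ) : g.X₁ A t = e / (c * A t + d) := by
    rw [ExtendedTransformation.X₁, hY, inv_div]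
  have hT (t) (ht : t ∈ E.dom) :
      HasDerivAt g.T ((a * d - b * c) * E.α t / (c * A t + d) ^ 2) t :=
    ((((hA t ht).const_mul a).add_const b).div (((hA t ht).const_mul c).add_const d)
      (hden t ht)).congr_deriv (by ring)
  refine ⟨k, l, 1, E', hk, hl, Or.inl rfl, hform, g, A, hA, fun t ht => ?_, ?_, fun t ht => ?_,
    ?_, fun t ht => ?_⟩
  · rw [hY]; exact div_ne_zero (hden t ht) he
  · exact ((contDiffOn_const.mul hAs).add contDiffOn_const).div
      ((contDiffOn_const.mul hAs).add contDiffOn_const) hden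
  · rw [(hT t ht).deriv]
    exact div_ne_zero (mul_ne_zero hΔ (E.α_ne t ht)) (pow_ne_zero 2 (hden t ht))
  · refine mapsEquation_of_projective (Y := fun t => (c * A t + d) / e) (γ := c / e)
      (κ := e ^ 2 / (a * d - b * c)) (div_ne_zero (pow_ne_zero 2 he) hΔ)
      (fun t ht => div_ne_zero (hden t ht) he) (fun t ht => ?_) (fun t ht => ?_)
      (fun t ht x => ?_) (fun t ht x u => ?_) hdom (fun t ht => (hcoef t ht).1)
      (fun t ht => ?_) (fun t ht => ?_)
    · exact ((((hA t ht).const_mul c).add_const d).div_const e).congr_deriv (by ring)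
    · refine (hT t ht).congr_deriv ?_
      have := hden t ht
      field_simp
    · change (x + 0) * g.X₁ A t + 0 = _
      rw [hX₁]
      have := hden t ht
      field_simp
      ring
    · change e ^ 2 / (a * d - b * c) / g.X₁ A t * u
        - e ^ 2 / (a * d - b * c) * (c / e) * (x + 0) = _
      rw [hX₁]
      have := hden t ht
      field_simp
      ring
    · refine (hcoef t ht).2.1.trans ?_
      have := hden t ht
      have := E.α_ne t ht
      field_simp
    · refine (hcoef t ht).2.2.trans ?_
      have := hden t ht
      have := E.α_ne t ht
      field_simp
  · have h1 := hden t ht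
    have h2 := E.α_ne t ht
    obtain ⟨e1, e2, e3⟩ := hcoef t ht
    rw [(hT t ht).deriv, hX₁]
    refine ⟨e1.trans ?_, e2.trans ?_, e3.trans ?_⟩
    · change 1 = (e / (c * A t + d)) ^ 2 / (e ^ 2 / (a * d - b * c) * _) * _
      generalize a * d - b * c = D at hΔ ⊢
      field_simp
    · field_simp
    · field_simp

/-! ## Inequivalence of the equations from the classification list -/

/-- The discriminant of the `t`-component of the third basis element. -/
def TableCase.disc (k : TableCase) : ℝ := k.mid ^ 2 - 4 * k.lead * k.free

/-- The discriminants are 9, 0, 0 and -4, so their sign separates all but the exponential and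
constant cases, which differ by whether the weight vanishes. Equal nonzero discriminants force `κ² =
1`, and nonnegative weights then coincide. -/
theorem TableCase.eq_of_invariants {k k' : TableCase} (hk : k.Admissible) (hk' : k'.Admissible)
    {κ : ℝ} (hκ : κ ≠ 0) (hd : k'.disc = κ ^ 2 * k.disc) (hw : k'.weight = κ * k.weight) :
    k = k' := by
  have hκ2 : 0 < κ ^ 2 := by positivity
  have sq_one (x y : ℝ) (hx : 0 ≤ x) (hy : 0 ≤ y) (h : κ ^ 2 = 1) (hxy : y = κ * x) : x = y := by
    have : y ^ 2 = x ^ 2 := by rw [hxy, mul_pow, h, one_mul]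
    exact ((sq_eq_sq₀ hy hx).1 this).symm
  cases k <;> cases k' <;>
    simp only [TableCase.disc, TableCase.lead, TableCase.mid, TableCase.free, TableCase.weight,
      TableCase.Admissible] at hk hk' hd hw
  case power.power ρ ρ' =>
    have := sq_one (ρ - 1 / 2) (ρ' - 1 / 2) (by linarith) (by linarith) (by linarith) hw
    rw [show ρ = ρ' by linarith]
  case arctangent.arctangent ν ν' =>
    rw [sq_one ν ν' hk hk' (by linarith) hw]
  case exponential.exponential => rfl
  case constant.constant => rfl
  case exponential.constant => exact absurd hw.symm (by simpa using hκ)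
  case constant.exponential => norm_num at hw
  all_goals exfalso; nlinarith

/-- A transformation with `T_t = κ₀ / Y²`, where `Y` is linear in `t`, that maps the coefficients
of an equation from the list to those of another such equation, preserves the case. -/
theorem TableCase.eq_of_projective {k k' : TableCase} {l δ l' δ' : ℝ} {E E' : Equation}
    (hk : k.Admissible) (hk' : k'.Admissible) (h : E.HasForm k l δ) (h' : E'.HasForm k' l' δ')
    {T Y : ℝ → ℝ} {γ κ₀ κ₁ κ₂ : ℝ} (hκ₀ : κ₀ ≠ 0) (hκ₁ : κ₁ ≠ 0) (hκ₂ : κ₂ ≠ 0)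
    (hTdom : ∀ t ∈ E.dom, T t ∈ E'.dom)
    (hY0 : ∀ t ∈ E.dom, Y t ≠ 0) (hY : ∀ t ∈ E.dom, HasDerivAt Y γ t)
    (hT : ∀ t ∈ E.dom, HasDerivAt T (κ₀ / Y t ^ 2) t)
    (hβ : ∀ t ∈ E.dom, E'.β (T t) = κ₁ * (E.β t / Y t))
    (hσ : ∀ t ∈ E.dom, E'.σ (T t) = κ₂ * (E.σ t / Y t ^ 3)) : k = k' := by
  set q : ℝ → ℝ := fun t => k.lead * t ^ 2 + k.mid * t + k.free with hq_def
  set q' : ℝ → ℝ := fun t => k'.lead * t ^ 2 + k'.mid * t + k'.free with hq'_def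
  have hq0 (t) (ht : t ∈ E.dom) : q t ≠ 0 := k.tau_ne_zero (h.2.1 ht)
  have hq'0 (t) (ht : t ∈ E'.dom) : q' t ≠ 0 := k'.tau_ne_zero (h'.2.1 ht)
  have dq (t : ℝ) : HasDerivAt q (2 * (k.mid / 2 + k.lead * t)) t :=
    (((((hasDerivAt_id t).pow 2).const_mul k.lead).add
      ((hasDerivAt_id t).const_mul k.mid)).add_const k.free).congr_deriv (by simp; ring)
  have dq' (t : ℝ) : HasDerivAt q' (2 * (k'.mid / 2 + k'.lead * t)) t :=
    (((((hasDerivAt_id t).pow 2).const_mul k'.lead).add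
      ((hasDerivAt_id t).const_mul k'.mid)).add_const k'.free).congr_deriv (by simp; ring)
  -- the pullback of the polynomial `q'`
  set Q : ℝ → ℝ := fun t => q' (T t) * Y t ^ 2 / κ₀ with hQ_def
  -- This is half the derivative of `Q`, the quantity appearing in the classifying equations.
  set W : ℝ → ℝ := fun t => k'.mid / 2 + k'.lead * T t + γ * Y t * q' (T t) / κ₀ with hW_def
  have dQ (t) (ht : t ∈ E.dom) : HasDerivAt Q (2 * W t) t := by
    refine (((HasDerivAt.comp (h₂ := q') t (dq' (T t)) (hT t ht)).mul
      ((hY t ht).pow 2)).div_const κ₀).congr_deriv ?_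
    have := hY0 t ht
    simp only [hW_def, Nat.cast_ofNat, Nat.add_one_sub_one, pow_one, Function.comp, Pi.pow_apply]
    field_simp
  have eβ (t) (ht : t ∈ E.dom) : Q t * deriv E.β t = (3 * k'.weight + W t) * E.β t := by
    have hy := hY0 t ht
    have d1 : HasDerivAt (fun s => E'.β (T s)) _ t := HasDerivAt.comp (h₂ := E'.β) t
      (E'.hasDerivAt_β (hTdom t ht)) (hT t ht)
    have d2 : HasDerivAt (fun s => E'.β (T s)) _ t :=
      (((E.hasDerivAt_β ht).div (hY t ht) hy).const_mul κ₁).congr_of_eventuallyEq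
        (Filter.mem_of_superset (E.dom_open.mem_nhds ht) hβ)
    have e1 := d1.unique d2
    have e2 := (h'.derivs (hTdom t ht)).2.1
    rw [hβ t ht] at e2
    change q' (T t) * _ = _ at e2
    field_simp at e1 e2
    have e3 : κ₁ * (q' (T t) * Y t ^ 2 * deriv E.β t)
        = κ₁ * ((κ₀ * (3 * k'.weight + (k'.mid / 2 + k'.lead * T t)) + γ * Y t * q' (T t))
          * E.β t) := by
      linear_combination -(q' (T t) * Y t) * e1 + κ₀ / 2 * e2
    have e4 := mul_left_cancel₀ hκ₁ e3
    simp only [hQ_def, hW_def]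
    field_simp
    linear_combination 2 * e4
  have eσ (t) (ht : t ∈ E.dom) : Q t * deriv E.σ t = (5 * k'.weight + 3 * W t) * E.σ t := by
    have hy := hY0 t ht
    have d1 : HasDerivAt (fun s => E'.σ (T s)) _ t := HasDerivAt.comp (h₂ := E'.σ) t
      (E'.hasDerivAt_σ (hTdom t ht)) (hT t ht)
    have d2 : HasDerivAt (fun s => E'.σ (T s)) _ t :=
      (((E.hasDerivAt_σ ht).div ((hY t ht).pow 3) (pow_ne_zero 3 hy)).const_mul
        κ₂).congr_of_eventuallyEq (Filter.mem_of_superset (E.dom_open.mem_nhds ht) hσ)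
    have e1 := d1.unique d2
    have e2 := (h'.derivs (hTdom t ht)).2.2
    rw [hσ t ht] at e2
    change q' (T t) * _ = _ at e2
    simp only [Nat.cast_ofNat, Pi.pow_apply, Nat.add_one_sub_one] at e1
    field_simp at e1 e2
    have e3 : κ₂ * (q' (T t) * Y t ^ 2 * deriv E.σ t)
        = κ₂ * ((κ₀ * (5 * k'.weight + 3 * (k'.mid / 2 + k'.lead * T t))
          + 3 * γ * Y t * q' (T t)) * E.σ t) := by
      linear_combination -(q' (T t) * Y t) * e1 + κ₀ / 2 * e2
    have e4 := mul_left_cancel₀ hκ₂ e3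
    simp only [hQ_def, hW_def]
    field_simp
    linear_combination 2 * e4
  -- Both `(Q, k'.weight)` and `(q, k.weight)` satisfy the equations for the same `β` and `σ`.
  -- Eliminating the derivatives gives a linear system with determinant `3 · 3 - 5 · 1 = 4`, whence
  -- `Q/q` is constant.
  have prop (t) (ht : t ∈ E.dom) : W t * q t = (k.mid / 2 + k.lead * t) * Q t ∧
      k'.weight * q t = k.weight * Q t := by
    have b0 := E.β_ne t ht
    have s0 := E.σ_ne t ht
    obtain ⟨-, f1, f2⟩ := h.derivs ht
    change q t * _ = _ at f1
    change q t * _ = _ at f2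
    have g1 : (3 * k'.weight + W t) * q t = (3 * k.weight + (k.mid / 2 + k.lead * t)) * Q t :=
      mul_right_cancel₀ b0 (by linear_combination Q t * f1 - q t * eβ t ht)
    have g2 : (5 * k'.weight + 3 * W t) * q t
        = (5 * k.weight + 3 * (k.mid / 2 + k.lead * t)) * Q t :=
      mul_right_cancel₀ s0 (by linear_combination Q t * f2 - q t * eσ t ht)
    exact ⟨by linear_combination (3 * g2 - 5 * g1) / 4, by linear_combination (3 * g1 - g2) / 4⟩
  obtain ⟨κ, hκ⟩ := E.exists_eq_const (f := fun t => Q t / q t) fun t ht =>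
    ((dQ t ht).div (dq t) (hq0 t ht)).congr_deriv (by
      rw [div_eq_zero_iff]; left; linear_combination 2 * (prop t ht).1)
  have hQq (t) (ht : t ∈ E.dom) : Q t = κ * q t := (div_eq_iff (hq0 t ht)).1 (hκ t ht)
  have hWq (t) (ht : t ∈ E.dom) : W t = κ * (k.mid / 2 + k.lead * t) := by
    refine mul_right_cancel₀ (hq0 t ht) ?_
    rw [(prop t ht).1, hQq t ht]; ring
  obtain ⟨t, ht⟩ := E.dom_nonempty
  have hy := hY0 t ht
  have hκ0 : κ ≠ 0 := by
    rintro rfl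
    have := hQq t ht
    rw [zero_mul] at this
    exact div_ne_zero (mul_ne_zero (hq'0 _ (hTdom t ht)) (pow_ne_zero 2 hy)) hκ₀ this
  have hweight : k'.weight = κ * k.weight := by
    refine mul_right_cancel₀ (hq0 t ht) ?_
    rw [(prop t ht).2, hQq t ht]; ring
  -- the second derivative of the pullback
  have hlead : k'.lead * κ₀ / Y t ^ 2 + γ ^ 2 * q' (T t) / κ₀
      + 2 * γ * (k'.mid / 2 + k'.lead * T t) / Y t = κ * k.lead := by
    have d1 : HasDerivAt W _ t := ((((hT t ht).const_mul k'.lead).const_add (k'.mid / 2)).add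
      ((((hY t ht).const_mul γ).mul
        (HasDerivAt.comp (h₂ := q') t (dq' (T t)) (hT t ht))).div_const κ₀))
    have d2 : HasDerivAt W _ t :=
      ((((hasDerivAt_id t).const_mul k.lead).const_add (k.mid / 2)).const_mul
        κ).congr_of_eventuallyEq (Filter.mem_of_superset (E.dom_open.mem_nhds ht) hWq)
    have e := d1.unique d2
    simp only [mul_one, Function.comp] at e
    rw [← e]
    field_simp
    ring
  refine TableCase.eq_of_invariants hk hk' hκ0 ?_ hweight
  -- For a quadratic `Q` with `W = Q'/2` the discriminant is `Q'² - 2 Q Q'' = 4 (W² - Q W')`;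
  -- evaluated through `T`, the same expression reduces to `k'.disc`.
  have hq2 : κ ^ 2 * k.disc = 4 * (W t ^ 2 - Q t * (κ * k.lead)) := by
    rw [hWq t ht, hQq t ht]
    simp only [TableCase.disc, hq_def]
    ring
  rw [hq2, ← hlead]
  simp only [hQ_def, hW_def, TableCase.disc]
  field_simp
  simp only [hq'_def]
  ring

theorem TableCase.eq_of_gaugedEquivalent {k k' : TableCase} {l δ l' δ' : ℝ} {E E' : Equation}
    (hk : k.Admissible) (hk' : k'.Admissible) (h : E.HasForm k l δ) (h' : E'.HasForm k' l' δ')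
    (he : GaugedEquivalent E E') : k = k' := by
  obtain ⟨g, hden, hmap, hcoef⟩ := he
  have hΔ : g.Δ ≠ 0 := g.det_ne
  have he₂ := g.e₂_ne
  refine TableCase.eq_of_projective hk hk' h h' (T := g.point.T) (Y := fun t => g.c * t + g.d)
    (γ := g.c) (κ₀ := g.Δ) (κ₁ := g.e₂ ^ 3 / g.Δ) (κ₂ := g.e₂ ^ 5 / g.Δ) hΔ
    (div_ne_zero (pow_ne_zero 3 he₂) hΔ) (div_ne_zero (pow_ne_zero 5 he₂) hΔ)
    (fun t ht => by rw [hmap.1]; exact mem_image_of_mem _ ht) hden (fun t _ => ?_)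
    (fun t ht => ?_) (fun t ht => ?_) (fun t ht => ?_)
  · exact (((hasDerivAt_id t).const_mul g.c).add_const g.d).congr_deriv (mul_one _)
  · refine ((((hasDerivAt_id t).const_mul g.a).add_const g.b).div
      (((hasDerivAt_id t).const_mul g.c).add_const g.d) (hden t ht)).congr_deriv ?_
    simp only [GaugedTransformation.Δ, id]
    ring
  · rw [(hcoef t ht).1]; ring
  · rw [(hcoef t ht).2]; ring

/-- With `α = 1` on both sides the transformation rule for `α` forces `T_t = (X¹)²/δ₂`, and `1/X¹`
is affine in `t`. The arbitrary function `T` is therefore projective. -/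
theorem TableCase.eq_of_extendedEquivalent {k k' : TableCase} {l δ l' δ' : ℝ} {E E' : Equation}
    (hk : k.Admissible) (hk' : k'.Admissible) (h : E.HasForm k l δ) (h' : E'.HasForm k' l' δ')
    (he : ExtendedEquivalent E E') : k = k' := by
  obtain ⟨g, A, hA, hden, hTs, hT0, hmap, hcoef⟩ := he
  have hδ₂ : g.δ₂ ≠ 0 := left_ne_zero_of_mul g.nondegenerate
  have hTdom : ∀ t ∈ E.dom, g.T t ∈ E'.dom := fun t ht => by
    rw [hmap.1]; exact mem_image_of_mem (g.point A).T ht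
  have hT' (t) (ht : t ∈ E.dom) : deriv g.T t = g.δ₂⁻¹ / (g.δ₃ * A t + g.δ₄) ^ 2 := by
    have e := (hcoef t ht).1
    have h0 := hT0 t ht
    have h1 := hden t ht
    rw [h.1 t ht, h'.1 _ (hTdom t ht), ExtendedTransformation.X₁] at e
    field_simp at e ⊢
    linear_combination e
  refine TableCase.eq_of_projective hk hk' h h' (T := g.T) (Y := fun t => g.δ₃ * A t + g.δ₄)
    (γ := g.δ₃) (κ₀ := g.δ₂⁻¹) (κ₁ := g.δ₂) (κ₂ := g.δ₂) (inv_ne_zero hδ₂) hδ₂ hδ₂ hTdom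
    hden (fun t ht => ?_) (fun t ht => ?_) (fun t ht => ?_) (fun t ht => ?_)
  · exact (((hA t ht).const_mul g.δ₃).add_const g.δ₄).congr_deriv (by rw [h.1 t ht, mul_one])
  · rw [← hT' t ht]
    exact ((hTs.contDiffAt (E.dom_open.mem_nhds ht)).differentiableAt (by simp)).hasDerivAt
  · have h1 := hden t ht
    rw [(hcoef t ht).2.1, hT' t ht, ExtendedTransformation.X₁]
    field_simp
  · have h1 := hden t ht
    rw [(hcoef t ht).2.2, hT' t ht, ExtendedTransformation.X₁]
    field_simp

end Kawahara

/-! ### Assembly of the classification theorem -/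

theorem theorem5 :
    -- the kernel algebra of the gauged class
    (∀ I : Set ℝ, IsOpen I → I.Nonempty → I.OrdConnected →
      Kawahara.kernelAlgebra I (fun _ => 1)
          = Submodule.span ℝ {Kawahara.translation I, Kawahara.boost I fun t => t} ∧
        Module.finrank ℝ (Kawahara.kernelAlgebra I (fun _ => 1)) = 2) ∧
    -- the kernel algebra of the class with variable `α`
    (∀ (I : Set ℝ) (α A : ℝ → ℝ), IsOpen I → I.Nonempty → I.OrdConnected →
      ContDiffOn ℝ ∞ α I → (∀ t ∈ I, α t ≠ 0) → (∀ t ∈ I, HasDerivAt A (α t) t) →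
      Kawahara.kernelAlgebra I α
          = Submodule.span ℝ {Kawahara.translation I, Kawahara.boost I A} ∧
        Module.finrank ℝ (Kawahara.kernelAlgebra I α) = 2) ∧
    -- the maximal Lie invariance algebras of the equations from the list
    (∀ (k : Kawahara.TableCase) (l δ : ℝ) (E : Kawahara.Equation),
      k.Admissible → l ≠ 0 → δ ≠ 0 → E.HasForm k l δ →
      E.HasExtension ∧
      E.maxAlgebra = Submodule.span ℝ {Kawahara.translation E.dom,
        Kawahara.boost E.dom (fun t => t), Kawahara.fieldOn E.dom k.generator} ∧
      Module.finrank ℝ E.maxAlgebra = 3) ∧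
    -- the list is exhaustive for the gauged class
    (∀ E : Kawahara.Equation, E.IsGauged → E.HasExtension →
      Module.finrank ℝ E.maxAlgebra = 3 ∧
      ∃ (k : Kawahara.TableCase) (l δ : ℝ) (E' : Kawahara.Equation),
        k.Admissible ∧ l ≠ 0 ∧ (δ = 1 ∨ δ = -1) ∧ E'.HasForm k l δ ∧
        Kawahara.GaugedEquivalent E E') ∧
    -- the list is exhaustive for the class with variable `α`
    (∀ E : Kawahara.Equation, E.HasExtension →
      Module.finrank ℝ E.maxAlgebra = 3 ∧
      ∃ (k : Kawahara.TableCase) (l δ : ℝ) (E' : Kawahara.Equation),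
        k.Admissible ∧ l ≠ 0 ∧ (δ = 1 ∨ δ = -1) ∧ E'.HasForm k l δ ∧
        Kawahara.ExtendedEquivalent E E') ∧
    -- different cases of the list, and different values of `ρ` or `ν`, are inequivalent
    (∀ (k k' : Kawahara.TableCase) (l δ l' δ' : ℝ) (E E' : Kawahara.Equation),
      k.Admissible → k'.Admissible → l ≠ 0 → δ ≠ 0 → l' ≠ 0 → δ' ≠ 0 →
      E.HasForm k l δ → E'.HasForm k' l' δ' →
      (Kawahara.GaugedEquivalent E E' ∨ Kawahara.ExtendedEquivalent E E') → k = k') := by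
  refine ⟨fun I hI hne hc => ?_, fun I α A hI hne hc hα hα0 hA => ?_,
    fun k l δ E _ _ _ h => h.maxAlgebra_eq, fun E hE hext => ⟨?_, ?_⟩, fun E hext => ⟨?_, ?_⟩,
    fun k k' l δ l' δ' E E' hk hk' _ _ _ _ h h' he => ?_⟩
  · exact Kawahara.kernelAlgebra_eq hI hne hc contDiffOn_const (fun _ _ => one_ne_zero)
      fun t _ => hasDerivAt_id t
  · exact Kawahara.kernelAlgebra_eq hI hne hc hα hα0 hA
  · exact E.finrank_maxAlgebra hext
  · exact E.exists_gaugedEquivalent hE hext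
  · exact E.finrank_maxAlgebra hext
  · exact E.exists_extendedEquivalent hext
  · rcases he with he | he
    · exact Kawahara.TableCase.eq_of_gaugedEquivalent hk hk' h h' he
    · exact Kawahara.TableCase.eq_of_extendedEquivalent hk hk' h h' he
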